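/- Let $\hbar,m>0$, let $M\subseteq\mathbb R^N$ be a connected open coordinate patch, and let $g=(g^{ij})$ be a constant symmetric invertible matrix, with $h^{ij}=g^{ij}/m$, $\surd=\sqrt{|\det g_{ij}|}$ and $dv=\surd\,d^Nx$. On a time interval $\tau<t<b$ let $A_t=A_{ti}\,dx^i$ and $U_t$ be smooth real potentials on $M$, and let $$H_t(x,p)=\tfrac12 h^{ij}(p_i+A_{ti}(x))(p_j+A_{tj}(x))+U_t(x).$$ *Labelled ensembles.* For a smooth $\eta:M\to S^1$ put $p(\eta)=-i\tfrac{\hbar}{2}\eta^{-1}d\eta$. Fix a reference set $R\subseteq M$ of non-zero Lebesgue measure. Let $B$ be the set of smooth $\xi:M\to S^1$, each given with a smooth square root $\xi^{1/2}$, such that $\sup_R p_j(\xi)=0$ for all $j$, and let $\mathcal N$ be an s-finite measure on $B$. Let $\zeta$ be a smooth real function on $M$ and, for almost every $(\xi,k)\in B\times\mathbb R^N$, let $\zeta_t[k](\xi)$ be real functions on $M$, smooth in $(t,x)$, with $\zeta_t[k](\xi)\to\zeta$ pointwise as $t\downarrow\tau$. Let $\tilde\varrho_t(\xi)(n,n')=\overline{\tilde\varrho_t(\xi)(n',n)}$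 be given for $n,n'\in\mathbb R^N$. Put $\langle x|k\rangle=e^{i(k\cdot x+\zeta(x))}\surd^{-1/2}$, $U_t[k](\xi)=e^{i(\zeta_t[k](\xi)-\zeta)}$, $$\hat\rho_t[k](\xi)=\int d^Nk'\,\tilde\varrho_t(\xi)\big(k+\tfrac{k'}2,k-\tfrac{k'}2\big)\,\xi^{1/2}\big|k+\tfrac{k'}2\big\rangle\big\langle k-\tfrac{k'}2\big|\xi^{-1/2},$$ $$\hat\rho_t=\int_B d\mathcal N(\xi)\int d^Nk\;U_t[k](\xi)\,\hat\rho_t[k](\xi)\,U_t[k](\xi)^{-1},$$ $\rho_t[k](\xi)(x)=\langle x|\hat\rho_t[k](\xi)|x\rangle$ and $p_t[k](\xi)=p\big(e^{2i(k\cdot x+\zeta_t[k](\xi))}\xi\big)$. Operators are understood through their kernels $\langle x|\cdot|y\rangle$, $x,y\in M$. It is assumed that the $k'$-integrals converge absolutely, and that the kernels of $U_t[k]\hat\rho_t[k]U_t[k]^{-1}$ are smooth in $(t,x,y)$, measurable in $(\xi,k)$, and have each derivative bounded, locally uniformly in $(t,x,y)$, by an integrable function of $(\xi,k)$. *Lie–Poisson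 equation.* Let $s(M)$ be the Lie algebra of pairs $(v,f)$ of a vector field and a function, with bracket $[(v_1,f_1),(v_2,f_2)]=([v_1,v_2],v_1f_2-v_2f_1)$. Put $J_t=(\rho_t p_t,\rho_t)$, with $\langle J_t,(w,f)\rangle=\int_M(\rho_t\,p_t\cdot w+\rho_t f)\,dv$, and $$\hat H_t=\Big(\tfrac{\partial H_t}{\partial p}(x,p_t),\;-p_t\cdot\tfrac{\partial H_t}{\partial p}(x,p_t)+H_t(x,p_t)\Big).$$ Suppose that for almost every $(\xi,k)$ the Lie–Poisson equation $\partial_tJ_t=ad^*_{\hat H_t}J_t$ holds, i.e. $\frac{d}{dt}\langle J_t,W\rangle=\langle J_t,[\hat H_t,W]\rangle$ for $\tau<t<b$ and all smooth compactly supported $W\in s(M)$. *Conclusion.* Suppose that $\hat\rho_t=|\psi_t\rangle\langle\psi_t|$ for $\tau<t<b$, i.e. $\langle x|\hat\rho_t|y\rangle=\psi_t(x)\overline{\psi_t(y)}$, with $\psi_t(x)$ smooth in $(t,x)$. Let $$\mathcal H_t=\frac1{2m}\,\surd^{-1}\big(-i\hbar\partial_i+A_{ti}\big)\,g^{ij}\surd\,\big(-i\hbar\partial_j+A_{tj}\big)+U_t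 .$$ Then, up to a phase that depends only on time (and does not change $|\psi_t\rangle\langle\psi_t|$), $\psi$ satisfies the Schrödinger equation $i\hbar\,\partial_t\psi_t=\mathcal H_t\psi_t$. Precisely: 1. if $\psi_{t_0}(x_0)\ne0$, there is a real function $\theta$, smooth at $t_0$, such that $e^{i\theta(t)}\psi_t(x)$ satisfies the Schrödinger equation for all $(t,x)$ near $(t_0,x_0)$; 2. if no $\psi_t$ vanishes to infinite order at a point of $M$, there is one smooth $\theta:(\tau,b)\to\mathbb R$ such that $e^{i\theta(t)}\psi_t$ satisfies the Schrödinger equation on all of $(\tau,b)\times M$. -/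

import Mathlib

open MeasureTheory Filter Topology Set
open scoped ContDiff

/-- Coordinates on an `N`-dimensional coordinate patch. -/
abbrev Coord (N : ℕ) : Type := Fin N → ℝ

noncomputable section

namespace Proto

variable {N : ℕ}

/-- The partial derivative `∂_j f`. -/
def pd {F : Type*} [NormedAddCommGroup F] [NormedSpace ℝ F]
    (f : Coord N → F) (j : Fin N) (x : Coord N) : F :=
  fderiv ℝ f x (Pi.single j 1)

/-! ### The Lie algebra of the semidirect product of diffeomorphisms and functions,
its dual, and the Lie-Poisson equation -/

/-- Elements `(v, U)` of the Lie algebra of `Diff(M) ⋉ C^∞(M)`: a vector field and a function. -/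
structure SAlg (N : ℕ) where
  vec : Coord N → Coord N
  fn : Coord N → ℝ

/-- The Lie bracket `[(v₁, U₁), (v₂, U₂)] = ([v₁, v₂], v₁ U₂ - v₂ U₁)`
(the functions form an abelian algebra). -/
def SAlg.bracket (V W : SAlg N) : SAlg N where
  vec := VectorField.lieBracket ℝ V.vec W.vec
  fn := fun x => fderiv ℝ W.fn x (V.vec x) - fderiv ℝ V.fn x (W.vec x)

/-- The smooth elements with compact support in `M`. -/
structure SAlg.IsTest (M : Set (Coord N)) (V : SAlg N) : Prop where
  smooth_vec : ContDiff ℝ ∞ V.vec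
  smooth_fn : ContDiff ℝ ∞ V.fn
  compact_vec : HasCompactSupport V.vec
  compact_fn : HasCompactSupport V.fn
  support_vec : tsupport V.vec ⊆ M
  support_fn : tsupport V.fn ⊆ M

/-- (Regular) elements of the dual space: a covector density and a scalar density,
both relative to the volume `dv`. -/
structure SDual (N : ℕ) where
  mom : Coord N → Coord N
  dens : Coord N → ℝ

/-- The natural pairing `⟨J, (w, f)⟩ = ∫_M (J_mom · w + J_dens f) dv` with `dv = s(x) dx`. -/
def pairing (M : Set (Coord N)) (s : Coord N → ℝ) (J : SDual N) (V : SAlg N) : ℝ :=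
  ∫ x in M, ((∑ j, J.mom x j * V.vec x j) + J.dens x * V.fn x) * s x

/-- The Lie-Poisson equation `∂_t J_t = ad^*_{Ĥ_t} J_t` on a set `T` of times, where
`⟨ad^*_V J, W⟩ = ⟨J, [V, W]⟩`. -/
def IsLiePoisson (M : Set (Coord N)) (s : Coord N → ℝ) (T : Set ℝ)
    (J : ℝ → SDual N) (Hop : ℝ → SAlg N) : Prop :=
  ∀ W : SAlg N, W.IsTest M → ∀ t ∈ T,
    HasDerivAt (fun r => pairing M s (J r) W) (pairing M s (J t) ((Hop t).bracket W)) t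

/-- The emergence-momentum `(ρ p, ρ)` of a density `ρ` and a momentum 1-form `p`. -/
def emergenceMomentum (ρ : Coord N → ℝ) (p : Coord N → Coord N) : SDual N where
  mom := fun x j => ρ x * p x j
  dens := ρ

/-- `∂H/∂p_j (x, p)` for a function `H` on the cotangent bundle. -/
def velocity (H : Coord N → Coord N → ℝ) (x p : Coord N) : Coord N :=
  fun j => pd (H x) j p

/-- The Hamiltonian operator `Ĥ = ∂𝓗/∂J = (∂H/∂p, - p · ∂H/∂p + H)` at a momentum field `p`. -/
def hamOperator (H : Coord N → Coord N → ℝ) (p : Coord N → Coord N) : SAlg N where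
  vec := fun x => velocity H x (p x)
  fn := fun x => -(∑ j, p x j * velocity H x (p x) j) + H x (p x)

/-- The canonical Hamiltonian `H(x, p) = (1/2) h^{ij} (p_i + A_i(x)) (p_j + A_j(x)) + U(x)`. -/
def canonicalHam (h : Matrix (Fin N) (Fin N) ℝ) (A : Coord N → Coord N) (U : Coord N → ℝ)
    (x p : Coord N) : ℝ :=
  (1 / 2) * (∑ i, ∑ j, h i j * (p i + A x i) * (p j + A x j)) + U x

/-! ### Sections of the trivial circle bundle -/

/-- The Einstein-de Broglie relation `p(η) = -i (ħ/2) η⁻¹ dη` for a section `η` of the trivial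
circle bundle (the value is real because `‖η‖ = 1`). -/
def momentum (hbar : ℝ) (η : Coord N → ℂ) (x : Coord N) : Coord N :=
  fun j => (-Complex.I * ((hbar / 2 : ℝ) : ℂ) * (η x)⁻¹ * pd η j x).re

/-- The background: sections `ξ` over `M` with `sup_R p_j(ξ) = 0` on the reference set `R`.
A section is given together with the smooth square root `ξ^{1/2}` that the density matrix uses. -/
structure Background (hbar : ℝ) (M R : Set (Coord N)) where
  root : Coord N → ℂ
  smooth : ContDiffOn ℝ ∞ root M
  norm_one : ∀ x ∈ M, ‖root x‖ = 1
  sup_zero : ∀ j, IsLUB ((fun x => momentum hbar (fun y => root y ^ 2) x j) '' R) 0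

/-- The section `η_t^τ(η[k]) = e^{2 i (k · x + ζ)} ξ`. -/
def sectionOf {hbar : ℝ} {M R : Set (Coord N)} (ξ : Background hbar M R) (k : Coord N)
    (ζ : Coord N → ℝ) (x : Coord N) : ℂ :=
  Complex.exp (2 * Complex.I * ((k ⬝ᵥ x + ζ x : ℝ) : ℂ)) * ξ.root x ^ 2

/-! ### Density matrices, through their integral kernels `⟨x| · |y⟩` -/

/-- The volume density `√ = √|det g_{ij}|`, for the inverse metric `g = (g^{ij})`. -/
def volDensity (g : Coord N → Matrix (Fin N) (Fin N) ℝ) (x : Coord N) : ℝ :=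
  Real.sqrt |((g x)⁻¹).det|

/-- `⟨x|k⟩ = e^{i (k · x + ζ(x))} √^{-1/2}`. -/
def ket (s : Coord N → ℝ) (ζ : Coord N → ℝ) (k x : Coord N) : ℂ :=
  Complex.exp (Complex.I * ((k ⬝ᵥ x + ζ x : ℝ) : ℂ)) * ((s x ^ (-(1 / 2) : ℝ) : ℝ) : ℂ)

/-- `⟨k|y⟩`. -/
def bra (s : Coord N → ℝ) (ζ : Coord N → ℝ) (k y : Coord N) : ℂ :=
  (starRingEnd ℂ) (ket s ζ k y)

/-- The integrand of `⟨x| ρ̂[k](ξ) |y⟩` in the variable `k'`. -/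
def labelledIntegrand {hbar : ℝ} {M R : Set (Coord N)} (s ζ₀ : Coord N → ℝ)
    (w : Coord N → Coord N → ℂ) (ξ : Background hbar M R) (k x y k' : Coord N) : ℂ :=
  w (k + (1 / 2 : ℝ) • k') (k - (1 / 2 : ℝ) • k') *
    (ξ.root x * ket s ζ₀ (k + (1 / 2 : ℝ) • k') x *
      (bra s ζ₀ (k - (1 / 2 : ℝ) • k') y * (ξ.root y)⁻¹))

/-- The kernel `⟨x| ρ̂[k](ξ) |y⟩` of
`ρ̂[k](ξ) = ∫ dk' w(k + k'/2, k - k'/2) ξ^{1/2} |k + k'/2⟩⟨k - k'/2| ξ^{-1/2}`. -/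
def labelledKernel {hbar : ℝ} {M R : Set (Coord N)} (s ζ₀ : Coord N → ℝ)
    (w : Coord N → Coord N → ℂ) (ξ : Background hbar M R) (k x y : Coord N) : ℂ :=
  ∫ k' : Coord N, labelledIntegrand s ζ₀ w ξ k x y k'

/-- The phase operator `e^{i (ζ - ζ₀)}`, acting by multiplication. -/
def phaseOp (ζ ζ₀ : Coord N → ℝ) (x : Coord N) : ℂ :=
  Complex.exp (Complex.I * ((ζ x - ζ₀ x : ℝ) : ℂ))

/-- The kernel of `U ρ̂[k](ξ) U⁻¹` with `U = e^{i (ζ - ζ₀)}`. -/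
def evolvedKernel {hbar : ℝ} {M R : Set (Coord N)} (s ζ₀ : Coord N → ℝ)
    (ζ : Coord N → ℝ) (w : Coord N → Coord N → ℂ) (ξ : Background hbar M R)
    (k x y : Coord N) : ℂ :=
  phaseOp ζ ζ₀ x * labelledKernel s ζ₀ w ξ k x y * (phaseOp ζ ζ₀ y)⁻¹

/-- The kernel `⟨x| ρ̂_t |y⟩` of the density matrix `ρ̂_t = ∫ d𝒩(ξ) ∫ dk U_t[k] ρ̂_t[k](ξ) U_t[k]⁻¹`.
-/
def densityMatrix {hbar : ℝ} {M R : Set (Coord N)} [MeasurableSpace (Background hbar M R)]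
    (𝒩 : Measure (Background hbar M R)) (s ζ₀ : Coord N → ℝ)
    (ζ : Background hbar M R → Coord N → Coord N → ℝ)
    (w : Background hbar M R → Coord N → Coord N → ℂ) (x y : Coord N) : ℂ :=
  ∫ q, evolvedKernel s ζ₀ (ζ q.1 q.2) (w q.1) q.1 q.2 x y ∂(𝒩.prod (volume : Measure (Coord N)))

/-- The emergence-density `ρ[k](ξ)(x) = ⟨x| ρ̂[k](ξ) |x⟩` (real when `w` is hermitian). -/
def emergenceDensity {hbar : ℝ} {M R : Set (Coord N)} (s ζ₀ : Coord N → ℝ)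
    (w : Coord N → Coord N → ℂ) (ξ : Background hbar M R) (k x : Coord N) : ℝ :=
  (labelledKernel s ζ₀ w ξ k x x).re

/-- The integral over `q` of the smooth functions `a q` on the open set `D` may be differentiated
under the integral sign to every order: near each point of `D` each derivative is bounded by an
integrable function of `q`. -/
structure SmoothUnderIntegral {Ω Z : Type*} [MeasurableSpace Ω] [NormedAddCommGroup Z]
    [NormedSpace ℝ Z] (P : Measure Ω) (D : Set Z) (a : Ω → Z → ℂ) : Prop where
  measurable : ∀ z ∈ D, AEStronglyMeasurable (fun q => a q z) P
  smooth : ∀ᵐ q ∂P, ContDiffOn ℝ ∞ (a q) D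
  dominated : ∀ z₀ ∈ D, ∀ n : ℕ, ∃ V ∈ 𝓝 z₀, ∃ b : Ω → ℝ, Integrable b P ∧
    ∀ᵐ q ∂P, ∀ z ∈ V, ‖iteratedFDeriv ℝ n (a q) z‖ ≤ b q

/-! ### The Schrödinger equation -/

/-- `(-iħ ∂_j + A_j) ψ`. -/
def covMomentum (hbar : ℝ) (A : Coord N → Coord N) (j : Fin N) (ψ : Coord N → ℂ)
    (x : Coord N) : ℂ :=
  -Complex.I * (hbar : ℂ) * pd ψ j x + ((A x j : ℝ) : ℂ) * ψ x

/-- `𝓗 ψ = (1/2m) √⁻¹ (-iħ ∂_i + A_i) g^{ij} √ (-iħ ∂_j + A_j) ψ + U ψ`. -/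
def schrodingerOp (hbar m : ℝ) (g : Coord N → Matrix (Fin N) (Fin N) ℝ)
    (A : Coord N → Coord N) (U : Coord N → ℝ) (ψ : Coord N → ℂ) (x : Coord N) : ℂ :=
  ((1 / (2 * m) : ℝ) : ℂ) * (((volDensity g x)⁻¹ : ℝ) : ℂ) *
      (∑ i, ∑ j, covMomentum hbar A i
        (fun y => ((g y i j * volDensity g y : ℝ) : ℂ) * covMomentum hbar A j ψ y) x) +
    ((U x : ℝ) : ℂ) * ψ x

/-- `iħ ∂_t ψ = 𝓗_t ψ` at the time `t` and the point `x`, including differentiability in time. -/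
def SchrodingerAt (hbar : ℝ) (Hop : ℝ → (Coord N → ℂ) → Coord N → ℂ) (ψ : ℝ → Coord N → ℂ)
    (t : ℝ) (x : Coord N) : Prop :=
  ∃ d : ℂ, HasDerivAt (fun r => ψ r x) d t ∧ Complex.I * (hbar : ℂ) * d = Hop t (ψ t) x

/-- `e^{iθ(t)} ψ_t`: the wave functions with the same pure state `|ψ_t⟩⟨ψ_t|`. -/
def rephase (θ : ℝ → ℝ) (ψ : ℝ → Coord N → ℂ) (t : ℝ) (x : Coord N) : ℂ :=
  Complex.exp (Complex.I * ((θ t : ℝ) : ℂ)) * ψ t x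

end Proto

end

/-!
# The Schrödinger equation from the Lie-Poisson equation of labelled ensembles

Fix a label `q = (ξ, k)` and let `u = e^{i (k · x + ζ_t)} ξ^{1/2}`, a phase factor with
`∂_j u = (i/ħ) p_j u` for the momentum `p` of the label. The kernel `K` of the evolved labelled
operator is `ρ((x + y) / 2) u(x) \overline{u(y)}` whenever the midpoint lies in `M`
(`isPhaseKernel_evolvedKernel`). Derivatives of `K` in the transverse directions
`∂/∂x_j - ∂/∂y_j` do not see `ρ`, so on the diagonal `K` and its first and second transverse
derivatives are, up to powers of `iħ/2`, the moments `ρ`, `ρ p_k` and `ρ p_k p_i`.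

The Lie-Poisson equation, tested against functions and against vector fields, is the pair of
pointwise balance laws for `ρ` and for `ρ p_i` (`mass_balance_of_isLiePoisson`,
`momentum_balance_of_isLiePoisson`). Only these three moments occur in them, and they occur
linearly. Both laws are thus linear differential equations for `K` on the diagonal (`massBalance`,
`momentumBalance`), with coefficients which do not depend on the label; they can be integrated over
the labels and hold for the kernel `ψ(x) \overline{ψ(y)}` of the density matrix.

For that kernel, let `G = iħ ∂_t ψ - 𝓗 ψ`. The first law says that `G ψ̄` is real
(`massBalance_tensorKernel`), and the second says that the transverse derivative of
`G(x) ψ̄(y) - ψ(x) Ḡ(y)` vanishes on the diagonal (`momentumBalance_tensorKernel`). Together they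
make `G / ψ` real with vanishing spatial gradient where `ψ ≠ 0` (`defect_div_of_balance`). Near
such a point `G = e(t) ψ`, and the phase `θ` with `θ' = e / ħ` removes the defect.

If no `ψ_t` has a flat point, then near any `x` some derivative `D^n ψ_t(·)(v)` does not vanish, and
the quotient `D^n G_t(·)(v) / D^n ψ_t(·)(v)` is smooth there. Its derivative vanishes on the dense
set `{ψ_t ≠ 0}`, hence everywhere, so `G_t` is a constant multiple of `ψ_t` across its zeros
(`exists_eq_const_mul_of_no_flat_point`), and the constants for the various `t` form a smooth
function of time.
-/

namespace Proto

variable {N : ℕ}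

/-! ### Differentiation under the integral sign -/

section UnderIntegral

variable {Ω Z : Type*} [MeasurableSpace Ω] [NormedAddCommGroup Z] [NormedSpace ℝ Z]
  {P : Measure Ω} {D : Set Z} {a : Ω → Z → ℂ}

lemma SmoothUnderIntegral.integrable (h : SmoothUnderIntegral P D a) {z : Z} (hz : z ∈ D) :
    Integrable (fun q => a q z) P := by
  obtain ⟨V, hV, b, hb, hbd⟩ := h.dominated z hz 0
  exact hb.mono' (h.measurable z hz)
    (hbd.mono fun q hq => by simpa using hq z (mem_of_mem_nhds hV))

/-- A directional derivative is a limit of difference quotients, so it is measurable in the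
parameter. -/
lemma SmoothUnderIntegral.aestronglyMeasurable_fderiv (hD : IsOpen D)
    (h : SmoothUnderIntegral P D a) {z : Z} (hz : z ∈ D) (v : Z) :
    AEStronglyMeasurable (fun q => fderiv ℝ (a q) z v) P := by
  have hu : Tendsto (fun n : ℕ => (1 / ((n : ℝ) + 1))) atTop (𝓝[≠] 0) :=
    tendsto_nhdsWithin_iff.2 ⟨tendsto_one_div_add_atTop_nhds_zero_nat,
      Eventually.of_forall fun n => by simp; positivity⟩
  have hc : Tendsto (fun s : ℝ => z + s • v) (𝓝[≠] 0) (𝓝 z) := by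
    have : Continuous (fun s : ℝ => z + s • v) := by fun_prop
    simpa using (this.tendsto 0).mono_left nhdsWithin_le_nhds
  obtain ⟨n₀, hn₀⟩ := eventually_atTop.1 ((hc.comp hu).eventually (hD.mem_nhds hz))
  have hu' := hu.comp (tendsto_add_atTop_nat n₀)
  refine aestronglyMeasurable_of_tendsto_ae atTop
    (f := fun n q => (1 / (((n + n₀ : ℕ) : ℝ) + 1))⁻¹ •
      (a q (z + (1 / (((n + n₀ : ℕ) : ℝ) + 1)) • v) - a q z)) (fun n => ?_) ?_
  · have := (h.measurable _ (hn₀ (n + n₀) (by omega))).sub (h.measurable _ hz)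
    exact this.const_smul (1 / (((n + n₀ : ℕ) : ℝ) + 1))⁻¹
  · filter_upwards [h.smooth] with q hq
    have hd : HasFDerivAt (a q) (fderiv ℝ (a q) z) z :=
      ((hq.contDiffAt (hD.mem_nhds hz)).differentiableAt (by simp)).hasFDerivAt
    exact (hd.hasLineDerivAt v).tendsto_slope_zero.comp hu'

lemma SmoothUnderIntegral.fderiv_apply (hD : IsOpen D) (h : SmoothUnderIntegral P D a) (v : Z) :
    SmoothUnderIntegral P D (fun q z => fderiv ℝ (a q) z v) where
  measurable z hz := h.aestronglyMeasurable_fderiv hD hz v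
  smooth := by
    filter_upwards [h.smooth] with q hq
    exact (hq.fderiv_of_isOpen hD (by simp)).clm_apply contDiffOn_const
  dominated z₀ hz₀ n := by
    obtain ⟨V, hV, b, hb, hbd⟩ := h.dominated z₀ hz₀ (n + 1)
    refine ⟨V ∩ D, inter_mem hV (hD.mem_nhds hz₀), fun q => ‖v‖ * b q, hb.const_mul _, ?_⟩
    filter_upwards [hbd, h.smooth] with q hq hs z hz
    have h1 : ContDiffAt ℝ ∞ (fderiv ℝ (a q)) z :=
      (hs.fderiv_of_isOpen hD (by simp)).contDiffAt (hD.mem_nhds hz.2)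
    calc _ ≤ ‖v‖ * ‖iteratedFDeriv ℝ n (fderiv ℝ (a q)) z‖ :=
          norm_iteratedFDeriv_clm_apply_const h1 (by exact_mod_cast le_top)
      _ ≤ _ := by
          rw [norm_iteratedFDeriv_fderiv]
          exact mul_le_mul_of_nonneg_left (hq z hz.1) (norm_nonneg _)

lemma SmoothUnderIntegral.hasDerivAt_integral (hD : IsOpen D) (h : SmoothUnderIntegral P D a)
    {z : Z} (hz : z ∈ D) (v : Z) :
    HasDerivAt (fun s : ℝ => ∫ q, a q (z + s • v) ∂P) (∫ q, fderiv ℝ (a q) z v ∂P) 0 := by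
  obtain ⟨V, hV, b, hb, hbd⟩ := (h.fderiv_apply hD v).dominated z hz 0
  have hc : Continuous (fun s : ℝ => z + s • v) := by fun_prop
  have hVD : (fun s : ℝ => z + s • v) ⁻¹' (V ∩ D) ∈ 𝓝 (0 : ℝ) :=
    hc.continuousAt.preimage_mem_nhds (by
      simpa only [zero_smul, add_zero] using inter_mem hV (hD.mem_nhds hz))
  have := hasDerivAt_integral_of_dominated_loc_of_deriv_le (μ := P) (x₀ := (0 : ℝ)) (bound := b)
    (F := fun s q => a q (z + s • v)) (F' := fun s q => fderiv ℝ (a q) (z + s • v) v) hVD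
    (by filter_upwards [hVD] with s hs using h.measurable _ hs.2)
    (by simpa using h.integrable hz)
    (by simpa using h.aestronglyMeasurable_fderiv hD hz v)
    (by
      filter_upwards [hbd] with q hq s hs
      simpa using hq _ hs.1)
    hb
    (by
      filter_upwards [h.smooth] with q hq s hs
      have hd : HasFDerivAt (a q) (fderiv ℝ (a q) (z + s • v)) (z + s • v) :=
        ((hq.contDiffAt (hD.mem_nhds hs.2)).differentiableAt (by simp)).hasFDerivAt
      have h2 : HasDerivAt (fun s : ℝ => z + s • v) v s := by
        simpa using ((hasDerivAt_id s).smul_const v).const_add z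
      exact hd.comp_hasDerivAt s h2)
  simpa using this.2

/-- Directional derivatives commute with the integral, when the integral is known to be
differentiable. -/
lemma SmoothUnderIntegral.integral_fderiv_apply (hD : IsOpen D) (h : SmoothUnderIntegral P D a)
    {c : Z → ℂ} (hc : DifferentiableOn ℝ c D) (hac : ∀ z ∈ D, ∫ q, a q z ∂P = c z)
    {z : Z} (hz : z ∈ D) (v : Z) :
    ∫ q, fderiv ℝ (a q) z v ∂P = fderiv ℝ c z v := by
  have h1 := h.hasDerivAt_integral hD hz v
  have h2 : HasDerivAt (fun s : ℝ => c (z + s • v)) (fderiv ℝ c z v) 0 :=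
    ((hc.differentiableAt (hD.mem_nhds hz)).hasFDerivAt).hasLineDerivAt v
  have hcont : ContinuousAt (fun s : ℝ => z + s • v) 0 := by fun_prop
  refine h1.unique (h2.congr_of_eventuallyEq ?_)
  filter_upwards [hcont.preimage_mem_nhds (by simpa using hD.mem_nhds hz)] with s hs
  exact hac _ hs

end UnderIntegral

/-! ### From the weak to the pointwise form of a balance law -/

section Weak

variable {M : Set (Coord N)}

lemma integrable_mul_of_hasCompactSupport (hM : IsOpen M) {f φ : Coord N → ℝ}
    (hf : ContinuousOn f M) (hφ : Continuous φ) (hc : HasCompactSupport φ)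
    (hs : tsupport φ ⊆ M) : Integrable (fun x => f x * φ x) := by
  have hsub : tsupport (fun x => f x * φ x) ⊆ tsupport φ := tsupport_mul_subset_right
  refine Continuous.integrable_of_hasCompactSupport ?_ hc.mul_left
  exact (hf.mul hφ.continuousOn).continuous_of_tsupport_subset hM (hsub.trans hs)

lemma setIntegral_mul_eq_integral_of_tsupport_subset {f φ : Coord N → ℝ} (hs : tsupport φ ⊆ M) :
    ∫ x in M, f x * φ x = ∫ x, f x * φ x := by
  refine setIntegral_eq_integral_of_forall_compl_eq_zero fun x hx => ?_
  rw [image_eq_zero_of_notMem_tsupport fun h => hx (hs h), mul_zero]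

/-- Integration by parts against a test function supported in `M`; nothing is assumed about `f`
outside `M`. -/
lemma integral_mul_pd_eq_neg (hM : IsOpen M) {f φ : Coord N → ℝ}
    (hf : ContDiffOn ℝ ∞ f M) (hφ : ContDiff ℝ ∞ φ) (hc : HasCompactSupport φ)
    (hs : tsupport φ ⊆ M) (j : Fin N) :
    ∫ x, f x * pd φ j x = -∫ x, pd f j x * φ x := by
  have hpf : ContinuousOn (pd f j) M :=
    ((hf.fderiv_of_isOpen hM (m := ∞) (by simp)).clm_apply contDiffOn_const).continuousOn
  have hpφ : ContDiff ℝ ∞ (pd φ j) := (hφ.fderiv_right (by simp)).clm_apply contDiff_const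
  have hsp : tsupport (pd φ j) ⊆ tsupport φ := tsupport_fderiv_apply_subset ℝ _
  exact integral_mul_fderiv_eq_neg_fderiv_mul_of_integrable
    (integrable_mul_of_hasCompactSupport hM hpf hφ.continuous hc hs)
    (integrable_mul_of_hasCompactSupport hM hf.continuousOn hpφ.continuous
      (hc.fderiv_apply ℝ _) (hsp.trans hs))
    (integrable_mul_of_hasCompactSupport hM hf.continuousOn hφ.continuous hc hs)
    (fun x hx => (hf.contDiffAt (hM.mem_nhds (hs hx))).differentiableAt (by simp))
    (fun x _ => hφ.differentiable (by simp) x)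

lemma hasDerivAt_integral_mul_test {T : Set ℝ} (hT : IsOpen T) (hM : IsOpen M)
    {F : ℝ × Coord N → ℝ} (hF : ContDiffOn ℝ ∞ F (T ×ˢ M)) {t : ℝ} (ht : t ∈ T)
    {φ : Coord N → ℝ} (hφ : Continuous φ) (hc : HasCompactSupport φ) (hs : tsupport φ ⊆ M) :
    HasDerivAt (fun r => ∫ x, F (r, x) * φ x)
      (∫ x, fderiv ℝ F (t, x) (1, 0) * φ x) t := by
  have hTM : IsOpen (T ×ˢ M) := hT.prod hM
  have hF' : ContinuousOn (fun z => fderiv ℝ F z (1, 0)) (T ×ˢ M) :=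
    ((hF.fderiv_of_isOpen hTM (m := ∞) (by simp)).clm_apply contDiffOn_const).continuousOn
  have hslice : ∀ r ∈ T, ContinuousOn (fun x : Coord N => (r, x)) M ∧
      MapsTo (fun x : Coord N => (r, x)) M (T ×ˢ M) := fun r hr =>
    ⟨by fun_prop, fun x hx => ⟨hr, hx⟩⟩
  obtain ⟨ε, hε, hball⟩ := Metric.nhds_basis_closedBall.mem_iff.1 (hT.mem_nhds ht)
  -- the time derivative is bounded on the compact set `closedBall t ε × tsupport φ`
  obtain ⟨C, hC⟩ := ((isCompact_closedBall t ε).prod hc.isCompact).exists_bound_of_continuousOn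
    (hF'.mono (prod_mono hball hs))
  have key := hasDerivAt_integral_of_dominated_loc_of_deriv_le (μ := (volume : Measure (Coord N)))
    (x₀ := t) (s := Metric.closedBall t ε) (bound := fun x => C * ‖φ x‖)
    (F := fun r x => F (r, x) * φ x) (F' := fun r x => fderiv ℝ F (r, x) (1, 0) * φ x)
    (Metric.closedBall_mem_nhds t hε)
    (by
      filter_upwards [hT.mem_nhds ht] with r hr
      exact (integrable_mul_of_hasCompactSupport hM (hF.continuousOn.comp (hslice r hr).1
        (hslice r hr).2) hφ hc hs).aestronglyMeasurable)
    (integrable_mul_of_hasCompactSupport hM (hF.continuousOn.comp (hslice t ht).1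
        (hslice t ht).2) hφ hc hs)
    (integrable_mul_of_hasCompactSupport hM (hF'.comp (hslice t ht).1
        (hslice t ht).2) hφ hc hs).aestronglyMeasurable
    (Eventually.of_forall fun x r hr => by
      by_cases hx : x ∈ tsupport φ
      · rw [norm_mul]
        exact mul_le_mul_of_nonneg_right (hC (r, x) ⟨hr, hx⟩) (norm_nonneg _)
      · simp [image_eq_zero_of_notMem_tsupport hx])
    ((hφ.norm.integrable_of_hasCompactSupport hc.norm).const_mul C)
    (Eventually.of_forall fun x r hr => by
      by_cases hx : x ∈ tsupport φ
      · have hd : HasFDerivAt F (fderiv ℝ F (r, x)) (r, x) :=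
          ((hF.contDiffAt (hTM.mem_nhds ⟨hball hr, hs hx⟩)).differentiableAt
            (by simp)).hasFDerivAt
        have hl : HasDerivAt (fun r : ℝ => (r, x)) ((1 : ℝ), (0 : Coord N)) r :=
          (hasDerivAt_id r).prodMk (hasDerivAt_const r x)
        exact (hd.comp_hasDerivAt r hl).mul_const _
      · simpa [image_eq_zero_of_notMem_tsupport hx] using hasDerivAt_const r (0 : ℝ))
  exact key.2

/-- A balance law `∂_t F + ∂_j X^j + Q = 0`, tested against smooth compactly supported functions,
holds at every point. -/
lemma balance_of_weak {T : Set ℝ} (hT : IsOpen T) (hM : IsOpen M)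
    {F : ℝ × Coord N → ℝ} (hF : ContDiffOn ℝ ∞ F (T ×ˢ M)) {t : ℝ} (ht : t ∈ T)
    {X : Fin N → Coord N → ℝ} (hX : ∀ j, ContDiffOn ℝ ∞ (X j) M)
    {Q : Coord N → ℝ} (hQ : ContinuousOn Q M)
    (h : ∀ φ : Coord N → ℝ, ContDiff ℝ ∞ φ → HasCompactSupport φ → tsupport φ ⊆ M →
      HasDerivAt (fun r => ∫ x in M, F (r, x) * φ x)
        (∫ x in M, ((∑ j, X j x * pd φ j x) - Q x * φ x)) t)
    {x : Coord N} (hx : x ∈ M) :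
    fderiv ℝ F (t, x) (1, 0) + (∑ j, pd (X j) j x) + Q x = 0 := by
  have hTM : IsOpen (T ×ˢ M) := hT.prod hM
  have hF' : ContinuousOn (fun x => fderiv ℝ F (t, x) (1, 0)) M :=
    ((hF.fderiv_of_isOpen hTM (m := ∞) (by simp)).clm_apply contDiffOn_const).continuousOn.comp
      (by fun_prop : ContinuousOn (fun x : Coord N => (t, x)) M) fun x hx => ⟨ht, hx⟩
  have hpX : ∀ j, ContinuousOn (pd (X j) j) M := fun j =>
    (((hX j).fderiv_of_isOpen hM (m := ∞) (by simp)).clm_apply contDiffOn_const).continuousOn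
  have hcont : ContinuousOn (fun x => fderiv ℝ F (t, x) (1, 0) + (∑ j, pd (X j) j x) + Q x) M :=
    (hF'.add (continuousOn_finsetSum _ fun j _ => hpX j)).add hQ
  have hae := hM.ae_eq_zero_of_integral_contDiff_smul_eq_zero (μ := volume)
    (hcont.locallyIntegrableOn hM.measurableSet) fun φ hφ hc hs => by
      have hsp : ∀ j, tsupport (pd φ j) ⊆ M := fun j =>
        (tsupport_fderiv_apply_subset ℝ _).trans hs
      have hpφ : ∀ j, Continuous (pd φ j) := fun j =>
        ((hφ.fderiv_right (m := ∞) (by simp)).clm_apply contDiff_const).continuous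
      have I1 : ∀ j, Integrable (fun x => X j x * pd φ j x) := fun j =>
        integrable_mul_of_hasCompactSupport hM (hX j).continuousOn (hpφ j)
          (hc.fderiv_apply ℝ _) (hsp j)
      have I2 := integrable_mul_of_hasCompactSupport hM hQ hφ.continuous hc hs
      have I3 := fun j => integrable_mul_of_hasCompactSupport hM (hpX j) hφ.continuous hc hs
      have I4 := integrable_mul_of_hasCompactSupport hM hF' hφ.continuous hc hs
      have d1 := hasDerivAt_integral_mul_test hT hM hF ht hφ.continuous hc hs
      have d2 := h φ hφ hc hs
      simp only [setIntegral_mul_eq_integral_of_tsupport_subset hs] at d2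
      rw [setIntegral_eq_integral_of_forall_compl_eq_zero (fun x hx => by
        rw [image_eq_zero_of_notMem_tsupport fun h => hx (hs h), mul_zero, sub_zero]
        exact Finset.sum_eq_zero fun j _ => by
          rw [image_eq_zero_of_notMem_tsupport fun h => hx (hsp j h), mul_zero])] at d2
      have e := d1.unique d2
      rw [integral_sub (integrable_finsetSum _ fun j _ => I1 j) I2,
        integral_finsetSum _ fun j _ => I1 j] at e
      simp only [integral_mul_pd_eq_neg hM (hX _) hφ hc hs, Finset.sum_neg_distrib] at e
      have : ∀ x, φ x • (fderiv ℝ F (t, x) (1, 0) + (∑ j, pd (X j) j x) + Q x) =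
          fderiv ℝ F (t, x) (1, 0) * φ x + (∑ j, pd (X j) j x * φ x) + Q x * φ x := fun x => by
        rw [smul_eq_mul, ← Finset.sum_mul]; ring
      simp only [this]
      have I5 : Integrable (fun x => ∑ j, pd (X j) j x * φ x) :=
        integrable_finsetSum _ fun j _ => I3 j
      have I6 : Integrable (fun x => fderiv ℝ F (t, x) (1, 0) * φ x + ∑ j, pd (X j) j x * φ x) :=
        I4.add I5
      rw [integral_add I6 I2, integral_add I4 I5,
        integral_finsetSum _ fun j _ => I3 j, e]
      ring
  have := Measure.eqOn_open_of_ae_eq (μ := (volume : Measure (Coord N)))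
    ((ae_restrict_iff' hM.measurableSet).2 hae) hM hcont continuousOn_const
  exact this hx

end Weak

/-! ### Functions proportional to a function without flat points -/

section UniqueContinuation

variable {E : Type*} [NormedAddCommGroup E] [NormedSpace ℝ E] {M : Set E} {f g : E → ℂ}

lemma exists_ne_zero_of_iteratedFDeriv_ne_zero {x : E} {n : ℕ}
    (hn : iteratedFDeriv ℝ n f x ≠ 0) {V : Set E} (hV : V ∈ 𝓝 x) : ∃ y ∈ V, f y ≠ 0 := by
  by_contra! h
  have h0 : f =ᶠ[𝓝 x] fun _ => 0 := by filter_upwards [hV] with y hy using h y hy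
  refine hn ?_
  rw [(h0.iteratedFDeriv ℝ n).eq_of_nhds]
  exact congrFun (iteratedFDeriv_fun_zero (𝕜 := ℝ) (n := n)) x

/-- If `g` is locally a constant multiple of `f` where `f ≠ 0`, then it is a constant multiple of
`f` near every point at which `f` has a non-zero derivative of some order `n`: the quotient of the
`n`-th derivatives is smooth there and has derivative zero on the dense set `{f ≠ 0}`. -/
lemma eventually_eq_const_mul_of_iteratedFDeriv_ne_zero (hM : IsOpen M)
    (hf : ContDiffOn ℝ ∞ f M) (hg : ContDiffOn ℝ ∞ g M)
    (hloc : ∀ x ∈ M, f x ≠ 0 → ∃ c : ℂ, ∀ᶠ y in 𝓝 x, g y = c * f y)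
    {x : E} (hx : x ∈ M) {n : ℕ} (hn : iteratedFDeriv ℝ n f x ≠ 0) :
    ∃ c : ℂ, ∀ᶠ y in 𝓝 x, g y = c * f y := by
  obtain ⟨v, hv⟩ : ∃ v, iteratedFDeriv ℝ n f x v ≠ 0 := by
    by_contra! h
    exact hn (ContinuousMultilinearMap.ext h)
  have hsm : ∀ {h : E → ℂ}, ContDiffOn ℝ ∞ h M →
      ContDiffOn ℝ ∞ (fun y => iteratedFDeriv ℝ n h y v) M := fun {h} hh => by
    intro y hy
    have h1 : ContDiffAt ℝ ∞ (iteratedFDeriv ℝ n h) y :=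
      (hh.contDiffAt (hM.mem_nhds hy)).iteratedFDeriv_right (by norm_cast)
    exact ((ContinuousMultilinearMap.apply ℝ (fun _ : Fin n => E) ℂ v).contDiff.contDiffAt.comp y
      h1).contDiffWithinAt
  have hne : ∀ᶠ y in 𝓝 x, iteratedFDeriv ℝ n f y v ≠ 0 :=
    ((hsm hf).continuousOn.continuousAt (hM.mem_nhds hx)).eventually_ne hv
  obtain ⟨ε, hε, hball⟩ := Metric.mem_nhds_iff.1 (inter_mem (hM.mem_nhds hx) hne)
  set B := Metric.ball x ε with hB
  have hBM : ∀ y ∈ B, y ∈ M := fun y hy => (hball hy).1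
  have hBv : ∀ y ∈ B, iteratedFDeriv ℝ n f y v ≠ 0 := fun y hy => (hball hy).2
  have hdense : ∀ y ∈ B, ∀ V ∈ 𝓝 y, ∃ z ∈ V, z ∈ B ∧ f z ≠ 0 := fun y hy V hV => by
    obtain ⟨z, hz, hz'⟩ := exists_ne_zero_of_iteratedFDeriv_ne_zero (f := f) (n := n)
      (fun h0 => hBv y hy (by rw [h0]; rfl)) (inter_mem hV (Metric.isOpen_ball.mem_nhds hy))
    exact ⟨z, hz.1, hz.2, hz'⟩
  set q : E → ℂ := fun y => iteratedFDeriv ℝ n g y v / iteratedFDeriv ℝ n f y v with hq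
  have hqs : ContDiffOn ℝ ∞ q B :=
    (((hsm hg).mono hBM).mul (((hsm hf).mono hBM).inv hBv)).congr fun y _ => div_eq_mul_inv _ _
  -- where `f ≠ 0`, the quotient `q` is locally the constant `g / f`
  have hqloc : ∀ y ∈ B, f y ≠ 0 → fderiv ℝ q y = 0 ∧ g y = q y * f y := fun y hy hfy => by
    obtain ⟨c, hc⟩ := hloc y (hBM y hy) hfy
    have hqc : q =ᶠ[𝓝 y] fun _ => c := by
      filter_upwards [hc.eventually_nhds, Metric.isOpen_ball.mem_nhds hy] with z hz hzB
      have e1 : g =ᶠ[𝓝 z] (c • f) := hz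
      have e2 : iteratedFDeriv ℝ n g z = c • iteratedFDeriv ℝ n f z := by
        rw [(e1.iteratedFDeriv ℝ n).eq_of_nhds]
        exact iteratedFDeriv_const_smul_apply ((hf.contDiffAt (hM.mem_nhds (hBM z hzB))).of_le
          (by exact_mod_cast le_top))
      simp only [hq, e2, _root_.smul_apply, smul_eq_mul]
      exact mul_div_cancel_right₀ _ (hBv z hzB)
    refine ⟨?_, ?_⟩
    · rw [hqc.fderiv_eq]; exact fderiv_const_apply c
    · rw [hqc.eq_of_nhds]; exact hc.self_of_nhds
  have hq0 : ∀ y ∈ B, fderiv ℝ q y = 0 := fun y hy => by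
    by_contra hne0
    have hcont : ContinuousAt (fderiv ℝ q) y :=
      (hqs.fderiv_of_isOpen Metric.isOpen_ball (m := ∞) (by simp)).continuousOn.continuousAt
        (Metric.isOpen_ball.mem_nhds hy)
    obtain ⟨z, hz, hzB, hfz⟩ := hdense y hy _ (hcont.eventually_ne hne0)
    exact hz (hqloc z hzB hfz).1
  have hqx : ∀ y ∈ B, q y = q x := fun y hy =>
    Metric.isOpen_ball.is_const_of_fderiv_eq_zero (convex_ball x ε).isPreconnected
      (hqs.differentiableOn (by simp)) hq0 hy (Metric.mem_ball_self hε)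
  refine ⟨q x, ?_⟩
  filter_upwards [Metric.isOpen_ball.mem_nhds (Metric.mem_ball_self hε)] with y hy
  by_contra hne0
  have hcont : ContinuousAt (fun y => g y - q x * f y) y :=
    ((hg.sub (contDiffOn_const.mul hf)).continuousOn.continuousAt (hM.mem_nhds (hBM y hy)))
  obtain ⟨z, hz, hzB, hfz⟩ := hdense y hy _ (hcont.eventually_ne (sub_ne_zero.2 hne0))
  exact hz (by rw [(hqloc z hzB hfz).2, hqx z hzB, sub_self])

/-- The local constants agree where their neighbourhoods overlap, because `f` does not vanish
identically on any open subset; the connectedness of `M` does the rest. -/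
lemma exists_eq_const_mul_of_no_flat_point (hM : IsOpen M) (hMc : IsPreconnected M)
    (hf : ContDiffOn ℝ ∞ f M) (hg : ContDiffOn ℝ ∞ g M)
    (hflat : ∀ x ∈ M, ∃ n : ℕ, iteratedFDeriv ℝ n f x ≠ 0)
    (hloc : ∀ x ∈ M, f x ≠ 0 → ∃ c : ℂ, ∀ᶠ y in 𝓝 x, g y = c * f y) :
    ∃ c : ℂ, ∀ x ∈ M, g x = c * f x := by
  have h1 : ∀ x ∈ M, ∃ c : ℂ, ∀ᶠ y in 𝓝 x, g y = c * f y := fun x hx => by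
    obtain ⟨n, hn⟩ := hflat x hx
    exact eventually_eq_const_mul_of_iteratedFDeriv_ne_zero hM hf hg hloc hx hn
  choose! c hc using h1
  have hcl : ∀ x ∈ M, c =ᶠ[𝓝 x] fun _ => c x := fun x hx => by
    filter_upwards [(hc x hx).eventually_nhds, hM.mem_nhds hx] with y hy hyM
    obtain ⟨n, hn⟩ := hflat y hyM
    obtain ⟨z, hz, hfz⟩ := exists_ne_zero_of_iteratedFDeriv_ne_zero hn (hy.and (hc y hyM))
    exact mul_right_cancel₀ hfz (hz.2.symm.trans hz.1)
  have hd : ∀ x ∈ M, HasFDerivAt c (0 : E →L[ℝ] ℂ) x := fun x hx =>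
    (hasFDerivAt_const (c x) x).congr_of_eventuallyEq (hcl x hx)
  obtain ⟨k, hk⟩ := hM.exists_is_const_of_fderiv_eq_zero (𝕜 := ℝ) hMc
    (fun x hx => (hd x hx).differentiableAt.differentiableWithinAt) (fun x hx => (hd x hx).fderiv)
  exact ⟨k, fun x hx => by rw [(hc x hx).self_of_nhds, hk x hx]⟩

end UniqueContinuation

/-! ### The phase -/

lemma exists_smooth_primitive {a b : ℝ} {c : ℝ → ℝ} (hc : ContDiffOn ℝ ∞ c (Ioo a b)) :
    ∃ θ : ℝ → ℝ, ContDiffOn ℝ ∞ θ (Ioo a b) ∧ ∀ t ∈ Ioo a b, HasDerivAt θ (c t) t := by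
  set t₁ := (a + b) / 2 with ht₁
  have hd : ∀ t ∈ Ioo a b, HasDerivAt (fun t => ∫ s in t₁..t, c s) (c t) t := fun t ht => by
    have h1 : t₁ ∈ Ioo a b := by constructor <;> linarith [ht.1, ht.2, ht.1.trans ht.2]
    have hsub : uIcc t₁ t ⊆ Ioo a b := (ordConnected_Ioo).uIcc_subset h1 ht
    exact intervalIntegral.integral_hasDerivAt_right
      ((hc.continuousOn.mono hsub).intervalIntegrable)
      (hc.continuousOn.stronglyMeasurableAtFilter isOpen_Ioo t ht)
      (hc.continuousOn.continuousAt (isOpen_Ioo.mem_nhds ht))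
  refine ⟨_, (contDiffOn_infty_iff_deriv_of_isOpen isOpen_Ioo).2
    ⟨fun t ht => (hd t ht).differentiableAt.differentiableWithinAt, ?_⟩, hd⟩
  exact hc.congr fun t ht => (hd t ht).deriv

lemma pd_const_mul (c : ℂ) (f : Coord N → ℂ) (j : Fin N) (x : Coord N) :
    pd (fun y => c * f y) j x = c * pd f j x := by
  have : fderiv ℝ (fun y => c • f y) x = c • fderiv ℝ f x :=
    congrFun (fderiv_const_smul_field (𝕜 := ℝ) (f := f) c) x
  simpa [pd] using congrArg (fun L => L (Pi.single j 1)) this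

lemma covMomentum_const_mul (hbar : ℝ) (A : Coord N → Coord N) (j : Fin N) (c : ℂ)
    (f : Coord N → ℂ) (x : Coord N) :
    covMomentum hbar A j (fun y => c * f y) x = c * covMomentum hbar A j f x := by
  simp only [covMomentum, pd_const_mul]; ring

lemma schrodingerOp_const_mul (hbar m : ℝ) (g : Coord N → Matrix (Fin N) (Fin N) ℝ)
    (A : Coord N → Coord N) (U : Coord N → ℝ) (c : ℂ) (f : Coord N → ℂ) (x : Coord N) :
    schrodingerOp hbar m g A U (fun y => c * f y) x = c * schrodingerOp hbar m g A U f x := by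
  have h : ∀ i j : Fin N, (fun y => ((g y i j * volDensity g y : ℝ) : ℂ) *
        covMomentum hbar A j (fun y => c * f y) y) =
      fun y => c * (((g y i j * volDensity g y : ℝ) : ℂ) * covMomentum hbar A j f y) := by
    intro i j; funext y; rw [covMomentum_const_mul]; ring
  rw [schrodingerOp]
  simp only [h]
  simp only [schrodingerOp, covMomentum_const_mul, ← Finset.mul_sum]
  ring

/-- If `iħ ∂_t ψ = 𝓗 ψ + c ψ` and `θ' = c / ħ`, then `e^{iθ} ψ` solves the Schrödinger equation. -/
lemma schrodingerAt_rephase {hbar m : ℝ} (hhbar : hbar ≠ 0)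
    {g : Coord N → Matrix (Fin N) (Fin N) ℝ} {A : ℝ → Coord N → Coord N} {U : ℝ → Coord N → ℝ}
    {ψ : ℝ → Coord N → ℂ} {t : ℝ} {x : Coord N} {d : ℂ} (hd : HasDerivAt (fun r => ψ r x) d t)
    {c : ℝ} (hc : Complex.I * hbar * d - schrodingerOp hbar m g (A t) (U t) (ψ t) x = c * ψ t x)
    {θ : ℝ → ℝ} (hθ : HasDerivAt θ (c / hbar) t) :
    SchrodingerAt hbar (fun t => schrodingerOp hbar m g (A t) (U t)) (rephase θ ψ) t x := by
  have h1 : HasDerivAt (fun r => Complex.exp (Complex.I * ((θ r : ℝ) : ℂ)))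
      (Complex.exp (Complex.I * ((θ t : ℝ) : ℂ)) * (Complex.I * ((c / hbar : ℝ) : ℂ))) t :=
    (hθ.ofReal_comp.const_mul Complex.I).cexp
  refine ⟨_, h1.mul hd, ?_⟩
  have h2 : schrodingerOp hbar m g (A t) (U t) (rephase θ ψ t) x =
      Complex.exp (Complex.I * ((θ t : ℝ) : ℂ)) * schrodingerOp hbar m g (A t) (U t) (ψ t) x :=
    schrodingerOp_const_mul ..
  simp only [h2]
  have hq : Complex.I * (hbar : ℂ) * (Complex.I * ((c / hbar : ℝ) : ℂ)) = -c := by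
    have : (hbar : ℂ) ≠ 0 := by exact_mod_cast hhbar
    push_cast
    field_simp
    linear_combination (c : ℂ) * Complex.I_sq
  linear_combination (Complex.exp (Complex.I * ((θ t : ℝ) : ℂ))) * hc +
    (Complex.exp (Complex.I * ((θ t : ℝ) : ℂ))) * ψ t x * hq

/-! ### Directional derivatives on space-time and on the doubled space -/

section Directional

variable {E F : Type*} [NormedAddCommGroup E] [NormedSpace ℝ E] [NormedAddCommGroup F]
  [NormedSpace ℝ F]

/-- The derivative of `f` in the constant direction `v`, as a function of the base point. -/
noncomputable def dd (v : E) (f : E → F) (z : E) : F := fderiv ℝ f z v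

variable {D : Set E} {z : E}

lemma contDiffOn_dd (hD : IsOpen D) {f : E → F} (hf : ContDiffOn ℝ ∞ f D) (v : E) :
    ContDiffOn ℝ ∞ (dd v f) D :=
  (hf.fderiv_of_isOpen hD (by simp)).clm_apply contDiffOn_const

lemma differentiableAt_of_contDiffOn (hD : IsOpen D) {f : E → F}
    (hf : ContDiffOn ℝ ∞ f D) (hz : z ∈ D) : DifferentiableAt ℝ f z :=
  (hf.contDiffAt (hD.mem_nhds hz)).differentiableAt (by simp)

lemma dd_congr (hD : IsOpen D) {f g : E → F} (h : ∀ z ∈ D, f z = g z) (v : E) :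
    ∀ z ∈ D, dd v f z = dd v g z := fun z hz => by
  have : f =ᶠ[𝓝 z] g := by filter_upwards [hD.mem_nhds hz] with y hy using h y hy
  rw [dd, dd, this.fderiv_eq]

/-- Symmetry of second derivatives. -/
lemma dd_comm (hD : IsOpen D) {f : E → F} (hf : ContDiffOn ℝ ∞ f D) (v w : E) (hz : z ∈ D) :
    dd v (dd w f) z = dd w (dd v f) z := by
  have hs : IsSymmSndFDerivAt ℝ f z := (hf.contDiffAt (hD.mem_nhds hz)).isSymmSndFDerivAt
    (by rw [minSmoothness_of_isRCLikeNormedField]; exact WithTop.coe_le_coe.2 le_top)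
  have hd : DifferentiableAt ℝ (fderiv ℝ f) z :=
    differentiableAt_of_contDiffOn hD (hf.fderiv_of_isOpen hD (by simp)) hz
  have h : ∀ v w, dd v (dd w f) z = fderiv ℝ (fderiv ℝ f) z v w := fun v w => by
    unfold dd
    rw [fderiv_clm_apply hd (differentiableAt_const w)]
    simp
  rw [h, h, hs v w]

lemma dd_add {f₁ f₂ : E → F} (h₁ : DifferentiableAt ℝ f₁ z) (h₂ : DifferentiableAt ℝ f₂ z)
    (v : E) : dd v (fun y => f₁ y + f₂ y) z = dd v f₁ z + dd v f₂ z := by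
  simp [dd, fderiv_fun_add h₁ h₂]

lemma dd_sub {f₁ f₂ : E → F} (h₁ : DifferentiableAt ℝ f₁ z) (h₂ : DifferentiableAt ℝ f₂ z)
    (v : E) : dd v (fun y => f₁ y - f₂ y) z = dd v f₁ z - dd v f₂ z := by
  simp [dd, fderiv_fun_sub h₁ h₂]

lemma dd_mul {𝔸 : Type*} [NormedCommRing 𝔸] [NormedAlgebra ℝ 𝔸] {f₁ f₂ : E → 𝔸}
    (h₁ : DifferentiableAt ℝ f₁ z) (h₂ : DifferentiableAt ℝ f₂ z) (v : E) :
    dd v (fun y => f₁ y * f₂ y) z = dd v f₁ z * f₂ z + f₁ z * dd v f₂ z := by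
  simp [dd, fderiv_fun_mul h₁ h₂]; ring

lemma dd_const_mul (c : ℂ) (f : E → ℂ) (v z : E) :
    dd v (fun y => c * f y) z = c * dd v f z := by
  have : fderiv ℝ (fun y => c • f y) z = c • fderiv ℝ f z :=
    congrFun (fderiv_const_smul_field (𝕜 := ℝ) (f := f) c) z
  simpa [dd] using congrArg (fun L => L v) this

lemma dd_sum {ι : Type*} (s : Finset ι) {f : ι → E → F}
    (h : ∀ i ∈ s, DifferentiableAt ℝ (f i) z) (v : E) :
    dd v (fun y => ∑ i ∈ s, f i y) z = ∑ i ∈ s, dd v (f i) z := by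
  simp [dd, fderiv_fun_sum h]

lemma dd_ofReal {f : E → ℝ} (hf : DifferentiableAt ℝ f z) (v : E) :
    dd v (fun y => (f y : ℂ)) z = ((dd v f z : ℝ) : ℂ) := by
  have := (Complex.ofRealCLM.hasFDerivAt.comp z hf.hasFDerivAt).fderiv
  exact congrArg (fun L => L v) this

lemma dd_conj {f : E → ℂ} (hf : DifferentiableAt ℝ f z) (v : E) :
    dd v (fun y => (starRingEnd ℂ) (f y)) z = (starRingEnd ℂ) (dd v f z) := by
  have := (Complex.conjCLE.toContinuousLinearMap.hasFDerivAt.comp z hf.hasFDerivAt).fderiv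
  exact congrArg (fun L => L v) this

lemma dd_comp_clm {E' : Type*} [NormedAddCommGroup E'] [NormedSpace ℝ E'] (L : E →L[ℝ] E')
    {f : E' → F} (hf : DifferentiableAt ℝ f (L z)) (v : E) :
    dd v (fun y => f (L y)) z = dd (L v) f (L z) := by
  have := (hf.hasFDerivAt.comp z L.hasFDerivAt).fderiv
  exact congrArg (fun L => L v) this

lemma dd_neg_left (f : E → F) (v z : E) : dd (-v) f z = -dd v f z := by simp [dd]

end Directional

/-- The direction of time in space-time. -/
def dirT : ℝ × Coord N := (1, 0)

/-- The direction of the `j`-th coordinate in space-time. -/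
def dirX (j : Fin N) : ℝ × Coord N := (0, Pi.single j 1)

/-- The direction of time in the doubled space of triples `(t, x, y)`. -/
def dirT₂ : ℝ × Coord N × Coord N := (1, 0, 0)

/-- The direction of `∂/∂x_j + ∂/∂y_j`, tangent to the diagonal of the doubled space. -/
def dirTan (j : Fin N) : ℝ × Coord N × Coord N := (0, Pi.single j 1, Pi.single j 1)

/-- The direction of `∂/∂x_j - ∂/∂y_j`, transverse to the diagonal of the doubled space. -/
def dirRel (j : Fin N) : ℝ × Coord N × Coord N := (0, Pi.single j 1, -Pi.single j 1)

/-- The point `(t, x, x)` over `(t, x)`. -/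
def diagCLM : (ℝ × Coord N) →L[ℝ] ℝ × Coord N × Coord N :=
  (ContinuousLinearMap.fst ℝ ℝ (Coord N)).prod
    ((ContinuousLinearMap.snd ℝ ℝ (Coord N)).prod (ContinuousLinearMap.snd ℝ ℝ (Coord N)))

/-- The projection `(t, x, y) ↦ (t, x)`. -/
def leftCLM : (ℝ × Coord N × Coord N) →L[ℝ] ℝ × Coord N :=
  (ContinuousLinearMap.fst ℝ ℝ _).prod
    ((ContinuousLinearMap.fst ℝ _ _).comp (ContinuousLinearMap.snd ℝ ℝ _))

/-- The projection `(t, x, y) ↦ (t, y)`. -/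
def rightCLM : (ℝ × Coord N × Coord N) →L[ℝ] ℝ × Coord N :=
  (ContinuousLinearMap.fst ℝ ℝ _).prod
    ((ContinuousLinearMap.snd ℝ _ _).comp (ContinuousLinearMap.snd ℝ ℝ _))

@[simp] lemma diagCLM_apply (z : ℝ × Coord N) : diagCLM z = (z.1, z.2, z.2) := rfl
@[simp] lemma leftCLM_apply (z : ℝ × Coord N × Coord N) : leftCLM z = (z.1, z.2.1) := rfl
@[simp] lemma rightCLM_apply (z : ℝ × Coord N × Coord N) : rightCLM z = (z.1, z.2.2) := rfl

/-- The partial derivative at a fixed time is a directional derivative on space-time. -/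
lemma pd_slice {F : Type*} [NormedAddCommGroup F] [NormedSpace ℝ F] {f : ℝ × Coord N → F} {t : ℝ}
    {x : Coord N} (hf : DifferentiableAt ℝ f (t, x)) (j : Fin N) :
    pd (fun y => f (t, y)) j x = dd (dirX j) f (t, x) := by
  have h1 : HasFDerivAt (fun y : Coord N => (t, y))
      ((0 : Coord N →L[ℝ] ℝ).prod (ContinuousLinearMap.id ℝ (Coord N))) x :=
    (hasFDerivAt_const t x).prodMk (hasFDerivAt_id x)
  exact congrArg (fun L => L (Pi.single j 1)) (hf.hasFDerivAt.comp x h1).fderiv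

/-- The kernel `f(t, x) \overline{g(t, y)}` on the doubled space. -/
noncomputable def tensorKernel (f g : ℝ × Coord N → ℂ) (z : ℝ × Coord N × Coord N) : ℂ :=
  f (leftCLM z) * (starRingEnd ℂ) (g (rightCLM z))

lemma dd_tensorKernel {f g : ℝ × Coord N → ℂ} {z : ℝ × Coord N × Coord N}
    (hf : DifferentiableAt ℝ f (leftCLM z)) (hg : DifferentiableAt ℝ g (rightCLM z))
    (v : ℝ × Coord N × Coord N) :
    dd v (tensorKernel f g) z = dd (leftCLM v) f (leftCLM z) * (starRingEnd ℂ) (g (rightCLM z)) +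
      f (leftCLM z) * (starRingEnd ℂ) (dd (rightCLM v) g (rightCLM z)) := by
  have h1 : DifferentiableAt ℝ (fun z => f (leftCLM z)) z :=
    hf.comp z leftCLM.differentiableAt
  have h2 : DifferentiableAt ℝ (fun z => g (rightCLM z)) z :=
    hg.comp z rightCLM.differentiableAt
  have h3 : DifferentiableAt ℝ (fun z => (starRingEnd ℂ) (g (rightCLM z))) z :=
    Complex.conjCLE.toContinuousLinearMap.differentiableAt.comp z h2
  have := dd_mul h1 h3 v
  rw [dd_conj h2, dd_comp_clm leftCLM hf, dd_comp_clm rightCLM hg] at this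
  exact this

section Tensor

variable {T : Set ℝ} {M : Set (Coord N)} {f g : ℝ × Coord N → ℂ}

lemma leftCLM_mem {z : ℝ × Coord N × Coord N} (hz : z ∈ T ×ˢ M ×ˢ M) : leftCLM z ∈ T ×ˢ M :=
  ⟨hz.1, hz.2.1⟩

lemma rightCLM_mem {z : ℝ × Coord N × Coord N} (hz : z ∈ T ×ˢ M ×ˢ M) : rightCLM z ∈ T ×ˢ M :=
  ⟨hz.1, hz.2.2⟩

lemma contDiffOn_tensorKernel (hf : ContDiffOn ℝ ∞ f (T ×ˢ M)) (hg : ContDiffOn ℝ ∞ g (T ×ˢ M)) :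
    ContDiffOn ℝ ∞ (tensorKernel f g) (T ×ˢ M ×ˢ M) :=
  (hf.comp leftCLM.contDiff.contDiffOn fun _ hz => leftCLM_mem hz).mul
    (Complex.conjCLE.toContinuousLinearMap.contDiff.comp_contDiffOn
      (hg.comp rightCLM.contDiff.contDiffOn fun _ hz => rightCLM_mem hz))

/-- The minus sign comes from moving `y` in the direction opposite to `x`. -/
lemma dd_dirRel_tensorKernel (hTM : IsOpen (T ×ˢ M)) (hf : ContDiffOn ℝ ∞ f (T ×ˢ M))
    (hg : ContDiffOn ℝ ∞ g (T ×ˢ M)) (k : Fin N) :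
    ∀ z ∈ T ×ˢ M ×ˢ M, dd (dirRel k) (tensorKernel f g) z =
      tensorKernel (dd (dirX k) f) g z - tensorKernel f (dd (dirX k) g) z := fun z hz => by
  rw [dd_tensorKernel (differentiableAt_of_contDiffOn hTM hf (leftCLM_mem hz))
    (differentiableAt_of_contDiffOn hTM hg (rightCLM_mem hz))]
  have h1 : leftCLM (dirRel k) = dirX k := rfl
  have h2 : rightCLM (dirRel k) = -dirX k := by simp [dirRel, dirX]
  rw [h1, h2, dd_neg_left, map_neg, mul_neg, ← sub_eq_add_neg]
  rfl

lemma dd_dirTan_tensorKernel (hTM : IsOpen (T ×ˢ M)) (hf : ContDiffOn ℝ ∞ f (T ×ˢ M))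
    (hg : ContDiffOn ℝ ∞ g (T ×ˢ M)) (k : Fin N) :
    ∀ z ∈ T ×ˢ M ×ˢ M, dd (dirTan k) (tensorKernel f g) z =
      tensorKernel (dd (dirX k) f) g z + tensorKernel f (dd (dirX k) g) z := fun _ hz =>
  dd_tensorKernel (differentiableAt_of_contDiffOn hTM hf (leftCLM_mem hz))
    (differentiableAt_of_contDiffOn hTM hg (rightCLM_mem hz)) _

lemma dd_dirT₂_tensorKernel (hTM : IsOpen (T ×ˢ M)) (hf : ContDiffOn ℝ ∞ f (T ×ˢ M))
    (hg : ContDiffOn ℝ ∞ g (T ×ˢ M)) :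
    ∀ z ∈ T ×ˢ M ×ˢ M, dd dirT₂ (tensorKernel f g) z =
      tensorKernel (dd dirT f) g z + tensorKernel f (dd dirT g) z := fun _ hz =>
  dd_tensorKernel (differentiableAt_of_contDiffOn hTM hf (leftCLM_mem hz))
    (differentiableAt_of_contDiffOn hTM hg (rightCLM_mem hz)) _

end Tensor

/-! ### The balance laws as linear differential expressions in the kernel -/

/-- The continuity equation `∂_t ρ + ∂_j h^{jk} (P_k + A_k ρ)`, where the density `ρ` and the
momentum `P_k` are the kernel `a` and `-(iħ/2) (∂/∂x_k - ∂/∂y_k) a` on the diagonal. -/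
noncomputable def massBalance (hbar : ℝ) (h : Matrix (Fin N) (Fin N) ℝ)
    (α : Fin N → ℝ × Coord N → ℝ) (a : ℝ × Coord N × Coord N → ℂ) (z : ℝ × Coord N) : ℂ :=
  dd dirT₂ a (diagCLM z) + ∑ j, ∑ k, (h j k : ℂ) *
    (-(Complex.I * (hbar / 2)) * dd (dirTan j) (dd (dirRel k) a) (diagCLM z) +
      (dd (dirX j) (α k) z : ℝ) * a (diagCLM z) + α k z * dd (dirTan j) a (diagCLM z))

/-- The momentum balance
`∂_t P_i + ∂_j h^{jk} (Π_{ki} + A_k P_i) + h^{jk} (P_j + A_j ρ) ∂_i A_k + ρ ∂_i U`, where the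
stress `Π_{ki}` is `(-(iħ/2))² (∂/∂x_k - ∂/∂y_k) (∂/∂x_i - ∂/∂y_i) a` on the diagonal. -/
noncomputable def momentumBalance (hbar : ℝ) (h : Matrix (Fin N) (Fin N) ℝ)
    (α : Fin N → ℝ × Coord N → ℝ) (υ : ℝ × Coord N → ℝ) (i : Fin N)
    (a : ℝ × Coord N × Coord N → ℂ) (z : ℝ × Coord N) : ℂ :=
  -(Complex.I * (hbar / 2)) * dd dirT₂ (dd (dirRel i) a) (diagCLM z) +
    (∑ j, ∑ k, (h j k : ℂ) *
      ((-(Complex.I * (hbar / 2))) ^ 2 *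
          dd (dirTan j) (dd (dirRel k) (dd (dirRel i) a)) (diagCLM z) +
        (dd (dirX j) (α k) z : ℝ) * (-(Complex.I * (hbar / 2)) * dd (dirRel i) a (diagCLM z)) +
        α k z * (-(Complex.I * (hbar / 2)) * dd (dirTan j) (dd (dirRel i) a) (diagCLM z)) +
        (dd (dirX i) (α k) z : ℝ) * (-(Complex.I * (hbar / 2)) * dd (dirRel j) a (diagCLM z)) +
        α j z * (dd (dirX i) (α k) z : ℝ) * a (diagCLM z))) +
    (dd (dirX i) υ z : ℝ) * a (diagCLM z)

/-- The term of index `(j, k)` in `h^{jk} (-iħ∂_j + A_j) (-iħ∂_k + A_k) ψ`, up to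
symmetrization. -/
noncomputable def kineticTerm (hbar : ℝ) (α : Fin N → ℝ × Coord N → ℝ) (ψ : ℝ × Coord N → ℂ)
    (j k : Fin N) (z : ℝ × Coord N) : ℂ :=
  -(hbar ^ 2 : ℂ) * dd (dirX j) (dd (dirX k) ψ) z -
    Complex.I * hbar * ((dd (dirX j) (α k) z : ℝ) * ψ z) -
    2 * Complex.I * hbar * (α j z * dd (dirX k) ψ z) + α j z * α k z * ψ z

/-- The defect `iħ ∂_t ψ - 𝓗 ψ` in the Schrödinger equation. -/
noncomputable def schrodingerDefect (hbar : ℝ) (h : Matrix (Fin N) (Fin N) ℝ)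
    (α : Fin N → ℝ × Coord N → ℝ) (υ : ℝ × Coord N → ℝ) (ψ : ℝ × Coord N → ℂ)
    (z : ℝ × Coord N) : ℂ :=
  Complex.I * hbar * dd dirT ψ z -
    (1 / 2 * (∑ j, ∑ k, (h j k : ℂ) * kineticTerm hbar α ψ j k z) + υ z * ψ z)

/-- Contractions with a symmetric matrix only see the symmetric parts. -/
lemma sum_symm_congr {h : Matrix (Fin N) (Fin N) ℝ} (hh : h.IsSymm) {X Y : Fin N → Fin N → ℂ}
    (hXY : ∀ j k, X j k + X k j = Y j k + Y k j) :
    ∑ j, ∑ k, (h j k : ℂ) * X j k = ∑ j, ∑ k, (h j k : ℂ) * Y j k := by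
  have key : ∀ X : Fin N → Fin N → ℂ, ∑ j, ∑ k, (h j k : ℂ) * X j k =
      1 / 2 * ∑ j, ∑ k, (h j k : ℂ) * (X j k + X k j) := fun X => by
    have h1 : ∑ j, ∑ k, (h j k : ℂ) * X k j = ∑ j, ∑ k, (h j k : ℂ) * X j k := by
      rw [Finset.sum_comm]
      exact Finset.sum_congr rfl fun j _ => Finset.sum_congr rfl fun k _ => by
        rw [hh.apply]
    simp only [mul_add, Finset.sum_add_distrib, h1]
    ring
  rw [key X, key Y]
  simp only [hXY]

section Pure

variable {T : Set ℝ} {M : Set (Coord N)} {hbar : ℝ} {h : Matrix (Fin N) (Fin N) ℝ}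
  {α : Fin N → ℝ × Coord N → ℝ} {υ : ℝ × Coord N → ℝ} {ψ : ℝ × Coord N → ℂ}

lemma contDiffOn_kineticTerm (hTM : IsOpen (T ×ˢ M)) (hα : ∀ k, ContDiffOn ℝ ∞ (α k) (T ×ˢ M))
    (hψ : ContDiffOn ℝ ∞ ψ (T ×ˢ M)) (j k : Fin N) :
    ContDiffOn ℝ ∞ (kineticTerm hbar α ψ j k) (T ×ˢ M) := by
  have hc : ∀ {f : ℝ × Coord N → ℝ}, ContDiffOn ℝ ∞ f (T ×ˢ M) →
      ContDiffOn ℝ ∞ (fun z => (f z : ℂ)) (T ×ˢ M) := fun hf =>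
    Complex.ofRealCLM.contDiff.comp_contDiffOn hf
  have h1 := contDiffOn_dd hTM (contDiffOn_dd hTM hψ (dirX k)) (dirX j)
  have h2 := contDiffOn_dd hTM hψ (dirX k)
  have h3 := hc (contDiffOn_dd hTM (hα k) (dirX j))
  exact (((contDiffOn_const.mul h1).sub (contDiffOn_const.mul (h3.mul hψ))).sub
    (contDiffOn_const.mul ((hc (hα j)).mul h2))).add (((hc (hα j)).mul (hc (hα k))).mul hψ)

lemma contDiffOn_schrodingerDefect (hTM : IsOpen (T ×ˢ M))
    (hα : ∀ k, ContDiffOn ℝ ∞ (α k) (T ×ˢ M)) (hυ : ContDiffOn ℝ ∞ υ (T ×ˢ M))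
    (hψ : ContDiffOn ℝ ∞ ψ (T ×ˢ M)) :
    ContDiffOn ℝ ∞ (schrodingerDefect hbar h α υ ψ) (T ×ˢ M) :=
  (contDiffOn_const.mul (contDiffOn_dd hTM hψ dirT)).sub
    ((contDiffOn_const.mul (ContDiffOn.sum fun j _ => ContDiffOn.sum fun k _ =>
      contDiffOn_const.mul (contDiffOn_kineticTerm hTM hα hψ j k))).add
      ((Complex.ofRealCLM.contDiff.comp_contDiffOn hυ).mul hψ))

/-- For the kernel `ψ ⊗ ψ̄` the continuity equation says that `iħ ∂_t ψ - 𝓗 ψ` is a real multiple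
of `ψ`. -/
lemma massBalance_tensorKernel (hTM : IsOpen (T ×ˢ M)) (hTMM : IsOpen (T ×ˢ M ×ˢ M))
    (hh : h.IsSymm) (hψ : ContDiffOn ℝ ∞ ψ (T ×ˢ M)) {z : ℝ × Coord N} (hz : z ∈ T ×ˢ M) :
    Complex.I * hbar * massBalance hbar h α (tensorKernel ψ ψ) z =
      schrodingerDefect hbar h α υ ψ z * (starRingEnd ℂ) (ψ z) -
        ψ z * (starRingEnd ℂ) (schrodingerDefect hbar h α υ ψ z) := by
  have hdz : diagCLM z ∈ T ×ˢ M ×ˢ M := ⟨hz.1, hz.2, hz.2⟩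
  have hd1 := fun k => contDiffOn_dd hTM hψ (dirX k)
  have e0 : tensorKernel ψ ψ (diagCLM z) = ψ z * (starRingEnd ℂ) (ψ z) := rfl
  have e1 : dd dirT₂ (tensorKernel ψ ψ) (diagCLM z) = dd dirT ψ z * (starRingEnd ℂ) (ψ z) +
      ψ z * (starRingEnd ℂ) (dd dirT ψ z) := dd_dirT₂_tensorKernel hTM hψ hψ _ hdz
  have e2 : ∀ j, dd (dirTan j) (tensorKernel ψ ψ) (diagCLM z) =
      dd (dirX j) ψ z * (starRingEnd ℂ) (ψ z) + ψ z * (starRingEnd ℂ) (dd (dirX j) ψ z) :=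
    fun j => dd_dirTan_tensorKernel hTM hψ hψ j _ hdz
  have e3 : ∀ j k, dd (dirTan j) (dd (dirRel k) (tensorKernel ψ ψ)) (diagCLM z) =
      (dd (dirX j) (dd (dirX k) ψ) z * (starRingEnd ℂ) (ψ z) +
        dd (dirX k) ψ z * (starRingEnd ℂ) (dd (dirX j) ψ z)) -
      (dd (dirX j) ψ z * (starRingEnd ℂ) (dd (dirX k) ψ z) +
        ψ z * (starRingEnd ℂ) (dd (dirX j) (dd (dirX k) ψ) z)) := fun j k => by
    rw [dd_congr hTMM (dd_dirRel_tensorKernel hTM hψ hψ k) _ _ hdz,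
      dd_sub (differentiableAt_of_contDiffOn hTMM (contDiffOn_tensorKernel (hd1 k) hψ) hdz)
        (differentiableAt_of_contDiffOn hTMM (contDiffOn_tensorKernel hψ (hd1 k)) hdz),
      dd_dirTan_tensorKernel hTM (hd1 k) hψ j _ hdz, dd_dirTan_tensorKernel hTM hψ (hd1 k) j _ hdz]
    rfl
  have hsum : ∑ j, ∑ k, (h j k : ℂ) * (Complex.I * hbar *
        (-(Complex.I * (hbar / 2)) * dd (dirTan j) (dd (dirRel k) (tensorKernel ψ ψ)) (diagCLM z) +
          (dd (dirX j) (α k) z : ℝ) * tensorKernel ψ ψ (diagCLM z) +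
          α k z * dd (dirTan j) (tensorKernel ψ ψ) (diagCLM z))) =
      ∑ j, ∑ k, (h j k : ℂ) * (-(1 / 2) * (kineticTerm hbar α ψ j k z * (starRingEnd ℂ) (ψ z) -
        ψ z * (starRingEnd ℂ) (kineticTerm hbar α ψ j k z))) := by
    refine sum_symm_congr hh fun j k => ?_
    simp only [e0, e2, e3, kineticTerm, map_add, map_sub, map_mul, map_neg, map_pow,
      Complex.conj_ofReal, Complex.conj_I, map_ofNat]
    rw [dd_comm hTM hψ (dirX k) (dirX j) hz]
    linear_combination (-(hbar : ℂ) ^ 2 * (dd (dirX j) (dd (dirX k) ψ) z * (starRingEnd ℂ) (ψ z) -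
      ψ z * (starRingEnd ℂ) (dd (dirX j) (dd (dirX k) ψ) z))) * Complex.I_sq
  have hsum' : Complex.I * hbar * massBalance hbar h α (tensorKernel ψ ψ) z =
      Complex.I * hbar * (dd dirT ψ z * (starRingEnd ℂ) (ψ z) +
        ψ z * (starRingEnd ℂ) (dd dirT ψ z)) +
      ∑ j, ∑ k, (h j k : ℂ) * (-(1 / 2) * (kineticTerm hbar α ψ j k z * (starRingEnd ℂ) (ψ z) -
        ψ z * (starRingEnd ℂ) (kineticTerm hbar α ψ j k z))) := by
    rw [← hsum, massBalance, e1, mul_add, Finset.mul_sum]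
    simp only [Finset.mul_sum, mul_left_comm]
  have hconj : (starRingEnd ℂ) (schrodingerDefect hbar h α υ ψ z) =
      -(Complex.I * hbar) * (starRingEnd ℂ) (dd dirT ψ z) -
        (1 / 2 * (∑ j, ∑ k, (h j k : ℂ) * (starRingEnd ℂ) (kineticTerm hbar α ψ j k z)) +
          υ z * (starRingEnd ℂ) (ψ z)) := by
    simp [schrodingerDefect, map_sum, map_ofNat]
  have hs2 : ∑ j, ∑ k, (h j k : ℂ) * (-(1 / 2) * (kineticTerm hbar α ψ j k z *
        (starRingEnd ℂ) (ψ z) - ψ z * (starRingEnd ℂ) (kineticTerm hbar α ψ j k z))) =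
      -(1 / 2) * ((∑ j, ∑ k, (h j k : ℂ) * kineticTerm hbar α ψ j k z) * (starRingEnd ℂ) (ψ z) -
        ψ z * ∑ j, ∑ k, (h j k : ℂ) * (starRingEnd ℂ) (kineticTerm hbar α ψ j k z)) := by
    simp only [Finset.sum_mul, Finset.mul_sum, ← Finset.sum_sub_distrib]
    exact Finset.sum_congr rfl fun j _ => Finset.sum_congr rfl fun k _ => by ring
  rw [hsum', hs2, hconj, schrodingerDefect]
  ring

end Pure

section Pure

variable {T : Set ℝ} {M : Set (Coord N)} {hbar : ℝ} {h : Matrix (Fin N) (Fin N) ℝ}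
  {α : Fin N → ℝ × Coord N → ℝ} {υ : ℝ × Coord N → ℝ} {ψ : ℝ × Coord N → ℂ}

lemma dd_kineticTerm (hTM : IsOpen (T ×ˢ M)) (hα : ∀ k, ContDiffOn ℝ ∞ (α k) (T ×ˢ M))
    (hψ : ContDiffOn ℝ ∞ ψ (T ×ˢ M)) (i j k : Fin N) {z : ℝ × Coord N} (hz : z ∈ T ×ˢ M) :
    dd (dirX i) (kineticTerm hbar α ψ j k) z =
      -(hbar ^ 2 : ℂ) * dd (dirX i) (dd (dirX j) (dd (dirX k) ψ)) z -
      Complex.I * hbar * ((dd (dirX i) (dd (dirX j) (α k)) z : ℝ) * ψ z +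
        (dd (dirX j) (α k) z : ℝ) * dd (dirX i) ψ z) -
      2 * Complex.I * hbar * ((dd (dirX i) (α j) z : ℝ) * dd (dirX k) ψ z +
        α j z * dd (dirX i) (dd (dirX k) ψ) z) +
      (((dd (dirX i) (α j) z : ℝ) * α k z + α j z * (dd (dirX i) (α k) z : ℝ)) * ψ z +
        α j z * α k z * dd (dirX i) ψ z) := by
  have diff : ∀ {f : ℝ × Coord N → ℂ}, ContDiffOn ℝ ∞ f (T ×ˢ M) → DifferentiableAt ℝ f z :=
    fun hf => differentiableAt_of_contDiffOn hTM hf hz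
  have diff' : ∀ {f : ℝ × Coord N → ℝ}, ContDiffOn ℝ ∞ f (T ×ˢ M) → DifferentiableAt ℝ f z :=
    fun hf => differentiableAt_of_contDiffOn hTM hf hz
  have cast : ∀ {f : ℝ × Coord N → ℝ}, DifferentiableAt ℝ f z →
      DifferentiableAt ℝ (fun z => (f z : ℂ)) z := fun hf =>
    Complex.ofRealCLM.differentiableAt.comp z hf
  have hψz := diff hψ
  have h1 := diff (contDiffOn_dd hTM (contDiffOn_dd hTM hψ (dirX k)) (dirX j))
  have h2 := diff (contDiffOn_dd hTM hψ (dirX k))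
  have h3 := diff' (contDiffOn_dd hTM (hα k) (dirX j))
  have hj := diff' (hα j)
  have hk := diff' (hα k)
  have m3 : DifferentiableAt ℝ (fun z => ((dd (dirX j) (α k) z : ℝ) : ℂ) * ψ z) z :=
    (cast h3).mul hψz
  have m2 : DifferentiableAt ℝ (fun z => (α j z : ℂ) * dd (dirX k) ψ z) z := (cast hj).mul h2
  have mjk : DifferentiableAt ℝ (fun z => (α j z : ℂ) * (α k z : ℂ)) z := (cast hj).mul (cast hk)
  have m4 : DifferentiableAt ℝ (fun z => (α j z : ℂ) * (α k z : ℂ) * ψ z) z := mjk.mul hψz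
  have c1 := h1.const_mul (-(hbar ^ 2 : ℂ))
  have c3 := m3.const_mul (Complex.I * hbar)
  have c2 := m2.const_mul (2 * Complex.I * hbar)
  have c13 : DifferentiableAt ℝ (fun z => -(hbar ^ 2 : ℂ) * dd (dirX j) (dd (dirX k) ψ) z -
    Complex.I * hbar * ((dd (dirX j) (α k) z : ℝ) * ψ z)) z := c1.sub c3
  have c132 : DifferentiableAt ℝ (fun z => -(hbar ^ 2 : ℂ) * dd (dirX j) (dd (dirX k) ψ) z -
    Complex.I * hbar * ((dd (dirX j) (α k) z : ℝ) * ψ z) -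
    2 * Complex.I * hbar * (α j z * dd (dirX k) ψ z)) z := c13.sub c2
  have := dd_add c132 m4 (dirX i)
  rw [dd_sub c13 c2, dd_sub c1 c3, dd_const_mul, dd_const_mul, dd_const_mul,
    dd_mul (cast h3) hψz, dd_mul (cast hj) h2, dd_mul mjk hψz, dd_mul (cast hj) (cast hk),
    dd_ofReal h3, dd_ofReal hj, dd_ofReal hk] at this
  exact this

lemma dd_schrodingerDefect (hTM : IsOpen (T ×ˢ M))
    (hα : ∀ k, ContDiffOn ℝ ∞ (α k) (T ×ˢ M)) (hυ : ContDiffOn ℝ ∞ υ (T ×ˢ M))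
    (hψ : ContDiffOn ℝ ∞ ψ (T ×ˢ M)) (i : Fin N) {z : ℝ × Coord N} (hz : z ∈ T ×ˢ M) :
    dd (dirX i) (schrodingerDefect hbar h α υ ψ) z =
      Complex.I * hbar * dd (dirX i) (dd dirT ψ) z -
      (1 / 2 * (∑ j, ∑ k, (h j k : ℂ) * dd (dirX i) (kineticTerm hbar α ψ j k) z) +
        ((dd (dirX i) υ z : ℝ) * ψ z + υ z * dd (dirX i) ψ z)) := by
  have diff : ∀ {f : ℝ × Coord N → ℂ}, ContDiffOn ℝ ∞ f (T ×ˢ M) → DifferentiableAt ℝ f z :=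
    fun hf => differentiableAt_of_contDiffOn hTM hf hz
  have hυz := differentiableAt_of_contDiffOn hTM hυ hz
  have hυc : DifferentiableAt ℝ (fun z => (υ z : ℂ)) z :=
    Complex.ofRealCLM.differentiableAt.comp z hυz
  have h1 := diff (contDiffOn_dd hTM hψ dirT)
  have h2 := fun j k => diff (contDiffOn_kineticTerm (hbar := hbar) hTM hα hψ j k)
  have h3 : ∀ j k, DifferentiableAt ℝ (fun z => (h j k : ℂ) * kineticTerm hbar α ψ j k z) z :=
    fun j k => (h2 j k).const_mul _
  have h4 : ∀ j, DifferentiableAt ℝ (fun z => ∑ k, (h j k : ℂ) * kineticTerm hbar α ψ j k z) z :=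
    fun j => DifferentiableAt.fun_sum fun k _ => h3 j k
  have h5 : DifferentiableAt ℝ
      (fun z => ∑ j, ∑ k, (h j k : ℂ) * kineticTerm hbar α ψ j k z) z :=
    DifferentiableAt.fun_sum fun j _ => h4 j
  have h6 : DifferentiableAt ℝ (fun z => (υ z : ℂ) * ψ z) z := hυc.mul (diff hψ)
  have h7 : DifferentiableAt ℝ (fun z => 1 / 2 * (∑ j, ∑ k, (h j k : ℂ) *
    kineticTerm hbar α ψ j k z) + υ z * ψ z) z := (h5.const_mul _).add h6
  have := dd_sub (h1.const_mul (Complex.I * hbar)) h7 (dirX i)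
  rw [dd_add (h5.const_mul _) h6, dd_const_mul, dd_const_mul, dd_sum _ fun j _ => h4 j,
    dd_mul hυc (diff hψ), dd_ofReal hυz] at this
  simp only [dd_sum _ fun k _ => h3 _ k, dd_const_mul] at this
  exact this

/-- For the kernel `ψ ⊗ ψ̄` the momentum balance is, up to a factor, the transverse derivative on
the diagonal of `G ⊗ ψ̄ - ψ ⊗ Ḡ`, where `G = iħ ∂_t ψ - 𝓗 ψ`. -/
lemma momentumBalance_tensorKernel (hTM : IsOpen (T ×ˢ M)) (hTMM : IsOpen (T ×ˢ M ×ˢ M))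
    (hh : h.IsSymm) (hα : ∀ k, ContDiffOn ℝ ∞ (α k) (T ×ˢ M)) (hυ : ContDiffOn ℝ ∞ υ (T ×ˢ M))
    (hψ : ContDiffOn ℝ ∞ ψ (T ×ˢ M)) (i : Fin N) {z : ℝ × Coord N} (hz : z ∈ T ×ˢ M) :
    -2 * momentumBalance hbar h α υ i (tensorKernel ψ ψ) z =
      dd (dirX i) (schrodingerDefect hbar h α υ ψ) z * (starRingEnd ℂ) (ψ z) -
      schrodingerDefect hbar h α υ ψ z * (starRingEnd ℂ) (dd (dirX i) ψ z) -
      dd (dirX i) ψ z * (starRingEnd ℂ) (schrodingerDefect hbar h α υ ψ z) +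
      ψ z * (starRingEnd ℂ) (dd (dirX i) (schrodingerDefect hbar h α υ ψ) z) := by
  have hdz : diagCLM z ∈ T ×ˢ M ×ˢ M := ⟨hz.1, hz.2, hz.2⟩
  have hd1 := fun k => contDiffOn_dd hTM hψ (dirX k)
  have hd2 := fun j k => contDiffOn_dd hTM (hd1 k) (dirX j)
  have diff : ∀ {f g : ℝ × Coord N → ℂ}, ContDiffOn ℝ ∞ f (T ×ˢ M) → ContDiffOn ℝ ∞ g (T ×ˢ M) →
      ∀ w ∈ T ×ˢ M ×ˢ M, DifferentiableAt ℝ (tensorKernel f g) w := fun hf hg w hw =>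
    differentiableAt_of_contDiffOn hTMM (contDiffOn_tensorKernel hf hg) hw
  have hrel := fun k => dd_dirRel_tensorKernel hTM hψ hψ k
  have e0 : tensorKernel ψ ψ (diagCLM z) = ψ z * (starRingEnd ℂ) (ψ z) := rfl
  have e1 : dd dirT₂ (dd (dirRel i) (tensorKernel ψ ψ)) (diagCLM z) =
      (dd dirT (dd (dirX i) ψ) z * (starRingEnd ℂ) (ψ z) +
        dd (dirX i) ψ z * (starRingEnd ℂ) (dd dirT ψ z)) -
      (dd dirT ψ z * (starRingEnd ℂ) (dd (dirX i) ψ z) +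
        ψ z * (starRingEnd ℂ) (dd dirT (dd (dirX i) ψ) z)) := by
    rw [dd_congr hTMM (hrel i) _ _ hdz, dd_sub (diff (hd1 i) hψ _ hdz) (diff hψ (hd1 i) _ hdz),
      dd_dirT₂_tensorKernel hTM (hd1 i) hψ _ hdz, dd_dirT₂_tensorKernel hTM hψ (hd1 i) _ hdz]
    rfl
  have e2 : ∀ j, dd (dirRel j) (tensorKernel ψ ψ) (diagCLM z) =
      dd (dirX j) ψ z * (starRingEnd ℂ) (ψ z) - ψ z * (starRingEnd ℂ) (dd (dirX j) ψ z) :=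
    fun j => hrel j _ hdz
  have e3 : ∀ j k, dd (dirTan j) (dd (dirRel k) (tensorKernel ψ ψ)) (diagCLM z) =
      (dd (dirX j) (dd (dirX k) ψ) z * (starRingEnd ℂ) (ψ z) +
        dd (dirX k) ψ z * (starRingEnd ℂ) (dd (dirX j) ψ z)) -
      (dd (dirX j) ψ z * (starRingEnd ℂ) (dd (dirX k) ψ z) +
        ψ z * (starRingEnd ℂ) (dd (dirX j) (dd (dirX k) ψ) z)) := fun j k => by
    rw [dd_congr hTMM (hrel k) _ _ hdz, dd_sub (diff (hd1 k) hψ _ hdz) (diff hψ (hd1 k) _ hdz),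
      dd_dirTan_tensorKernel hTM (hd1 k) hψ j _ hdz, dd_dirTan_tensorKernel hTM hψ (hd1 k) j _ hdz]
    rfl
  have e4 : ∀ k, ∀ w ∈ T ×ˢ M ×ˢ M, dd (dirRel k) (dd (dirRel i) (tensorKernel ψ ψ)) w =
      (tensorKernel (dd (dirX k) (dd (dirX i) ψ)) ψ w -
        tensorKernel (dd (dirX i) ψ) (dd (dirX k) ψ) w) -
      (tensorKernel (dd (dirX k) ψ) (dd (dirX i) ψ) w -
        tensorKernel ψ (dd (dirX k) (dd (dirX i) ψ)) w) := fun k w hw => by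
    rw [dd_congr hTMM (hrel i) _ _ hw, dd_sub (diff (hd1 i) hψ _ hw) (diff hψ (hd1 i) _ hw),
      dd_dirRel_tensorKernel hTM (hd1 i) hψ k _ hw, dd_dirRel_tensorKernel hTM hψ (hd1 i) k _ hw]
  have e5 : ∀ j k, dd (dirTan j) (dd (dirRel k) (dd (dirRel i) (tensorKernel ψ ψ))) (diagCLM z) =
      ((dd (dirX j) (dd (dirX k) (dd (dirX i) ψ)) z * (starRingEnd ℂ) (ψ z) +
          dd (dirX k) (dd (dirX i) ψ) z * (starRingEnd ℂ) (dd (dirX j) ψ z)) -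
        (dd (dirX j) (dd (dirX i) ψ) z * (starRingEnd ℂ) (dd (dirX k) ψ z) +
          dd (dirX i) ψ z * (starRingEnd ℂ) (dd (dirX j) (dd (dirX k) ψ) z))) -
      ((dd (dirX j) (dd (dirX k) ψ) z * (starRingEnd ℂ) (dd (dirX i) ψ z) +
          dd (dirX k) ψ z * (starRingEnd ℂ) (dd (dirX j) (dd (dirX i) ψ) z)) -
        (dd (dirX j) ψ z * (starRingEnd ℂ) (dd (dirX k) (dd (dirX i) ψ) z) +
          ψ z * (starRingEnd ℂ) (dd (dirX j) (dd (dirX k) (dd (dirX i) ψ)) z))) := fun j k => by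
    have d1 := diff (hd2 k i) hψ _ hdz
    have d2 := diff (hd1 i) (hd1 k) _ hdz
    have d3 := diff (hd1 k) (hd1 i) _ hdz
    have d4 := diff hψ (hd2 k i) _ hdz
    rw [dd_congr hTMM (e4 k) _ _ hdz, dd_sub (d1.fun_sub d2) (d3.fun_sub d4), dd_sub d1 d2,
      dd_sub d3 d4,
      dd_dirTan_tensorKernel hTM (hd2 k i) hψ j _ hdz,
      dd_dirTan_tensorKernel hTM (hd1 i) (hd1 k) j _ hdz,
      dd_dirTan_tensorKernel hTM (hd1 k) (hd1 i) j _ hdz,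
      dd_dirTan_tensorKernel hTM hψ (hd2 k i) j _ hdz]
    rfl
  have c2 : ∀ j k, dd (dirX j) (dd (dirX k) ψ) z = dd (dirX k) (dd (dirX j) ψ) z :=
    fun j k => dd_comm hTM hψ _ _ hz
  have c3 : ∀ j k, dd (dirX j) (dd (dirX k) (dd (dirX i) ψ)) z =
      dd (dirX i) (dd (dirX j) (dd (dirX k) ψ)) z := fun j k => by
    rw [dd_congr hTM (fun w hw => dd_comm hTM hψ (dirX k) (dirX i) hw) _ _ hz,
      dd_comm hTM (hd1 k) _ _ hz]
  have c3' : ∀ j k, dd (dirX i) (dd (dirX j) (dd (dirX k) ψ)) z =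
      dd (dirX i) (dd (dirX k) (dd (dirX j) ψ)) z := fun j k =>
    dd_congr hTM (fun w hw => dd_comm hTM hψ (dirX j) (dirX k) hw) _ _ hz
  have ct : dd dirT (dd (dirX i) ψ) z = dd (dirX i) (dd dirT ψ) z := dd_comm hTM hψ _ _ hz
  set K := kineticTerm hbar α ψ with hK
  have hsum : ∑ j, ∑ k, (h j k : ℂ) *
      (-2 * ((-(Complex.I * (hbar / 2))) ^ 2 *
          dd (dirTan j) (dd (dirRel k) (dd (dirRel i) (tensorKernel ψ ψ))) (diagCLM z) +
        (dd (dirX j) (α k) z : ℝ) *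
          (-(Complex.I * (hbar / 2)) * dd (dirRel i) (tensorKernel ψ ψ) (diagCLM z)) +
        α k z * (-(Complex.I * (hbar / 2)) *
          dd (dirTan j) (dd (dirRel i) (tensorKernel ψ ψ)) (diagCLM z)) +
        (dd (dirX i) (α k) z : ℝ) *
          (-(Complex.I * (hbar / 2)) * dd (dirRel j) (tensorKernel ψ ψ) (diagCLM z)) +
        α j z * (dd (dirX i) (α k) z : ℝ) * tensorKernel ψ ψ (diagCLM z))) =
      ∑ j, ∑ k, (h j k : ℂ) * (-(1 / 2) * (dd (dirX i) (K j k) z * (starRingEnd ℂ) (ψ z) -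
        K j k z * (starRingEnd ℂ) (dd (dirX i) ψ z) -
        dd (dirX i) ψ z * (starRingEnd ℂ) (K j k z) +
        ψ z * (starRingEnd ℂ) (dd (dirX i) (K j k) z))) := by
    refine sum_symm_congr hh fun j k => ?_
    simp only [hK, e0, e2, e3, e5, dd_kineticTerm hTM hα hψ _ _ _ hz, kineticTerm, map_add,
      map_sub, map_mul, map_neg, map_pow, Complex.conj_ofReal, Complex.conj_I, map_ofNat]
    rw [c3 j k, c3 k j, c3' k j, c2 k j, c2 j i, c2 k i]
    ring_nf
    simp only [Complex.I_sq]
    ring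
  have hlhs : -2 * momentumBalance hbar h α υ i (tensorKernel ψ ψ) z =
      Complex.I * hbar * dd dirT₂ (dd (dirRel i) (tensorKernel ψ ψ)) (diagCLM z) +
      (∑ j, ∑ k, (h j k : ℂ) * (-(1 / 2) * (dd (dirX i) (K j k) z * (starRingEnd ℂ) (ψ z) -
        K j k z * (starRingEnd ℂ) (dd (dirX i) ψ z) -
        dd (dirX i) ψ z * (starRingEnd ℂ) (K j k z) +
        ψ z * (starRingEnd ℂ) (dd (dirX i) (K j k) z)))) -
      2 * ((dd (dirX i) υ z : ℝ) * tensorKernel ψ ψ (diagCLM z)) := by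
    rw [← hsum, momentumBalance, mul_add, mul_add, Finset.mul_sum]
    simp only [Finset.mul_sum, mul_left_comm (-2 : ℂ)]
    ring
  have hconj : (starRingEnd ℂ) (schrodingerDefect hbar h α υ ψ z) =
      -(Complex.I * hbar) * (starRingEnd ℂ) (dd dirT ψ z) -
        (1 / 2 * (∑ j, ∑ k, (h j k : ℂ) * (starRingEnd ℂ) (K j k z)) +
          υ z * (starRingEnd ℂ) (ψ z)) := by
    simp [schrodingerDefect, map_sum, map_ofNat, hK]
  have hconj' : (starRingEnd ℂ) (dd (dirX i) (schrodingerDefect hbar h α υ ψ) z) =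
      -(Complex.I * hbar) * (starRingEnd ℂ) (dd (dirX i) (dd dirT ψ) z) -
        (1 / 2 * (∑ j, ∑ k, (h j k : ℂ) * (starRingEnd ℂ) (dd (dirX i) (K j k) z)) +
          ((dd (dirX i) υ z : ℝ) * (starRingEnd ℂ) (ψ z) +
            υ z * (starRingEnd ℂ) (dd (dirX i) ψ z))) := by
    simp [dd_schrodingerDefect hTM hα hυ hψ i hz, map_sum, map_ofNat, hK]
  have hs2 : ∑ j, ∑ k, (h j k : ℂ) * (-(1 / 2) * (dd (dirX i) (K j k) z * (starRingEnd ℂ) (ψ z) -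
        K j k z * (starRingEnd ℂ) (dd (dirX i) ψ z) -
        dd (dirX i) ψ z * (starRingEnd ℂ) (K j k z) +
        ψ z * (starRingEnd ℂ) (dd (dirX i) (K j k) z))) =
      -(1 / 2) * ((∑ j, ∑ k, (h j k : ℂ) * dd (dirX i) (K j k) z) * (starRingEnd ℂ) (ψ z) -
        (∑ j, ∑ k, (h j k : ℂ) * K j k z) * (starRingEnd ℂ) (dd (dirX i) ψ z) -
        dd (dirX i) ψ z * (∑ j, ∑ k, (h j k : ℂ) * (starRingEnd ℂ) (K j k z)) +
        ψ z * ∑ j, ∑ k, (h j k : ℂ) * (starRingEnd ℂ) (dd (dirX i) (K j k) z)) := by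
    simp only [Finset.sum_mul, Finset.mul_sum, ← Finset.sum_sub_distrib, ← Finset.sum_add_distrib]
    exact Finset.sum_congr rfl fun j _ => Finset.sum_congr rfl fun k _ => by ring
  rw [hlhs, hs2, hconj, hconj', e0, e1, ct, dd_schrodingerDefect hTM hα hυ hψ i hz,
    schrodingerDefect]
  simp only [← hK]
  ring

/-- If the kernel `ψ ⊗ ψ̄` satisfies both balance laws, then the ratio of `iħ ∂_t ψ - 𝓗 ψ` to `ψ`
is real and has no spatial gradient where `ψ ≠ 0`. -/
lemma defect_div_of_balance (hTM : IsOpen (T ×ˢ M)) (hTMM : IsOpen (T ×ˢ M ×ˢ M))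
    (hh : h.IsSymm) (hα : ∀ k, ContDiffOn ℝ ∞ (α k) (T ×ˢ M)) (hυ : ContDiffOn ℝ ∞ υ (T ×ˢ M))
    (hψ : ContDiffOn ℝ ∞ ψ (T ×ˢ M))
    (h1 : ∀ z ∈ T ×ˢ M, massBalance hbar h α (tensorKernel ψ ψ) z = 0)
    (h2 : ∀ i, ∀ z ∈ T ×ˢ M, momentumBalance hbar h α υ i (tensorKernel ψ ψ) z = 0)
    {z : ℝ × Coord N} (hz : z ∈ T ×ˢ M) (hne : ψ z ≠ 0) :
    (schrodingerDefect hbar h α υ ψ z / ψ z).im = 0 ∧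
    ∀ i, dd (dirX i) (fun w => schrodingerDefect hbar h α υ ψ w / ψ w) z = 0 := by
  set G := schrodingerDefect hbar h α υ ψ with hG
  have hGs : ContDiffOn ℝ ∞ G (T ×ˢ M) := contDiffOn_schrodingerDefect hTM hα hυ hψ
  have hGz := differentiableAt_of_contDiffOn hTM hGs hz
  have hψz := differentiableAt_of_contDiffOn hTM hψ hz
  have hψc : (starRingEnd ℂ) (ψ z) ≠ 0 := (map_ne_zero _).2 hne
  have hreal : ∀ w ∈ T ×ˢ M, G w * (starRingEnd ℂ) (ψ w) = ψ w * (starRingEnd ℂ) (G w) :=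
    fun w hw => by
      have := massBalance_tensorKernel (υ := υ) (hbar := hbar) (α := α) hTM hTMM hh hψ hw
      rw [h1 w hw, mul_zero] at this
      exact (sub_eq_zero.1 this.symm)
  refine ⟨?_, fun i => ?_⟩
  · rw [← Complex.conj_eq_iff_im, map_div₀, div_eq_div_iff hψc hne]
    linear_combination -hreal z hz
  · have hψcd : DifferentiableAt ℝ (fun w => (starRingEnd ℂ) (ψ w)) z :=
      Complex.conjCLE.toContinuousLinearMap.differentiableAt.comp z hψz
    have hGcd : DifferentiableAt ℝ (fun w => (starRingEnd ℂ) (G w)) z :=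
      Complex.conjCLE.toContinuousLinearMap.differentiableAt.comp z hGz
    have hd := dd_congr hTM hreal (dirX i) z hz
    rw [dd_mul hGz hψcd, dd_mul hψz hGcd, dd_conj hψz, dd_conj hGz] at hd
    have hm := momentumBalance_tensorKernel (hbar := hbar) hTM hTMM hh hα hυ hψ i hz
    rw [h2 i z hz, mul_zero] at hm
    simp only [← hG] at hm
    have hr := hreal z hz
    have key : dd (dirX i) G z * ψ z = dd (dirX i) ψ z * G z :=
      mul_right_cancel₀ hψc (by
        linear_combination (1 / 2 * ψ z) * hd - (1 / 2 * ψ z) * hm - dd (dirX i) ψ z * hr)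
    -- differentiate `ψ · (G / ψ) = G`
    have hq : DifferentiableAt ℝ (fun w => G w / ψ w) z := by
      simp only [div_eq_mul_inv]
      exact hGz.mul (hψz.inv hne)
    have hev : (fun w => ψ w * (G w / ψ w)) =ᶠ[𝓝 z] G := by
      filter_upwards [hψz.continuousAt.eventually_ne hne] with w hw
      exact mul_div_cancel₀ _ hw
    have hprod := dd_mul hψz hq (dirX i)
    rw [dd, hev.fderiv_eq, ← dd] at hprod
    have : ψ z * dd (dirX i) (fun w => G w / ψ w) z = 0 := by
      have h3 : ψ z * (G z / ψ z) = G z := mul_div_cancel₀ _ hne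
      refine mul_left_cancel₀ hne ?_
      linear_combination -ψ z * hprod + key - dd (dirX i) ψ z * h3
    exact (mul_eq_zero.1 this).resolve_left hne

end Pure

/-! ### The moments of a labelled kernel -/

/-- The midpoint `(t, (x + y) / 2)`. -/
noncomputable def midCLM : (ℝ × Coord N × Coord N) →L[ℝ] ℝ × Coord N :=
  (ContinuousLinearMap.fst ℝ ℝ _).prod ((1 / 2 : ℝ) •
    ((ContinuousLinearMap.fst ℝ _ _).comp (ContinuousLinearMap.snd ℝ ℝ _) +
      (ContinuousLinearMap.snd ℝ _ _).comp (ContinuousLinearMap.snd ℝ ℝ _)))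

lemma midCLM_apply (z : ℝ × Coord N × Coord N) :
    midCLM z = (z.1, (1 / 2 : ℝ) • (z.2.1 + z.2.2)) := rfl

lemma midCLM_diagCLM (z : ℝ × Coord N) : midCLM (diagCLM z) = z := by
  ext1
  · rfl
  · simp [midCLM_apply, ← two_smul ℝ, smul_smul]

/-- The kernel `a` is `ρ((x + y) / 2) u(x) \overline{u(y)}` wherever the midpoint is in `M`, for a
phase factor `u` with `∂_k u = (i/ħ) p_k u`. -/
structure IsPhaseKernel (hbar : ℝ) (T : Set ℝ) (M : Set (Coord N))
    (a : ℝ × Coord N × Coord N → ℂ) (ρ : ℝ × Coord N → ℝ) (u : ℝ × Coord N → ℂ)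
    (p : Fin N → ℝ × Coord N → ℝ) : Prop where
  smooth : ContDiffOn ℝ ∞ a (T ×ˢ M ×ˢ M)
  smooth_phase : ContDiffOn ℝ ∞ u (T ×ˢ M)
  smooth_momentum : ∀ k, ContDiffOn ℝ ∞ (p k) (T ×ˢ M)
  mul_conj_phase : ∀ z ∈ T ×ˢ M, u z * (starRingEnd ℂ) (u z) = 1
  dd_phase : ∀ k, ∀ z ∈ T ×ˢ M, dd (dirX k) u z = Complex.I / hbar * (p k z * u z)
  eq_phase : ∀ z ∈ T ×ˢ M ×ˢ M, midCLM z ∈ T ×ˢ M → a z = ρ (midCLM z) * tensorKernel u u z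

section Moments

variable {hbar : ℝ} {T : Set ℝ} {M : Set (Coord N)} {a : ℝ × Coord N × Coord N → ℂ}
  {ρ : ℝ × Coord N → ℝ} {u : ℝ × Coord N → ℂ} {p : Fin N → ℝ × Coord N → ℝ}

lemma IsPhaseKernel.diag (H : IsPhaseKernel hbar T M a ρ u p) {z : ℝ × Coord N}
    (hz : z ∈ T ×ˢ M) : a (diagCLM z) = ρ z := by
  have h := H.eq_phase (diagCLM z) ⟨hz.1, hz.2, hz.2⟩ (by rwa [midCLM_diagCLM])
  have h' : tensorKernel u u (diagCLM z) = 1 := H.mul_conj_phase z hz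
  rw [h, midCLM_diagCLM, h', mul_one]

lemma IsPhaseKernel.smooth_density (H : IsPhaseKernel hbar T M a ρ u p) :
    ContDiffOn ℝ ∞ ρ (T ×ˢ M) := by
  have h : ContDiffOn ℝ ∞ (fun z => a (diagCLM z)) (T ×ˢ M) :=
    H.smooth.comp diagCLM.contDiff.contDiffOn fun z hz => ⟨hz.1, hz.2, hz.2⟩
  refine (Complex.reCLM.contDiff.comp_contDiffOn h).congr fun z hz => ?_
  change ρ z = (a (diagCLM z)).re
  rw [H.diag hz, Complex.ofReal_re]

/-- Transverse derivatives of the kernel multiply it by the sum of the two momenta, because the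
midpoint does not move. -/
lemma IsPhaseKernel.dd_dirRel (H : IsPhaseKernel hbar T M a ρ u p) (hTM : IsOpen (T ×ˢ M))
    (hTMM : IsOpen (T ×ˢ M ×ˢ M)) (k : Fin N) :
    ∀ z ∈ (T ×ˢ M ×ˢ M) ∩ midCLM ⁻¹' (T ×ˢ M), dd (dirRel k) a z =
      Complex.I / hbar * (((p k (leftCLM z) + p k (rightCLM z) : ℝ) : ℂ) * a z) := fun z hz => by
  have hD : IsOpen ((T ×ˢ M ×ˢ M) ∩ midCLM ⁻¹' (T ×ˢ M)) :=
    hTMM.inter (hTM.preimage midCLM.continuous)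
  have hρ := differentiableAt_of_contDiffOn hTM H.smooth_density hz.2
  have hρm : DifferentiableAt ℝ (fun z => ρ (midCLM z)) z := hρ.comp z midCLM.differentiableAt
  have hρc : DifferentiableAt ℝ (fun z => (ρ (midCLM z) : ℂ)) z :=
    Complex.ofRealCLM.differentiableAt.comp z hρm
  have hten := differentiableAt_of_contDiffOn hTMM
    (contDiffOn_tensorKernel H.smooth_phase H.smooth_phase) hz.1
  have hmid : midCLM (dirRel k) = 0 := by simp [midCLM_apply, dirRel]
  have h0 : dd (dirRel k) (fun z => (ρ (midCLM z) : ℂ)) z = 0 := by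
    rw [dd_ofReal hρm, dd_comp_clm midCLM hρ, hmid]
    simp [dd]
  rw [dd_congr hD (fun z hz => H.eq_phase z hz.1 hz.2) _ z hz, dd_mul hρc hten, h0,
    dd_dirRel_tensorKernel hTM H.smooth_phase H.smooth_phase k z hz.1, H.eq_phase z hz.1 hz.2]
  simp only [tensorKernel, H.dd_phase k _ (leftCLM_mem hz.1), H.dd_phase k _ (rightCLM_mem hz.1),
    map_mul, map_div₀, Complex.conj_I, Complex.conj_ofReal]
  push_cast
  ring

/-- The first moment of the kernel on the diagonal is the momentum density. -/
lemma IsPhaseKernel.dd_dirRel_diag (H : IsPhaseKernel hbar T M a ρ u p) (hTM : IsOpen (T ×ˢ M))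
    (hTMM : IsOpen (T ×ˢ M ×ˢ M)) (hhbar : hbar ≠ 0) (k : Fin N) {z : ℝ × Coord N}
    (hz : z ∈ T ×ˢ M) :
    -(Complex.I * (hbar / 2)) * dd (dirRel k) a (diagCLM z) = ((ρ z * p k z : ℝ) : ℂ) := by
  have hc : (hbar : ℂ) ≠ 0 := by exact_mod_cast hhbar
  rw [H.dd_dirRel hTM hTMM k (diagCLM z)
    ⟨⟨hz.1, hz.2, hz.2⟩, by rw [mem_preimage, midCLM_diagCLM]; exact hz⟩, H.diag hz]
  have e1 : leftCLM (diagCLM z) = z := rfl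
  have e2 : rightCLM (diagCLM z) = z := rfl
  rw [e1, e2]
  push_cast
  field_simp
  linear_combination (-2 * (p k z : ℂ) * ρ z) * Complex.I_sq

/-- The second moment of the kernel on the diagonal is the momentum flux `ρ p_k p_i`. -/
lemma IsPhaseKernel.dd_dirRel_dirRel_diag (H : IsPhaseKernel hbar T M a ρ u p)
    (hTM : IsOpen (T ×ˢ M)) (hTMM : IsOpen (T ×ˢ M ×ˢ M)) (hhbar : hbar ≠ 0) (k i : Fin N)
    {z : ℝ × Coord N} (hz : z ∈ T ×ˢ M) :
    (-(Complex.I * (hbar / 2))) ^ 2 * dd (dirRel k) (dd (dirRel i) a) (diagCLM z) =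
      ((ρ z * p k z * p i z : ℝ) : ℂ) := by
  have hc : (hbar : ℂ) ≠ 0 := by exact_mod_cast hhbar
  have hD : IsOpen ((T ×ˢ M ×ˢ M) ∩ midCLM ⁻¹' (T ×ˢ M)) :=
    hTMM.inter (hTM.preimage midCLM.continuous)
  have hzD : diagCLM z ∈ (T ×ˢ M ×ˢ M) ∩ midCLM ⁻¹' (T ×ˢ M) :=
    ⟨⟨hz.1, hz.2, hz.2⟩, by rw [mem_preimage, midCLM_diagCLM]; exact hz⟩
  have e1 : leftCLM (diagCLM z) = z := rfl
  have e2 : rightCLM (diagCLM z) = z := rfl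
  have hp : DifferentiableAt ℝ (p i) z :=
    differentiableAt_of_contDiffOn hTM (H.smooth_momentum i) hz
  have hl : DifferentiableAt ℝ (fun w => p i (leftCLM w)) (diagCLM z) :=
    DifferentiableAt.comp (diagCLM z) (g := p i) (by rwa [e1]) leftCLM.differentiableAt
  have hr : DifferentiableAt ℝ (fun w => p i (rightCLM w)) (diagCLM z) :=
    DifferentiableAt.comp (diagCLM z) (g := p i) (by rwa [e2]) rightCLM.differentiableAt
  have hlr : DifferentiableAt ℝ (fun w => p i (leftCLM w) + p i (rightCLM w)) (diagCLM z) :=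
    hl.add hr
  have hlrc : DifferentiableAt ℝ (fun w => ((p i (leftCLM w) + p i (rightCLM w) : ℝ) : ℂ))
      (diagCLM z) := Complex.ofRealCLM.differentiableAt.comp _ hlr
  have ha := differentiableAt_of_contDiffOn hTMM H.smooth hzD.1
  -- the derivatives of the two momenta cancel on the diagonal
  have h0 : dd (dirRel k) (fun w => ((p i (leftCLM w) + p i (rightCLM w) : ℝ) : ℂ))
      (diagCLM z) = 0 := by
    have h2 : rightCLM (dirRel k) = -leftCLM (dirRel k) := by simp [dirRel]
    rw [dd_ofReal hlr, dd_add hl hr, dd_comp_clm leftCLM (by rwa [e1]),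
      dd_comp_clm rightCLM (by rwa [e2]), h2, dd_neg_left, e1, e2, add_neg_cancel,
      Complex.ofReal_zero]
  rw [dd_congr hD (H.dd_dirRel hTM hTMM i) _ _ hzD, dd_const_mul, dd_mul hlrc ha, h0,
    H.dd_dirRel hTM hTMM k _ hzD, H.diag hz, e1, e2]
  push_cast
  field_simp
  have h4 : Complex.I ^ 4 = 1 := Complex.I_pow_four
  linear_combination (4 * (p i z : ℂ) * p k z * ρ z) * h4

/-- Directions tangent to the diagonal differentiate the restriction `F` of `c * f` to
it. -/
lemma dd_dirTan_diag {f : ℝ × Coord N × Coord N → ℂ} {F : ℝ × Coord N → ℝ} {c : ℂ}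
    (hTM : IsOpen (T ×ˢ M)) (hTMM : IsOpen (T ×ˢ M ×ˢ M))
    (hf : ContDiffOn ℝ ∞ f (T ×ˢ M ×ˢ M)) (hF : ContDiffOn ℝ ∞ F (T ×ˢ M))
    (h : ∀ z ∈ T ×ˢ M, c * f (diagCLM z) = F z) (v : ℝ × Coord N) {z : ℝ × Coord N}
    (hz : z ∈ T ×ˢ M) : c * dd (diagCLM v) f (diagCLM z) = ((dd v F z : ℝ) : ℂ) := by
  have h1 := differentiableAt_of_contDiffOn hTMM hf
    (show diagCLM z ∈ T ×ˢ M ×ˢ M from ⟨hz.1, hz.2, hz.2⟩)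
  rw [← dd_ofReal (differentiableAt_of_contDiffOn hTM hF hz),
    ← dd_congr hTM h v z hz, dd_const_mul, dd_comp_clm diagCLM h1]

variable {h : Matrix (Fin N) (Fin N) ℝ} {α : Fin N → ℝ × Coord N → ℝ} {υ : ℝ × Coord N → ℝ}

lemma IsPhaseKernel.massBalance_eq (H : IsPhaseKernel hbar T M a ρ u p) (hTM : IsOpen (T ×ˢ M))
    (hTMM : IsOpen (T ×ˢ M ×ˢ M)) (hhbar : hbar ≠ 0) {z : ℝ × Coord N} (hz : z ∈ T ×ˢ M) :
    massBalance hbar h α a z = ((dd dirT ρ z + ∑ j, ∑ k, h j k *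
      (dd (dirX j) (fun w => ρ w * p k w) z + dd (dirX j) (α k) z * ρ z +
        α k z * dd (dirX j) ρ z) : ℝ) : ℂ) := by
  have hρ := H.smooth_density
  have hdiag : ∀ z ∈ T ×ˢ M, 1 * a (diagCLM z) = ρ z := fun z hz => by rw [one_mul, H.diag hz]
  have e1 : dd dirT₂ a (diagCLM z) = ((dd dirT ρ z : ℝ) : ℂ) :=
    (one_mul _).symm.trans (dd_dirTan_diag hTM hTMM H.smooth hρ hdiag dirT hz)
  have e2 : ∀ j, dd (dirTan j) a (diagCLM z) = ((dd (dirX j) ρ z : ℝ) : ℂ) := fun j =>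
    (one_mul _).symm.trans (dd_dirTan_diag hTM hTMM H.smooth hρ hdiag (dirX j) hz)
  have e3 : ∀ j k, -(Complex.I * (hbar / 2)) * dd (dirTan j) (dd (dirRel k) a) (diagCLM z) =
      ((dd (dirX j) (fun w => ρ w * p k w) z : ℝ) : ℂ) := fun j k =>
    dd_dirTan_diag hTM hTMM (contDiffOn_dd hTMM H.smooth _) (hρ.mul (H.smooth_momentum k))
      (fun z hz => H.dd_dirRel_diag hTM hTMM hhbar k hz) (dirX j) hz
  simp only [massBalance, e1, e2, e3, H.diag hz]
  push_cast
  rfl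

lemma IsPhaseKernel.momentumBalance_eq (H : IsPhaseKernel hbar T M a ρ u p)
    (hTM : IsOpen (T ×ˢ M)) (hTMM : IsOpen (T ×ˢ M ×ˢ M)) (hhbar : hbar ≠ 0) (i : Fin N)
    {z : ℝ × Coord N} (hz : z ∈ T ×ˢ M) :
    momentumBalance hbar h α υ i a z = ((dd dirT (fun w => ρ w * p i w) z + (∑ j, ∑ k, h j k *
      (dd (dirX j) (fun w => ρ w * p k w * p i w) z + dd (dirX j) (α k) z * (ρ z * p i z) +
        α k z * dd (dirX j) (fun w => ρ w * p i w) z +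
        dd (dirX i) (α k) z * (ρ z * p j z) + α j z * dd (dirX i) (α k) z * ρ z)) +
      dd (dirX i) υ z * ρ z : ℝ) : ℂ) := by
  have hρ := H.smooth_density
  have hp := H.smooth_momentum
  have hrel := fun k => contDiffOn_dd hTMM H.smooth (dirRel k)
  have hd := fun k => fun z hz => H.dd_dirRel_diag hTM hTMM hhbar k (z := z) hz
  have e1 : -(Complex.I * (hbar / 2)) * dd dirT₂ (dd (dirRel i) a) (diagCLM z) =
      ((dd dirT (fun w => ρ w * p i w) z : ℝ) : ℂ) :=
    dd_dirTan_diag hTM hTMM (hrel i) (hρ.mul (hp i)) (hd i) dirT hz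
  have e2 : ∀ j, -(Complex.I * (hbar / 2)) * dd (dirTan j) (dd (dirRel i) a) (diagCLM z) =
      ((dd (dirX j) (fun w => ρ w * p i w) z : ℝ) : ℂ) := fun j =>
    dd_dirTan_diag hTM hTMM (hrel i) (hρ.mul (hp i)) (hd i) (dirX j) hz
  have e3 : ∀ j k, (-(Complex.I * (hbar / 2))) ^ 2 *
      dd (dirTan j) (dd (dirRel k) (dd (dirRel i) a)) (diagCLM z) =
      ((dd (dirX j) (fun w => ρ w * p k w * p i w) z : ℝ) : ℂ) := fun j k =>
    dd_dirTan_diag hTM hTMM (contDiffOn_dd hTMM (hrel i) _) ((hρ.mul (hp k)).mul (hp i))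
      (fun z hz => H.dd_dirRel_dirRel_diag hTM hTMM hhbar k i hz) (dirX j) hz
  simp only [momentumBalance, e1, e2, e3, H.diag hz, hd _ z hz]
  push_cast
  rfl

end Moments

/-! ### Labelled kernels are phase kernels -/

section Labelled

variable {hbar : ℝ} {M R : Set (Coord N)} {T : Set ℝ}

/-- The phase factor `e^{i (k · x + ζ_t(x))} ξ^{1/2}(x)`, a square root of the section
`e^{2i (k · x + ζ_t)} ξ`. -/
noncomputable def phaseFactor (ξ : Background hbar M R) (k : Coord N) (ζ : ℝ → Coord N → ℝ)
    (z : ℝ × Coord N) : ℂ :=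
  Complex.exp (Complex.I * ((k ⬝ᵥ z.2 + ζ z.1 z.2 : ℝ) : ℂ)) * ξ.root z.2

lemma mul_conj_eq_one_of_norm {c : ℂ} (h : ‖c‖ = 1) : c * (starRingEnd ℂ) c = 1 := by
  rw [Complex.mul_conj, Complex.normSq_eq_norm_sq, h]; norm_num

lemma exp_I_mul_conj (r : ℝ) :
    (starRingEnd ℂ) (Complex.exp (Complex.I * (r : ℂ))) = Complex.exp (-(Complex.I * (r : ℂ))) := by
  rw [← Complex.exp_conj, map_mul, Complex.conj_I, Complex.conj_ofReal, neg_mul]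

lemma contDiffOn_phaseFactor (ξ : Background hbar M R) (k : Coord N) {ζ : ℝ → Coord N → ℝ}
    (hζ : ContDiffOn ℝ ∞ (fun z : ℝ × Coord N => ζ z.1 z.2) (T ×ˢ M)) :
    ContDiffOn ℝ ∞ (phaseFactor ξ k ζ) (T ×ˢ M) := by
  have h1 : ContDiff ℝ ∞ (fun z : ℝ × Coord N => k ⬝ᵥ z.2) := by
    unfold dotProduct
    exact ContDiff.sum fun i _ => contDiff_const.mul ((contDiff_apply ℝ ℝ i).comp contDiff_snd)
  have h2 : ContDiffOn ℝ ∞ (fun z : ℝ × Coord N => ((k ⬝ᵥ z.2 + ζ z.1 z.2 : ℝ) : ℂ)) (T ×ˢ M) :=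
    Complex.ofRealCLM.contDiff.comp_contDiffOn (h1.contDiffOn.add hζ)
  exact (contDiffOn_const.mul h2).cexp.mul
    (ξ.smooth.comp contDiff_snd.contDiffOn fun z hz => hz.2)

lemma phaseFactor_mul_conj (ξ : Background hbar M R) (k : Coord N) (ζ : ℝ → Coord N → ℝ)
    {z : ℝ × Coord N} (hz : z.2 ∈ M) :
    phaseFactor ξ k ζ z * (starRingEnd ℂ) (phaseFactor ξ k ζ z) = 1 := by
  refine mul_conj_eq_one_of_norm ?_
  rw [phaseFactor, norm_mul, ξ.norm_one _ hz, mul_comm Complex.I, Complex.norm_exp_ofReal_mul_I,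
    one_mul]

/-- The momentum of the section `u²` is `-iħ ū ∂_j u`, which is real because `|u| = 1`. -/
lemma momentum_sectionOf (ξ : Background hbar M R) (k : Coord N) {ζ : ℝ → Coord N → ℝ}
    (hTM : IsOpen (T ×ˢ M))
    (hζ : ContDiffOn ℝ ∞ (fun z : ℝ × Coord N => ζ z.1 z.2) (T ×ˢ M)) (j : Fin N)
    {z : ℝ × Coord N} (hz : z ∈ T ×ˢ M) :
    ((momentum hbar (sectionOf ξ k (ζ z.1)) z.2 j : ℝ) : ℂ) =
      -Complex.I * hbar * ((starRingEnd ℂ) (phaseFactor ξ k ζ z) *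
        dd (dirX j) (phaseFactor ξ k ζ) z) := by
  have hu := differentiableAt_of_contDiffOn hTM (contDiffOn_phaseFactor ξ k hζ) hz
  set u := phaseFactor ξ k ζ with hudef
  have hsq : sectionOf ξ k (ζ z.1) = fun x => u (z.1, x) * u (z.1, x) := by
    funext x
    simp only [sectionOf, hudef, phaseFactor]
    rw [show 2 * Complex.I * ((k ⬝ᵥ x + ζ z.1 x : ℝ) : ℂ) =
      Complex.I * ((k ⬝ᵥ x + ζ z.1 x : ℝ) : ℂ) + Complex.I * ((k ⬝ᵥ x + ζ z.1 x : ℝ) : ℂ) by ring,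
      Complex.exp_add]
    ring
  have huu : DifferentiableAt ℝ (fun w => u w * u w) z := hu.mul hu
  have hpd : pd (sectionOf ξ k (ζ z.1)) j z.2 = 2 * (u z * dd (dirX j) u z) := by
    rw [hsq, pd_slice (f := fun w => u w * u w) huu j, dd_mul hu hu]
    ring
  have h1 : u z * (starRingEnd ℂ) (u z) = 1 := phaseFactor_mul_conj ξ k ζ hz.2
  have hne : u z ≠ 0 := left_ne_zero_of_mul_eq_one h1
  have hval : sectionOf ξ k (ζ z.1) z.2 = u z * u z := by rw [hsq]
  have hinv : (u z * u z)⁻¹ * (2 * (u z * dd (dirX j) u z)) =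
      2 * ((starRingEnd ℂ) (u z) * dd (dirX j) u z) := by
    rw [eq_inv_of_mul_eq_one_right h1]
    field_simp
  -- differentiating `u ū = 1` shows that `ū ∂_j u` is imaginary
  have him : (starRingEnd ℂ) ((starRingEnd ℂ) (u z) * dd (dirX j) u z) =
      -((starRingEnd ℂ) (u z) * dd (dirX j) u z) := by
    have huc : DifferentiableAt ℝ (fun w => (starRingEnd ℂ) (u w)) z :=
      Complex.conjCLE.toContinuousLinearMap.differentiableAt.comp z hu
    have h2 := dd_congr hTM (g := fun _ => (1 : ℂ))
      (fun w hw => phaseFactor_mul_conj ξ k ζ hw.2) (dirX j) z hz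
    rw [dd_mul hu huc, dd_conj hu] at h2
    have h3 : dd (dirX j) (fun _ : ℝ × Coord N => (1 : ℂ)) z = 0 := by simp [dd]
    rw [h3] at h2
    rw [map_mul, Complex.conj_conj]
    linear_combination h2
  rw [momentum, hpd, hval, mul_assoc _ (u z * u z)⁻¹, hinv]
  have hre : -Complex.I * ((hbar / 2 : ℝ) : ℂ) *
      (2 * ((starRingEnd ℂ) (u z) * dd (dirX j) u z)) =
      -Complex.I * hbar * ((starRingEnd ℂ) (u z) * dd (dirX j) u z) := by
    push_cast; ring
  rw [hre]
  refine Complex.conj_eq_iff_re.1 ?_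
  rw [map_mul, him, map_mul, map_neg, Complex.conj_I, Complex.conj_ofReal]
  ring

/-- The exponent `(k + k'/2) · x - (k - k'/2) · y` is `k · (x - y) + k' · (x + y)/2`, so the
variable `k'` of integration only meets the midpoint. -/
lemma labelledIntegrand_eq (g : Matrix (Fin N) (Fin N) ℝ) (ζ₀ : Coord N → ℝ)
    (w : Coord N → Coord N → ℂ) (ξ : Background hbar M R) (k : Coord N) {x y : Coord N}
    (hy : y ∈ M) (hm : (1 / 2 : ℝ) • (x + y) ∈ M) (k' : Coord N) :
    labelledIntegrand (volDensity fun _ => g) ζ₀ w ξ k x y k' =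
      labelledIntegrand (volDensity fun _ => g) ζ₀ w ξ k
        ((1 / 2 : ℝ) • (x + y)) ((1 / 2 : ℝ) • (x + y)) k' *
      (Complex.exp (Complex.I * ((k ⬝ᵥ x + ζ₀ x : ℝ) : ℂ)) * ξ.root x *
        (starRingEnd ℂ) (Complex.exp (Complex.I * ((k ⬝ᵥ y + ζ₀ y : ℝ) : ℂ)) * ξ.root y)) := by
  set m := (1 / 2 : ℝ) • (x + y) with hmdef
  have hrm : ξ.root m * (ξ.root m)⁻¹ = 1 := mul_inv_cancel₀ (by
    rw [← norm_ne_zero_iff, ξ.norm_one m hm]; exact one_ne_zero)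
  have hry : (ξ.root y)⁻¹ = (starRingEnd ℂ) (ξ.root y) :=
    (eq_inv_of_mul_eq_one_right (mul_conj_eq_one_of_norm (ξ.norm_one y hy))).symm
  have hs : ∀ a b : Coord N, volDensity (fun _ => g) a = volDensity (fun _ => g) b :=
    fun _ _ => rfl
  simp only [labelledIntegrand, bra, ket, map_mul, exp_I_mul_conj, Complex.conj_ofReal, hry,
    hs m x, hs y x]
  have hexp : Complex.exp (Complex.I * (((k + (1 / 2 : ℝ) • k') ⬝ᵥ x + ζ₀ x : ℝ) : ℂ)) *
      Complex.exp (-(Complex.I * (((k - (1 / 2 : ℝ) • k') ⬝ᵥ y + ζ₀ y : ℝ) : ℂ))) =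
      Complex.exp (Complex.I * (((k + (1 / 2 : ℝ) • k') ⬝ᵥ m + ζ₀ m : ℝ) : ℂ)) *
      Complex.exp (-(Complex.I * (((k - (1 / 2 : ℝ) • k') ⬝ᵥ m + ζ₀ m : ℝ) : ℂ))) *
      Complex.exp (Complex.I * ((k ⬝ᵥ x + ζ₀ x : ℝ) : ℂ)) *
      Complex.exp (-(Complex.I * ((k ⬝ᵥ y + ζ₀ y : ℝ) : ℂ))) := by
    rw [← Complex.exp_add, ← Complex.exp_add, ← Complex.exp_add, ← Complex.exp_add]
    congr 1
    simp only [hmdef, add_dotProduct, sub_dotProduct, smul_dotProduct, dotProduct_smul,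
      dotProduct_add, smul_eq_mul]
    push_cast
    ring
  generalize Complex.exp (Complex.I * (((k + (1 / 2 : ℝ) • k') ⬝ᵥ x + ζ₀ x : ℝ) : ℂ)) = X1 at *
  generalize Complex.exp (-(Complex.I * (((k - (1 / 2 : ℝ) • k') ⬝ᵥ y + ζ₀ y : ℝ) : ℂ))) = X2 at *
  generalize Complex.exp (Complex.I * (((k + (1 / 2 : ℝ) • k') ⬝ᵥ m + ζ₀ m : ℝ) : ℂ)) = X3 at *
  generalize Complex.exp (-(Complex.I * (((k - (1 / 2 : ℝ) • k') ⬝ᵥ m + ζ₀ m : ℝ) : ℂ))) = X4 at *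
  generalize Complex.exp (Complex.I * ((k ⬝ᵥ x + ζ₀ x : ℝ) : ℂ)) = X5 at *
  generalize Complex.exp (-(Complex.I * ((k ⬝ᵥ y + ζ₀ y : ℝ) : ℂ))) = X6 at *
  generalize ((volDensity (fun _ => g) x ^ (-(1 / 2) : ℝ) : ℝ) : ℂ) = S at *
  generalize w (k + (1 / 2 : ℝ) • k') (k - (1 / 2 : ℝ) • k') = W at *
  generalize (ξ.root m)⁻¹ = ri at *
  linear_combination (W * ξ.root x * S * S * (starRingEnd ℂ) (ξ.root y)) * hexp -
    (W * X3 * X4 * S * S * X5 * ξ.root x * X6 * (starRingEnd ℂ) (ξ.root y)) * hrm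

/-- On the diagonal, conjugation of the integrand is the substitution `k' ↦ -k'`, as `w` is
hermitian; so the kernel is real there. -/
lemma labelledKernel_diag (g : Matrix (Fin N) (Fin N) ℝ) (ζ₀ : Coord N → ℝ)
    {w : Coord N → Coord N → ℂ} (hw : ∀ n n', (starRingEnd ℂ) (w n n') = w n' n)
    (ξ : Background hbar M R) (k : Coord N) {x : Coord N} (hx : x ∈ M) :
    labelledKernel (volDensity fun _ => g) ζ₀ w ξ k x x =
      ((emergenceDensity (volDensity fun _ => g) ζ₀ w ξ k x : ℝ) : ℂ) := by
  refine (Complex.conj_eq_iff_re.1 ?_).symm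
  have hr : (starRingEnd ℂ) (ξ.root x) = (ξ.root x)⁻¹ :=
    eq_inv_of_mul_eq_one_right (mul_conj_eq_one_of_norm (ξ.norm_one x hx))
  have hconj : ∀ k', (starRingEnd ℂ)
      (labelledIntegrand (volDensity fun _ => g) ζ₀ w ξ k x x k') =
      labelledIntegrand (volDensity fun _ => g) ζ₀ w ξ k x x (-k') := fun k' => by
    simp only [labelledIntegrand, bra, map_mul, hw, map_inv₀, hr, inv_inv, Complex.conj_conj,
      smul_neg, ← sub_eq_add_neg, sub_neg_eq_add]
    ring
  unfold labelledKernel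
  rw [← integral_conj]
  simp only [hconj]
  exact integral_neg_eq_self _ _

lemma isPhaseKernel_evolvedKernel (hTM : IsOpen (T ×ˢ M)) (hhbar : hbar ≠ 0)
    (g : Matrix (Fin N) (Fin N) ℝ) (ζ₀ : Coord N → ℝ) (ξ : Background hbar M R) (k : Coord N)
    {ζ : ℝ → Coord N → ℝ} (hζ : ContDiffOn ℝ ∞ (fun z : ℝ × Coord N => ζ z.1 z.2) (T ×ˢ M))
    {w : ℝ → Coord N → Coord N → ℂ}
    (hw : ∀ t ∈ T, ∀ n n', (starRingEnd ℂ) (w t n n') = w t n' n)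
    (ha : ContDiffOn ℝ ∞ (fun z : ℝ × Coord N × Coord N =>
      evolvedKernel (volDensity fun _ => g) ζ₀ (ζ z.1) (w z.1) ξ k z.2.1 z.2.2) (T ×ˢ M ×ˢ M)) :
    IsPhaseKernel hbar T M
      (fun z => evolvedKernel (volDensity fun _ => g) ζ₀ (ζ z.1) (w z.1) ξ k z.2.1 z.2.2)
      (fun z => emergenceDensity (volDensity fun _ => g) ζ₀ (w z.1) ξ k z.2)
      (phaseFactor ξ k ζ) (fun j z => momentum hbar (sectionOf ξ k (ζ z.1)) z.2 j) where
  smooth := ha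
  smooth_phase := contDiffOn_phaseFactor ξ k hζ
  smooth_momentum j := by
    have hu := contDiffOn_phaseFactor ξ k hζ
    have h1 : ContDiffOn ℝ ∞ (fun z => -Complex.I * hbar *
        ((starRingEnd ℂ) (phaseFactor ξ k ζ z) * dd (dirX j) (phaseFactor ξ k ζ) z)) (T ×ˢ M) :=
      contDiffOn_const.mul ((Complex.conjCLE.toContinuousLinearMap.contDiff.comp_contDiffOn hu).mul
        (contDiffOn_dd hTM hu _))
    refine (Complex.reCLM.contDiff.comp_contDiffOn h1).congr fun z hz => ?_
    have := congrArg Complex.re (momentum_sectionOf ξ k hTM hζ j hz)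
    rwa [Complex.ofReal_re] at this
  mul_conj_phase z hz := phaseFactor_mul_conj ξ k ζ hz.2
  dd_phase j z hz := by
    have hc : (hbar : ℂ) ≠ 0 := by exact_mod_cast hhbar
    have h1 := phaseFactor_mul_conj ξ k ζ hz.2
    rw [momentum_sectionOf ξ k hTM hζ j hz]
    field_simp
    linear_combination (-dd (dirX j) (phaseFactor ξ k ζ) z) * h1 +
      dd (dirX j) (phaseFactor ξ k ζ) z * (starRingEnd ℂ) (phaseFactor ξ k ζ z) *
        phaseFactor ξ k ζ z * Complex.I_sq
  eq_phase z hz hm := by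
    have hm' : (1 / 2 : ℝ) • (z.2.1 + z.2.2) ∈ M := hm.2
    have hker : labelledKernel (volDensity fun _ => g) ζ₀ (w z.1) ξ k z.2.1 z.2.2 =
        ((emergenceDensity (volDensity fun _ => g) ζ₀ (w z.1) ξ k
          ((1 / 2 : ℝ) • (z.2.1 + z.2.2)) : ℝ) : ℂ) *
        (Complex.exp (Complex.I * ((k ⬝ᵥ z.2.1 + ζ₀ z.2.1 : ℝ) : ℂ)) * ξ.root z.2.1 *
          (starRingEnd ℂ) (Complex.exp (Complex.I * ((k ⬝ᵥ z.2.2 + ζ₀ z.2.2 : ℝ) : ℂ)) *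
            ξ.root z.2.2)) := by
      rw [← labelledKernel_diag g ζ₀ (hw z.1 hz.1) ξ k hm', labelledKernel, labelledKernel,
        ← integral_mul_const]
      exact integral_congr_ae (Eventually.of_forall fun k' =>
        labelledIntegrand_eq g ζ₀ (w z.1) ξ k hz.2.2 hm' k')
    rw [evolvedKernel, hker, midCLM_apply, tensorKernel, leftCLM_apply, rightCLM_apply]
    simp only [phaseFactor, phaseOp, map_mul, exp_I_mul_conj, ← Complex.exp_neg]
    have e1 : Complex.exp (Complex.I * ((k ⬝ᵥ z.2.1 + ζ z.1 z.2.1 : ℝ) : ℂ)) =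
        Complex.exp (Complex.I * ((ζ z.1 z.2.1 - ζ₀ z.2.1 : ℝ) : ℂ)) *
          Complex.exp (Complex.I * ((k ⬝ᵥ z.2.1 + ζ₀ z.2.1 : ℝ) : ℂ)) := by
      rw [← Complex.exp_add]; congr 1; push_cast; ring
    have e2 : Complex.exp (-(Complex.I * ((k ⬝ᵥ z.2.2 + ζ z.1 z.2.2 : ℝ) : ℂ))) =
        Complex.exp (-(Complex.I * ((ζ z.1 z.2.2 - ζ₀ z.2.2 : ℝ) : ℂ))) *
          Complex.exp (-(Complex.I * ((k ⬝ᵥ z.2.2 + ζ₀ z.2.2 : ℝ) : ℂ))) := by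
      rw [← Complex.exp_add]; congr 1; push_cast; ring
    rw [e1, e2]
    ring

end Labelled

/-! ### The Lie-Poisson equation as a pair of pointwise balance laws -/

section LiePoisson

lemma fderiv_apply_eq_sum_pd (f : Coord N → ℝ) (x v : Coord N) :
    fderiv ℝ f x v = ∑ j, v j * pd f j x := by
  conv_lhs => rw [← Finset.univ_sum_single v]
  rw [map_sum]
  refine Finset.sum_congr rfl fun j _ => ?_
  have : (Pi.single j (v j) : Coord N) = v j • Pi.single j (1 : ℝ) := by
    rw [← Pi.single_smul]; simp
  rw [this, map_smul, smul_eq_mul, pd]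

lemma velocity_canonicalHam {h : Matrix (Fin N) (Fin N) ℝ} (hh : h.IsSymm) (A : Coord N → Coord N)
    (U : Coord N → ℝ) (x p : Coord N) (j : Fin N) :
    velocity (canonicalHam h A U) x p j = ∑ k, h j k * (p k + A x k) := by
  have hd : ∀ i, HasFDerivAt (fun p : Coord N => p i + A x i)
      (ContinuousLinearMap.proj (R := ℝ) (φ := fun _ : Fin N => ℝ) i) p := fun i =>
    ((ContinuousLinearMap.proj (R := ℝ) (φ := fun _ : Fin N => ℝ) i).hasFDerivAt).add_const _
  have h1 : HasFDerivAt (canonicalHam h A U x) ((1 / 2 : ℝ) • ∑ i, ∑ k,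
      ((h i k * (p i + A x i)) • ContinuousLinearMap.proj (R := ℝ) (φ := fun _ : Fin N => ℝ) k +
      (p k + A x k) • (h i k • ContinuousLinearMap.proj (R := ℝ) (φ := fun _ : Fin N => ℝ) i))) p :=
    ((HasFDerivAt.fun_sum fun i _ => HasFDerivAt.fun_sum fun k _ =>
      ((hd i).const_mul (h i k)).mul (hd k)).const_mul (1 / 2)).add_const _
  rw [velocity, pd, h1.fderiv]
  simp only [_root_.smul_apply, _root_.sum_apply, _root_.add_apply,
    ContinuousLinearMap.proj_apply, Pi.single_apply, smul_eq_mul, mul_ite, mul_one, mul_zero,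
    Finset.sum_add_distrib, Finset.sum_ite_eq', Finset.mem_univ, if_true]
  have h2 : ∑ i, ∑ k, (if i = j then (p k + A x k) * h i k else 0) =
      ∑ k, h j k * (p k + A x k) := by
    rw [Finset.sum_comm]
    exact Finset.sum_congr rfl fun k _ => by simp [mul_comm]
  have h3 : ∑ i, h i j * (p i + A x i) = ∑ k, h j k * (p k + A x k) :=
    Finset.sum_congr rfl fun k _ => by rw [hh.apply]
  rw [h2, h3]
  ring

lemma dd_flux {E : Type*} [NormedAddCommGroup E] [NormedSpace ℝ E] {c : Fin N → ℝ}
    {f α : Fin N → E → ℝ} {F : E → ℝ} {z : E} (hf : ∀ k, DifferentiableAt ℝ (f k) z)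
    (hα : ∀ k, DifferentiableAt ℝ (α k) z) (hF : DifferentiableAt ℝ F z) (v : E) :
    dd v (fun w => ∑ k, c k * (f k w + α k w * F w)) z =
      ∑ k, c k * (dd v (f k) z + dd v (α k) z * F z + α k z * dd v F z) := by
  have h1 : ∀ k, DifferentiableAt ℝ (fun w => α k w * F w) z := fun k => (hα k).mul hF
  have h2 : ∀ k, DifferentiableAt ℝ (fun w => f k w + α k w * F w) z := fun k => (hf k).add (h1 k)
  rw [dd_sum _ fun k _ => (h2 k).const_mul (c k)]
  refine Finset.sum_congr rfl fun k _ => ?_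
  rw [dd_mul (differentiableAt_const (c k)) (h2 k), dd_add (hf k) (h1 k), dd_mul (hα k) hF]
  simp [dd, add_assoc]

variable {T : Set ℝ} {M : Set (Coord N)} {h : Matrix (Fin N) (Fin N) ℝ}
  {A : ℝ → Coord N → Coord N} {U : ℝ → Coord N → ℝ} {ρ : ℝ × Coord N → ℝ}
  {p : Fin N → ℝ × Coord N → ℝ} {σ : ℝ}

/-- Testing the Lie-Poisson equation with functions gives the continuity equation. -/
lemma mass_balance_of_isLiePoisson (hT : IsOpen T) (hM : IsOpen M) (hh : h.IsSymm) (hσ : σ ≠ 0)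
    (hA : ∀ k, ContDiffOn ℝ ∞ (fun z : ℝ × Coord N => A z.1 z.2 k) (T ×ˢ M))
    (hρ : ContDiffOn ℝ ∞ ρ (T ×ˢ M)) (hp : ∀ k, ContDiffOn ℝ ∞ (p k) (T ×ˢ M))
    (hLP : IsLiePoisson M (fun _ => σ) T
      (fun t => emergenceMomentum (fun x => ρ (t, x)) (fun x j => p j (t, x)))
      (fun t => hamOperator (canonicalHam h (A t) (U t)) (fun x j => p j (t, x))))
    {z : ℝ × Coord N} (hz : z ∈ T ×ˢ M) :
    dd dirT ρ z + ∑ j, ∑ k, h j k * (dd (dirX j) (fun w => ρ w * p k w) z +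
      dd (dirX j) (fun w => A w.1 w.2 k) z * ρ z + A z.1 z.2 k * dd (dirX j) ρ z) = 0 := by
  obtain ⟨t, x⟩ := z
  have ht : t ∈ T := hz.1
  have hTM := hT.prod hM
  set X : Fin N → ℝ × Coord N → ℝ :=
    fun j w => ∑ k, h j k * (ρ w * p k w + A w.1 w.2 k * ρ w) with hX
  have hXs : ∀ j, ContDiffOn ℝ ∞ (X j) (T ×ˢ M) := fun j =>
    ContDiffOn.sum fun k _ => contDiffOn_const.mul ((hρ.mul (hp k)).add ((hA k).mul hρ))
  have hslice : ContDiff ℝ ∞ (fun y : Coord N => (t, y)) := contDiff_const.prodMk contDiff_id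
  have hbal := balance_of_weak hT hM hρ ht (X := fun j y => X j (t, y)) (Q := fun _ => 0)
    (fun j => (hXs j).comp hslice.contDiffOn fun y hy => ⟨ht, hy⟩) continuousOn_const
    (fun φ hφ hc hs => by
      have hW : SAlg.IsTest M (⟨fun _ => 0, φ⟩ : SAlg N) :=
        ⟨contDiff_const, hφ, HasCompactSupport.zero, hc, by simp [tsupport], hs⟩
      have hd := hLP _ hW t ht
      have e1 : ∀ r, pairing M (fun _ => σ)
          (emergenceMomentum (fun x => ρ (r, x)) (fun x j => p j (r, x)))
          (⟨fun _ => 0, φ⟩ : SAlg N) = (∫ x in M, ρ (r, x) * φ x) * σ := fun r => by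
        simp [pairing, emergenceMomentum, integral_mul_const]
      have e2 : pairing M (fun _ => σ)
          (emergenceMomentum (fun x => ρ (t, x)) (fun x j => p j (t, x)))
          ((hamOperator (canonicalHam h (A t) (U t)) (fun x j => p j (t, x))).bracket
            (⟨fun _ => 0, φ⟩ : SAlg N)) =
          (∫ x in M, ((∑ j, X j (t, x) * pd φ j x) - 0 * φ x)) * σ := by
        rw [← integral_mul_const, pairing]
        refine integral_congr_ae (Eventually.of_forall fun y => ?_)
        simp only [emergenceMomentum, SAlg.bracket, VectorField.lieBracket, hamOperator, map_zero,
          fderiv_fun_const, sub_zero, Pi.zero_apply, _root_.zero_apply, mul_zero,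
          Finset.sum_const_zero, zero_add, zero_mul]
        rw [fderiv_apply_eq_sum_pd, Finset.mul_sum]
        congr 1
        refine Finset.sum_congr rfl fun j _ => ?_
        rw [velocity_canonicalHam hh, ← mul_assoc, Finset.mul_sum]
        congr 1
        exact Finset.sum_congr rfl fun k _ => by ring
      simp only [e1] at hd
      rw [e2] at hd
      simpa [hσ] using hd.div_const σ) hz.2
  rw [add_zero] at hbal
  have hd := fun {f : ℝ × Coord N → ℝ} (hf : ContDiffOn ℝ ∞ f (T ×ˢ M)) =>
    differentiableAt_of_contDiffOn hTM hf hz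
  simp only [pd_slice (hd (hXs _))] at hbal
  simp only [hX, dd_flux (fun k => hd (hρ.mul (hp k))) (fun k => hd (hA k)) (hd hρ)] at hbal
  exact hbal

/-- In the gradient of `-p · v + H(x, p(x))`, with `v = ∂H/∂p`, the derivatives of `p` cancel: it is
`-p_j ∂_i v^j + ∂_i H`, with `∂_i H` taken at fixed `p`. -/
lemma pd_hamOperator_fn (hM : IsOpen M) (hh : h.IsSymm) {B : Coord N → Coord N} {V : Coord N → ℝ}
    {q : Fin N → Coord N → ℝ} (hB : ∀ k, ContDiffOn ℝ ∞ (fun x => B x k) M)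
    (hV : ContDiffOn ℝ ∞ V M) (hq : ∀ k, ContDiffOn ℝ ∞ (q k) M) (i : Fin N) {x : Coord N}
    (hx : x ∈ M) :
    pd (hamOperator (canonicalHam h B V) (fun x j => q j x)).fn i x =
      -(∑ j, q j x * pd (fun y => velocity (canonicalHam h B V) y (fun j => q j y) j) i x) +
      (∑ j, ∑ k, h j k * (q j x + B x j) * pd (fun y => B y k) i x) + pd V i x := by
  set v : Fin N → Coord N → ℝ := fun j y => ∑ k, h j k * (q k y + B y k) with hv
  have hvel : ∀ y j, velocity (canonicalHam h B V) y (fun j => q j y) j = v j y := fun y j =>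
    velocity_canonicalHam hh B V y _ j
  have hfn : (hamOperator (canonicalHam h B V) (fun x j => q j x)).fn = fun y =>
      -(∑ j, q j y * v j y) + ((1 / 2) * (∑ j, (q j y + B y j) * v j y) + V y) := by
    funext y
    simp only [hamOperator, hvel, canonicalHam, hv, Finset.mul_sum]
    congr 3
    funext j
    exact Finset.sum_congr rfl fun k _ => by ring
  have hd := fun {f : Coord N → ℝ} (hf : ContDiffOn ℝ ∞ f M) =>
    differentiableAt_of_contDiffOn hM hf hx
  have hvs : ∀ j, ContDiffOn ℝ ∞ (v j) M := fun j =>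
    ContDiffOn.sum fun k _ => contDiffOn_const.mul ((hq k).add (hB k))
  have hqB : ∀ j, DifferentiableAt ℝ (fun y => q j y + B y j) x := fun j => hd ((hq j).add (hB j))
  have hqv : ∀ j, DifferentiableAt ℝ (fun y => q j y * v j y) x := fun j =>
    (hd (hq j)).mul (hd (hvs j))
  have hqBv : ∀ j, DifferentiableAt ℝ (fun y => (q j y + B y j) * v j y) x := fun j =>
    (hqB j).mul (hd (hvs j))
  have s1 : DifferentiableAt ℝ (fun y => ∑ j, q j y * v j y) x :=
    DifferentiableAt.fun_sum fun j _ => hqv j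
  have s2 : DifferentiableAt ℝ (fun y => ∑ j, (q j y + B y j) * v j y) x :=
    DifferentiableAt.fun_sum fun j _ => hqBv j
  have pdv : ∀ j, dd (Pi.single i 1) (v j) x = ∑ k, h j k *
      (dd (Pi.single i 1) (q k) x + dd (Pi.single i 1) (fun y => B y k) x) := fun j => by
    simp only [hv]
    rw [dd_sum _ fun k _ => (hqB k).const_mul (h j k)]
    refine Finset.sum_congr rfl fun k _ => ?_
    rw [dd_mul (differentiableAt_const (h j k)) (hqB k), dd_add (hd (hq k)) (hd (hB k))]
    simp [dd]
  -- by the symmetry of `h`, both factors of the kinetic energy contribute equally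
  have hsymm : ∑ j, (q j x + B x j) * dd (Pi.single i 1) (v j) x =
      ∑ j, (dd (Pi.single i 1) (q j) x + dd (Pi.single i 1) (fun y => B y j) x) * v j x := by
    simp only [pdv]
    simp only [hv, Finset.mul_sum]
    rw [Finset.sum_comm]
    exact Finset.sum_congr rfl fun j _ => Finset.sum_congr rfl fun k _ => by
      rw [hh.apply]; ring
  have hlast : ∑ j, ∑ k, h j k * (q j x + B x j) * dd (Pi.single i 1) (fun y => B y k) x =
      ∑ j, dd (Pi.single i 1) (fun y => B y j) x * v j x := by
    rw [Finset.sum_comm]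
    refine Finset.sum_congr rfl fun j _ => ?_
    simp only [hv, Finset.mul_sum]
    exact Finset.sum_congr rfl fun k _ => by rw [hh.apply]; ring
  have hsplit : ∑ j, (dd (Pi.single i 1) (q j) x + dd (Pi.single i 1) (fun y => B y j) x) *
      v j x = ∑ j, dd (Pi.single i 1) (q j) x * v j x +
        ∑ j, dd (Pi.single i 1) (fun y => B y j) x * v j x := by
    simp only [add_mul, Finset.sum_add_distrib]
  change dd (Pi.single i 1) _ x = -(∑ j, q j x * dd (Pi.single i 1) _ x) +
    (∑ j, ∑ k, h j k * (q j x + B x j) * dd (Pi.single i 1) (fun y => B y k) x) +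
    dd (Pi.single i 1) V x
  simp only [hvel]
  rw [hfn, hlast, dd_add s1.fun_neg ((s2.const_mul (1 / 2)).fun_add (hd hV)),
    dd_add (s2.const_mul (1 / 2)) (hd hV), dd_mul (differentiableAt_const (1 / 2 : ℝ)) s2,
    dd_sum _ fun j _ => hqBv j]
  have hneg : dd (Pi.single i 1) (fun y => -(∑ j, q j y * v j y)) x =
      -∑ j, (dd (Pi.single i 1) (q j) x * v j x + q j x * dd (Pi.single i 1) (v j) x) := by
    have : dd (Pi.single i 1) (fun y => -(∑ j, q j y * v j y)) x =
        -dd (Pi.single i 1) (fun y => ∑ j, q j y * v j y) x := by simp [dd, fderiv_fun_neg]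
    rw [this, dd_sum _ fun j _ => hqv j]
    simp only [dd_mul (hd (hq _)) (hd (hvs _))]
  have hconst : dd (Pi.single i 1) (fun _ : Coord N => (1 / 2 : ℝ)) x = 0 := by simp [dd]
  rw [hneg, hconst]
  simp only [dd_mul (hqB _) (hd (hvs _)), dd_add (hd (hq _)) (hd (hB _)), Finset.sum_add_distrib,
    hsymm, hsplit]
  ring

/-- Testing the Lie-Poisson equation with vector fields in the direction of the `i`-th coordinate
gives the balance of the `i`-th component of the momentum. -/
lemma momentum_balance_of_isLiePoisson (hT : IsOpen T) (hM : IsOpen M) (hh : h.IsSymm)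
    (hσ : σ ≠ 0) (hA : ∀ k, ContDiffOn ℝ ∞ (fun z : ℝ × Coord N => A z.1 z.2 k) (T ×ˢ M))
    (hU : ContDiffOn ℝ ∞ (fun z : ℝ × Coord N => U z.1 z.2) (T ×ˢ M))
    (hρ : ContDiffOn ℝ ∞ ρ (T ×ˢ M)) (hp : ∀ k, ContDiffOn ℝ ∞ (p k) (T ×ˢ M))
    (hLP : IsLiePoisson M (fun _ => σ) T
      (fun t => emergenceMomentum (fun x => ρ (t, x)) (fun x j => p j (t, x)))
      (fun t => hamOperator (canonicalHam h (A t) (U t)) (fun x j => p j (t, x))))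
    (i : Fin N) {z : ℝ × Coord N} (hz : z ∈ T ×ˢ M) :
    dd dirT (fun w => ρ w * p i w) z +
      (∑ j, ∑ k, h j k * (dd (dirX j) (fun w => ρ w * p k w * p i w) z +
        dd (dirX j) (fun w => A w.1 w.2 k) z * (ρ z * p i z) +
        A z.1 z.2 k * dd (dirX j) (fun w => ρ w * p i w) z +
        dd (dirX i) (fun w => A w.1 w.2 k) z * (ρ z * p j z) +
        A z.1 z.2 j * dd (dirX i) (fun w => A w.1 w.2 k) z * ρ z)) +
      dd (dirX i) (fun w => U w.1 w.2) z * ρ z = 0 := by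
  obtain ⟨t, x⟩ := z
  have ht : t ∈ T := hz.1
  have hTM := hT.prod hM
  have hF : ContDiffOn ℝ ∞ (fun w => ρ w * p i w) (T ×ˢ M) := hρ.mul (hp i)
  set X : Fin N → ℝ × Coord N → ℝ :=
    fun j w => ∑ k, h j k * (ρ w * p k w * p i w + A w.1 w.2 k * (ρ w * p i w)) with hX
  set Q : ℝ × Coord N → ℝ := fun w => ρ w * ((∑ j, ∑ k, h j k * (p j w + A w.1 w.2 j) *
    dd (dirX i) (fun w => A w.1 w.2 k) w) + dd (dirX i) (fun w => U w.1 w.2) w) with hQ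
  have hXs : ∀ j, ContDiffOn ℝ ∞ (X j) (T ×ˢ M) := fun j =>
    ContDiffOn.sum fun k _ =>
      contDiffOn_const.mul (((hρ.mul (hp k)).mul (hp i)).add ((hA k).mul hF))
  have hQs : ContDiffOn ℝ ∞ Q (T ×ˢ M) :=
    hρ.mul ((ContDiffOn.sum fun j _ => ContDiffOn.sum fun k _ =>
      (contDiffOn_const.mul ((hp j).add (hA j))).mul (contDiffOn_dd hTM (hA k) _)).add
      (contDiffOn_dd hTM hU _))
  have hslice : ContDiff ℝ ∞ (fun y : Coord N => (t, y)) := contDiff_const.prodMk contDiff_id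
  have hsl : ∀ {f : ℝ × Coord N → ℝ}, ContDiffOn ℝ ∞ f (T ×ˢ M) →
      ContDiffOn ℝ ∞ (fun y => f (t, y)) M := fun hf =>
    hf.comp hslice.contDiffOn fun y hy => ⟨ht, hy⟩
  have hbal := balance_of_weak hT hM hF ht (X := fun j y => X j (t, y)) (Q := fun y => Q (t, y))
    (fun j => hsl (hXs j)) (hsl hQs).continuousOn
    (fun φ hφ hc hs => by
      set W : SAlg N := ⟨fun y => φ y • Pi.single i 1, fun _ => 0⟩ with hWdef
      have hW : SAlg.IsTest M W :=
        ⟨hφ.smul contDiff_const, contDiff_const, hc.smul_right, HasCompactSupport.zero,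
          (tsupport_smul_subset_left _ _).trans hs, by simp [hWdef, tsupport]⟩
      have hd := hLP _ hW t ht
      have e1 : ∀ r, pairing M (fun _ => σ)
          (emergenceMomentum (fun x => ρ (r, x)) (fun x j => p j (r, x))) W =
          (∫ x in M, (ρ (r, x) * p i (r, x)) * φ x) * σ := fun r => by
        simp [pairing, emergenceMomentum, integral_mul_const, hWdef, Pi.single_apply]
      have e2 : pairing M (fun _ => σ)
          (emergenceMomentum (fun x => ρ (t, x)) (fun x j => p j (t, x)))
          ((hamOperator (canonicalHam h (A t) (U t)) (fun x j => p j (t, x))).bracket W) =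
          (∫ x in M, ((∑ j, X j (t, x) * pd φ j x) - Q (t, x) * φ x)) * σ := by
        rw [← integral_mul_const, pairing]
        refine setIntegral_congr_fun hM.measurableSet fun y hy => ?_
        have hfn := pd_hamOperator_fn hM hh (B := A t) (V := U t) (q := fun j y => p j (t, y))
          (fun k => hsl (hA k)) (hsl hU) (fun k => hsl (hp k)) i hy
        set V := hamOperator (canonicalHam h (A t) (U t)) (fun x j => p j (t, x)) with hV
        have hvel : ∀ y j, V.vec y j = ∑ k, h j k * (p k (t, y) + A t y k) := fun y j =>
          velocity_canonicalHam hh _ _ _ _ j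
        have hvd : ∀ j, DifferentiableAt ℝ (fun y => V.vec y j) y := fun j => by
          simp only [hvel]
          exact differentiableAt_of_contDiffOn hM (ContDiffOn.sum fun k _ =>
            contDiffOn_const.mul ((hsl (hp k)).add (hsl (hA k)))) hy
        have hb1 : ∀ j, (V.bracket W).vec y j =
            fderiv ℝ φ y (V.vec y) * (Pi.single i (1 : ℝ) : Coord N) j -
            φ y * pd (fun y => V.vec y j) i y := fun j => by
          have hφd : DifferentiableAt ℝ φ y := hφ.differentiable (by simp) y
          have hWf : fderiv ℝ W.vec y = (fderiv ℝ φ y).smulRight (Pi.single i 1) :=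
            (hφd.hasFDerivAt.smul_const (Pi.single i (1 : ℝ) : Coord N)).fderiv
          have hcomp : fderiv ℝ V.vec y (Pi.single i 1) j = pd (fun y => V.vec y j) i y := by
            rw [pd, fderiv_pi hvd]; rfl
          change fderiv ℝ W.vec y (V.vec y) j - fderiv ℝ V.vec y (W.vec y) j = _
          rw [hWf, show W.vec y = φ y • Pi.single i 1 from rfl, map_smul]
          simp [hcomp]
        have hb2 : (V.bracket W).fn y = -(φ y * pd V.fn i y) := by
          simp [SAlg.bracket, hWdef, pd]
        simp only [emergenceMomentum, hb1, hb2, fderiv_apply_eq_sum_pd]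
        rw [hfn]
        have h1 : ∀ j, pd (fun y => velocity (canonicalHam h (A t) (U t)) y
          (fun j => p j (t, y)) j) i y = pd (fun y => V.vec y j) i y := fun _ => rfl
        have h2 : ∀ k, pd (fun y => A t y k) i y = dd (dirX i) (fun w => A w.1 w.2 k) (t, y) :=
          fun k => pd_slice (f := fun w : ℝ × Coord N => A w.1 w.2 k)
            (differentiableAt_of_contDiffOn hTM (hA k) ⟨ht, hy⟩) i
        have h3 : pd (U t) i y = dd (dirX i) (fun w => U w.1 w.2) (t, y) :=
          pd_slice (f := fun w : ℝ × Coord N => U w.1 w.2)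
            (differentiableAt_of_contDiffOn hTM hU ⟨ht, hy⟩) i
        simp only [h1, h2, h3]
        have s1 : ∑ j, ρ (t, y) * p j (t, y) * ((∑ l, V.vec y l * pd φ l y) *
            (Pi.single i (1 : ℝ) : Coord N) j - φ y * pd (fun y => V.vec y j) i y) =
            ρ (t, y) * p i (t, y) * (∑ l, V.vec y l * pd φ l y) -
            ρ (t, y) * φ y * ∑ j, p j (t, y) * pd (fun y => V.vec y j) i y := by
          simp only [mul_sub, Finset.sum_sub_distrib, Pi.single_apply, mul_ite, mul_one, mul_zero,
            Finset.sum_ite_eq', Finset.mem_univ, if_true]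
          congr 1
          rw [Finset.mul_sum]
          exact Finset.sum_congr rfl fun j _ => by ring
        have s2 : ∑ j, X j (t, y) * pd φ j y =
            ρ (t, y) * p i (t, y) * (∑ l, V.vec y l * pd φ l y) := by
          rw [Finset.mul_sum]
          refine Finset.sum_congr rfl fun j _ => ?_
          rw [hvel, ← mul_assoc, Finset.mul_sum]
          congr 1
          exact Finset.sum_congr rfl fun k _ => by ring
        rw [s1, s2, hQ]
        ring
      simp only [e1] at hd
      rw [e2] at hd
      simpa [hσ] using hd.div_const σ) hz.2
  have hd := fun {f : ℝ × Coord N → ℝ} (hf : ContDiffOn ℝ ∞ f (T ×ˢ M)) =>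
    differentiableAt_of_contDiffOn hTM hf hz
  simp only [pd_slice (hd (hXs _))] at hbal
  simp only [hX, hQ, dd_flux (fun k => hd ((hρ.mul (hp k)).mul (hp i))) (fun k => hd (hA k))
    (hd hF)] at hbal
  have key : ∑ j, ∑ k, h j k * (dd (dirX j) (fun w => ρ w * p k w * p i w) (t, x) +
        dd (dirX j) (fun w => A w.1 w.2 k) (t, x) * (ρ (t, x) * p i (t, x)) +
        A t x k * dd (dirX j) (fun w => ρ w * p i w) (t, x) +
        dd (dirX i) (fun w => A w.1 w.2 k) (t, x) * (ρ (t, x) * p j (t, x)) +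
        A t x j * dd (dirX i) (fun w => A w.1 w.2 k) (t, x) * ρ (t, x)) =
      (∑ j, ∑ k, h j k * (dd (dirX j) (fun w => ρ w * p k w * p i w) (t, x) +
        dd (dirX j) (fun w => A w.1 w.2 k) (t, x) * (ρ (t, x) * p i (t, x)) +
        A t x k * dd (dirX j) (fun w => ρ w * p i w) (t, x))) +
      ρ (t, x) * ∑ j, ∑ k, h j k * (p j (t, x) + A t x j) *
        dd (dirX i) (fun w => A w.1 w.2 k) (t, x) := by
    simp only [Finset.mul_sum, ← Finset.sum_add_distrib]
    exact Finset.sum_congr rfl fun j _ => Finset.sum_congr rfl fun k _ => by ring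
  change dd dirT (fun w => ρ w * p i w) (t, x) + _ + _ = 0 at hbal
  rw [key]
  linear_combination hbal

end LiePoisson

/-! ### Averaging the balance laws over the labels -/

section Average

variable {Ω Z : Type*} [MeasurableSpace Ω] [NormedAddCommGroup Z] [NormedSpace ℝ Z]

/-- The function `f` is integrable with integral `c`. -/
def HasIntegral (P : Measure Ω) (f : Ω → ℂ) (c : ℂ) : Prop :=
  Integrable f P ∧ ∫ q, f q ∂P = c

variable {P : Measure Ω} {f f' : Ω → ℂ} {c c' : ℂ}

lemma HasIntegral.add (h : HasIntegral P f c) (h' : HasIntegral P f' c') :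
    HasIntegral P (fun q => f q + f' q) (c + c') :=
  ⟨h.1.add h'.1, by rw [integral_add h.1 h'.1, h.2, h'.2]⟩

lemma HasIntegral.const_mul (h : HasIntegral P f c) (k : ℂ) :
    HasIntegral P (fun q => k * f q) (k * c) :=
  ⟨h.1.const_mul k, by rw [integral_const_mul, h.2]⟩

lemma HasIntegral.sum {ι : Type*} (s : Finset ι) {f : ι → Ω → ℂ} {c : ι → ℂ}
    (h : ∀ i ∈ s, HasIntegral P (f i) (c i)) :
    HasIntegral P (fun q => ∑ i ∈ s, f i q) (∑ i ∈ s, c i) :=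
  ⟨integrable_finsetSum _ fun i hi => (h i hi).1, by
    rw [integral_finsetSum _ fun i hi => (h i hi).1]
    exact Finset.sum_congr rfl fun i hi => (h i hi).2⟩

lemma HasIntegral.eq_zero (h : HasIntegral P f c) (h0 : ∀ᵐ q ∂P, f q = 0) : c = 0 := by
  rw [← h.2, integral_eq_zero_of_ae h0]

/-- The smooth function `b` is the average of the functions `a q`, which may be differentiated
under the integral sign. -/
structure IsAverage (P : Measure Ω) (D : Set Z) (a : Ω → Z → ℂ) (b : Z → ℂ) : Prop where
  regular : SmoothUnderIntegral P D a
  smooth : ContDiffOn ℝ ∞ b D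
  integral_eq : ∀ z ∈ D, ∫ q, a q z ∂P = b z

variable {D : Set Z} {a : Ω → Z → ℂ} {b : Z → ℂ}

lemma IsAverage.hasIntegral (h : IsAverage P D a b) {z : Z} (hz : z ∈ D) :
    HasIntegral P (fun q => a q z) (b z) :=
  ⟨h.regular.integrable hz, h.integral_eq z hz⟩

lemma IsAverage.dd (h : IsAverage P D a b) (hD : IsOpen D) (v : Z) :
    IsAverage P D (fun q => dd v (a q)) (dd v b) where
  regular := h.regular.fderiv_apply hD v
  smooth := contDiffOn_dd hD h.smooth v
  integral_eq _ hz := h.regular.integral_fderiv_apply hD (h.smooth.differentiableOn (by simp))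
    h.integral_eq hz v

variable {T : Set ℝ} {M : Set (Coord N)} {a : Ω → ℝ × Coord N × Coord N → ℂ}
  {b : ℝ × Coord N × Coord N → ℂ} {hbar : ℝ} {h : Matrix (Fin N) (Fin N) ℝ}
  {α : Fin N → ℝ × Coord N → ℝ} {υ : ℝ × Coord N → ℝ}

lemma IsAverage.massBalance_eq_zero (H : IsAverage P (T ×ˢ M ×ˢ M) a b)
    (hTMM : IsOpen (T ×ˢ M ×ˢ M))
    (h0 : ∀ᵐ q ∂P, ∀ z ∈ T ×ˢ M, massBalance hbar h α (a q) z = 0) :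
    ∀ z ∈ T ×ˢ M, massBalance hbar h α b z = 0 := fun z hz => by
  have hdz : diagCLM z ∈ T ×ˢ M ×ˢ M := ⟨hz.1, hz.2, hz.2⟩
  have key : HasIntegral P (fun q => massBalance hbar h α (a q) z) (massBalance hbar h α b z) :=
    ((H.dd hTMM _).hasIntegral hdz).add (HasIntegral.sum _ fun j _ => HasIntegral.sum _ fun k _ =>
      (((((((H.dd hTMM _).dd hTMM _).hasIntegral hdz).const_mul _).add
        ((H.hasIntegral hdz).const_mul _)).add
        (((H.dd hTMM _).hasIntegral hdz).const_mul _)).const_mul _))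
  exact key.eq_zero (h0.mono fun q hq => hq z hz)

lemma IsAverage.momentumBalance_eq_zero (H : IsAverage P (T ×ˢ M ×ˢ M) a b)
    (hTMM : IsOpen (T ×ˢ M ×ˢ M)) (i : Fin N)
    (h0 : ∀ᵐ q ∂P, ∀ z ∈ T ×ˢ M, momentumBalance hbar h α υ i (a q) z = 0) :
    ∀ z ∈ T ×ˢ M, momentumBalance hbar h α υ i b z = 0 := fun z hz => by
  have hdz : diagCLM z ∈ T ×ˢ M ×ˢ M := ⟨hz.1, hz.2, hz.2⟩
  have d0 := H.hasIntegral hdz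
  have d1 := fun v => (H.dd hTMM v).hasIntegral hdz
  have d2 := fun v w => ((H.dd hTMM v).dd hTMM w).hasIntegral hdz
  have d3 := fun v w r => (((H.dd hTMM v).dd hTMM w).dd hTMM r).hasIntegral hdz
  have key : HasIntegral P (fun q => momentumBalance hbar h α υ i (a q) z)
      (momentumBalance hbar h α υ i b z) :=
    (((d2 _ _).const_mul _).add (HasIntegral.sum _ fun j _ => HasIntegral.sum _ fun k _ =>
      ((((((d3 _ _ _).const_mul _).add (((d1 _).const_mul _).const_mul _)).add
        (((d2 _ _).const_mul _).const_mul _)).add (((d1 _).const_mul _).const_mul _)).add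
        (d0.const_mul _)).const_mul _)).add (d0.const_mul _)
  exact key.eq_zero (h0.mono fun q hq => hq z hz)

end Average

/-! ### The Schrödinger operator and its defect -/

section Schrodinger

variable {T : Set ℝ} {M : Set (Coord N)} {hbar m : ℝ} {g : Matrix (Fin N) (Fin N) ℝ}
  {A : ℝ → Coord N → Coord N} {U : ℝ → Coord N → ℝ} {ψ : ℝ → Coord N → ℂ}

/-- The volume density is constant, so it cancels in `𝓗`. -/
lemma schrodingerDefect_eq (hT : IsOpen T) (hM : IsOpen M) (hg : g.IsSymm) (hgdet : IsUnit g.det)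
    (hA : ∀ k, ContDiffOn ℝ ∞ (fun z : ℝ × Coord N => A z.1 z.2 k) (T ×ˢ M))
    (hψ : ContDiffOn ℝ ∞ (fun z : ℝ × Coord N => ψ z.1 z.2) (T ×ˢ M)) {t : ℝ} {x : Coord N}
    (ht : t ∈ T) (hx : x ∈ M) :
    schrodingerDefect hbar (m⁻¹ • g) (fun k z => A z.1 z.2 k) (fun z => U z.1 z.2)
      (fun z => ψ z.1 z.2) (t, x) =
    Complex.I * hbar * dd dirT (fun z : ℝ × Coord N => ψ z.1 z.2) (t, x) -
      schrodingerOp hbar m (fun _ => g) (A t) (U t) (ψ t) x := by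
  have hTM := hT.prod hM
  set Ψ : ℝ × Coord N → ℂ := fun z => ψ z.1 z.2 with hΨ
  have hσ : ((volDensity (fun _ => g) x : ℝ) : ℂ) ≠ 0 := by
    have h1 : (g⁻¹).det ≠ 0 := ((Matrix.isUnit_nonsing_inv_det_iff).2 hgdet).ne_zero
    have h2 : volDensity (fun _ => g) x ≠ 0 := (Real.sqrt_pos.2 (abs_pos.2 h1)).ne'
    exact_mod_cast h2
  have hd := fun {f : ℝ × Coord N → ℂ} (hf : ContDiffOn ℝ ∞ f (T ×ˢ M)) =>
    differentiableAt_of_contDiffOn hTM hf (z := (t, x)) ⟨ht, hx⟩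
  have hAc : ∀ k, ContDiffOn ℝ ∞ (fun z : ℝ × Coord N => (A z.1 z.2 k : ℂ)) (T ×ˢ M) := fun k =>
    Complex.ofRealCLM.contDiff.comp_contDiffOn (hA k)
  have hcov : ∀ j, ∀ y ∈ M, covMomentum hbar (A t) j (ψ t) y =
      (fun z : ℝ × Coord N => -Complex.I * hbar * dd (dirX j) Ψ z + A z.1 z.2 j * Ψ z) (t, y) :=
    fun j y hy => by
      have := pd_slice (f := Ψ)
        (differentiableAt_of_contDiffOn hTM hψ (z := (t, y)) ⟨ht, hy⟩) j
      simp only [covMomentum, ← this]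
      rfl
  have hcov2 : ∀ i j, covMomentum hbar (A t) i (covMomentum hbar (A t) j (ψ t)) x =
      -Complex.I * hbar * (-Complex.I * hbar * dd (dirX i) (dd (dirX j) Ψ) (t, x) +
        ((dd (dirX i) (fun z => A z.1 z.2 j) (t, x) : ℝ) * Ψ (t, x) +
          A t x j * dd (dirX i) Ψ (t, x))) +
      A t x i * (-Complex.I * hbar * dd (dirX j) Ψ (t, x) + A t x j * Ψ (t, x)) := fun i j => by
    have e1 : pd (covMomentum hbar (A t) j (ψ t)) i x = pd (fun y =>
        (fun z : ℝ × Coord N => -Complex.I * hbar * dd (dirX j) Ψ z + A z.1 z.2 j * Ψ z) (t, y))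
        i x := dd_congr hM (hcov j) _ x hx
    have d1 := hd (contDiffOn_dd hTM hψ (dirX j))
    have d2 : DifferentiableAt ℝ (fun z : ℝ × Coord N => -Complex.I * hbar * dd (dirX j) Ψ z)
      (t, x) := d1.const_mul _
    have d3 : DifferentiableAt ℝ (fun z : ℝ × Coord N => (A z.1 z.2 j : ℂ) * Ψ z) (t, x) :=
      (hd (hAc j)).mul (hd hψ)
    rw [covMomentum, e1, pd_slice (d2.fun_add d3), dd_add d2 d3, dd_const_mul,
      dd_mul (hd (hAc j)) (hd hψ), dd_ofReal
        (differentiableAt_of_contDiffOn hTM (hA j) ⟨ht, hx⟩), hcov j x hx]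
  have hconst : ∀ i j, covMomentum hbar (A t) i (fun y =>
      ((g i j * volDensity (fun _ => g) y : ℝ) : ℂ) * covMomentum hbar (A t) j (ψ t) y) x =
      ((g i j * volDensity (fun _ => g) x : ℝ) : ℂ) *
        covMomentum hbar (A t) i (covMomentum hbar (A t) j (ψ t)) x := fun i j =>
    covMomentum_const_mul hbar (A t) i ((g i j * volDensity (fun _ => g) x : ℝ) : ℂ) _ x
  have hsym := sum_symm_congr hg (X := fun i j =>
      kineticTerm hbar (fun k z => A z.1 z.2 k) Ψ i j (t, x))
    (Y := fun i j => covMomentum hbar (A t) i (covMomentum hbar (A t) j (ψ t)) x) fun i j => by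
      simp only [hcov2, kineticTerm]
      linear_combination (-(hbar : ℂ) ^ 2 * (dd (dirX i) (dd (dirX j) Ψ) (t, x) +
        dd (dirX j) (dd (dirX i) Ψ) (t, x))) * Complex.I_sq
  have hs1 : ∑ i, ∑ j, (((m⁻¹ • g) i j : ℝ) : ℂ) *
      kineticTerm hbar (fun k z => A z.1 z.2 k) Ψ i j (t, x) = (m : ℂ)⁻¹ * ∑ i, ∑ j, (g i j : ℂ) *
        covMomentum hbar (A t) i (covMomentum hbar (A t) j (ψ t)) x := by
    rw [← hsym]
    simp only [Finset.mul_sum]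
    exact Finset.sum_congr rfl fun i _ => Finset.sum_congr rfl fun j _ => by
      simp [Matrix.smul_apply, mul_assoc]
  have hs2 : ∑ i, ∑ j, ((g i j * volDensity (fun _ => g) x : ℝ) : ℂ) *
        covMomentum hbar (A t) i (covMomentum hbar (A t) j (ψ t)) x =
      ((volDensity (fun _ => g) x : ℝ) : ℂ) * ∑ i, ∑ j, (g i j : ℂ) *
        covMomentum hbar (A t) i (covMomentum hbar (A t) j (ψ t)) x := by
    simp only [Finset.mul_sum]
    exact Finset.sum_congr rfl fun i _ => Finset.sum_congr rfl fun j _ => by push_cast; ring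
  rw [schrodingerDefect, schrodingerOp, hs1]
  simp only [hconst]
  rw [hs2]
  push_cast
  have : Ψ (t, x) = ψ t x := rfl
  rw [this]
  field_simp

/-- Near a point at which `ψ` does not vanish the ratio of the defect to `ψ` is a real function of
time. -/
lemma exists_defect_eq_mul {G Ψ : ℝ × Coord N → ℂ} (hTM : IsOpen (T ×ˢ M))
    (hG : ContDiffOn ℝ ∞ G (T ×ˢ M)) (hΨ : ContDiffOn ℝ ∞ Ψ (T ×ˢ M))
    (h : ∀ z ∈ T ×ˢ M, Ψ z ≠ 0 → (G z / Ψ z).im = 0 ∧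
      ∀ i, dd (dirX i) (fun w => G w / Ψ w) z = 0)
    {t₀ : ℝ} (ht₀ : t₀ ∈ T) {x₀ : Coord N} (hx₀ : x₀ ∈ M) (hne : Ψ (t₀, x₀) ≠ 0) :
    ∃ ε > 0, ∃ e : ℝ → ℝ, ContDiffOn ℝ ∞ e (Ioo (t₀ - ε) (t₀ + ε)) ∧
      ∀ t ∈ Ioo (t₀ - ε) (t₀ + ε), ∀ x ∈ Metric.ball x₀ ε,
        (t, x) ∈ T ×ˢ M ∧ Ψ (t, x) ≠ 0 ∧ G (t, x) = e t * Ψ (t, x) := by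
  have hmem : (t₀, x₀) ∈ T ×ˢ M := ⟨ht₀, hx₀⟩
  have hev : ∀ᶠ z in 𝓝 (t₀, x₀), z ∈ T ×ˢ M ∧ Ψ z ≠ 0 :=
    (hTM.eventually_mem hmem).and
      ((hΨ.continuousOn.continuousAt (hTM.mem_nhds hmem)).eventually_ne hne)
  obtain ⟨ε, hε, hball⟩ := Metric.mem_nhds_iff.1 hev
  have hbox : ∀ t ∈ Ioo (t₀ - ε) (t₀ + ε), ∀ x ∈ Metric.ball x₀ ε,
      (t, x) ∈ T ×ˢ M ∧ Ψ (t, x) ≠ 0 := fun t ht x hx => hball (by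
    rw [← ball_prod_same]
    exact ⟨by rwa [Real.ball_eq_Ioo], hx⟩)
  have hsm : ∀ z ∈ T ×ˢ M, Ψ z ≠ 0 → ContDiffAt ℝ ∞ (fun w => G w / Ψ w) z := fun z hz hne => by
    simp only [div_eq_mul_inv]
    exact (hG.contDiffAt (hTM.mem_nhds hz)).mul ((hΨ.contDiffAt (hTM.mem_nhds hz)).inv hne)
  have hx₀b := Metric.mem_ball_self (x := x₀) hε
  refine ⟨ε, hε, fun t => (G (t, x₀) / Ψ (t, x₀)).re, fun t ht => ?_, fun t ht x hx => ?_⟩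
  · obtain ⟨hz, hz'⟩ := hbox t ht x₀ hx₀b
    exact (Complex.reCLM.contDiff.contDiffAt.comp t ((hsm _ hz hz').comp t
      (contDiffAt_id.prodMk contDiffAt_const))).contDiffWithinAt
  · obtain ⟨hz, hz'⟩ := hbox t ht x hx
    refine ⟨hz, hz', ?_⟩
    have hdiff : ∀ y ∈ Metric.ball x₀ ε, DifferentiableAt ℝ (fun w => G w / Ψ w) (t, y) :=
      fun y hy => (hsm _ (hbox t ht y hy).1 (hbox t ht y hy).2).differentiableAt (by simp)
    have hconst : G (t, x) / Ψ (t, x) = G (t, x₀) / Ψ (t, x₀) := by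
      refine Metric.isOpen_ball.is_const_of_fderiv_eq_zero (𝕜 := ℝ)
        (f := fun y => G (t, y) / Ψ (t, y)) (convex_ball x₀ ε).isPreconnected
        (fun y hy => DifferentiableAt.differentiableWithinAt
          ((hdiff y hy).comp y (f := fun y : Coord N => (t, y)) (by fun_prop)))
        (fun y hy => ?_) hx hx₀b
      refine ContinuousLinearMap.coe_injective (LinearMap.pi_ext' fun j => ?_)
      refine LinearMap.ext_ring ?_
      have := (h _ (hbox t ht y hy).1 (hbox t ht y hy).2).2 j
      rw [← pd_slice (f := fun w => G w / Ψ w) (hdiff y hy) j] at this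
      exact this
    have him := (h _ (hbox t ht x₀ hx₀b).1 (hbox t ht x₀ hx₀b).2).1
    have hre : (((G (t, x₀) / Ψ (t, x₀)).re : ℝ) : ℂ) = G (t, x₀) / Ψ (t, x₀) :=
      Complex.ext rfl (by simpa using him.symm)
    rw [hre, ← hconst, div_mul_cancel₀ _ hz']

end Schrodinger

/-! ### The Schrödinger equation of a pure state -/

/-- For each label the two balance laws hold, so they hold for the average kernel `ψ ⊗ ψ̄`; hence
the ratio of `iħ ∂_t ψ - 𝓗 ψ` to `ψ` is real and has no spatial gradient. -/
lemma defect_div_of_pure {hbar m : ℝ} (hhbar : hbar ≠ 0) {M R : Set (Coord N)} {T : Set ℝ}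
    (hT : IsOpen T) (hM : IsOpen M) {g : Matrix (Fin N) (Fin N) ℝ} (hg : g.IsSymm)
    (hgdet : IsUnit g.det) {A : ℝ → Coord N → Coord N} {U : ℝ → Coord N → ℝ}
    (hA : ∀ k, ContDiffOn ℝ ∞ (fun z : ℝ × Coord N => A z.1 z.2 k) (T ×ˢ M))
    (hU : ContDiffOn ℝ ∞ (fun z : ℝ × Coord N => U z.1 z.2) (T ×ˢ M))
    [MeasurableSpace (Background hbar M R)]
    {P : Measure (Background hbar M R × Coord N)} {ζ₀ : Coord N → ℝ}
    {ζ : ℝ → Background hbar M R → Coord N → Coord N → ℝ}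
    (hζ : ∀ᵐ q ∂P, ContDiffOn ℝ ∞ (fun z : ℝ × Coord N => ζ z.1 q.1 q.2 z.2) (T ×ˢ M))
    {w : ℝ → Background hbar M R → Coord N → Coord N → ℂ}
    (hw : ∀ t ∈ T, ∀ ξ n n', (starRingEnd ℂ) (w t ξ n n') = w t ξ n' n)
    (hreg : SmoothUnderIntegral P (T ×ˢ M ×ˢ M) (fun q (z : ℝ × Coord N × Coord N) =>
      evolvedKernel (volDensity fun _ => g) ζ₀ (ζ z.1 q.1 q.2) (w z.1 q.1) q.1 q.2 z.2.1 z.2.2))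
    (hLP : ∀ᵐ q ∂P, IsLiePoisson M (volDensity fun _ => g) T
      (fun t => emergenceMomentum
        (emergenceDensity (volDensity fun _ => g) ζ₀ (w t q.1) q.1 q.2)
        (momentum hbar (sectionOf q.1 q.2 (ζ t q.1 q.2))))
      (fun t => hamOperator (canonicalHam (m⁻¹ • g) (A t) (U t))
        (momentum hbar (sectionOf q.1 q.2 (ζ t q.1 q.2)))))
    {Ψ : ℝ × Coord N → ℂ} (hΨ : ContDiffOn ℝ ∞ Ψ (T ×ˢ M))
    (hpure : ∀ z ∈ T ×ˢ M ×ˢ M, ∫ q, evolvedKernel (volDensity fun _ => g) ζ₀ (ζ z.1 q.1 q.2)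
      (w z.1 q.1) q.1 q.2 z.2.1 z.2.2 ∂P = tensorKernel Ψ Ψ z)
    {z : ℝ × Coord N} (hz : z ∈ T ×ˢ M) (hne : Ψ z ≠ 0) :
    (schrodingerDefect hbar (m⁻¹ • g) (fun k z => A z.1 z.2 k) (fun z => U z.1 z.2) Ψ z /
      Ψ z).im = 0 ∧
    ∀ i, dd (dirX i) (fun w => schrodingerDefect hbar (m⁻¹ • g) (fun k z => A z.1 z.2 k)
      (fun z => U z.1 z.2) Ψ w / Ψ w) z = 0 := by
  have hTM := hT.prod hM
  have hTMM := hT.prod (hM.prod hM)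
  have hh : (m⁻¹ • g).IsSymm := hg.smul _
  have hσ : Real.sqrt |(g⁻¹).det| ≠ 0 :=
    (Real.sqrt_pos.2 (abs_pos.2 ((Matrix.isUnit_nonsing_inv_det_iff).2 hgdet).ne_zero)).ne'
  have hav : IsAverage P (T ×ˢ M ×ˢ M) _ (tensorKernel Ψ Ψ) :=
    ⟨hreg, contDiffOn_tensorKernel hΨ hΨ, hpure⟩
  have hker : ∀ᵐ q ∂P, IsPhaseKernel hbar T M (fun z => evolvedKernel (volDensity fun _ => g) ζ₀
      (ζ z.1 q.1 q.2) (w z.1 q.1) q.1 q.2 z.2.1 z.2.2)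
      (fun z => emergenceDensity (volDensity fun _ => g) ζ₀ (w z.1 q.1) q.1 q.2 z.2)
      (phaseFactor q.1 q.2 fun t => ζ t q.1 q.2)
      (fun j z => momentum hbar (sectionOf q.1 q.2 (ζ z.1 q.1 q.2)) z.2 j) := by
    filter_upwards [hζ, hreg.smooth] with q hq hs
    exact isPhaseKernel_evolvedKernel hTM hhbar g ζ₀ q.1 q.2 (ζ := fun t => ζ t q.1 q.2) hq
      (w := fun t => w t q.1) (fun t ht => hw t ht q.1) hs
  refine defect_div_of_balance hTM hTMM hh hA hU hΨ
    (hav.massBalance_eq_zero hTMM ?_) (fun i => hav.momentumBalance_eq_zero hTMM i ?_) hz hne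
  · filter_upwards [hker, hLP] with q hq hl z hz
    rw [hq.massBalance_eq hTM hTMM hhbar hz]
    have := mass_balance_of_isLiePoisson hT hM hh hσ hA hq.smooth_density hq.smooth_momentum hl hz
    exact_mod_cast this
  · filter_upwards [hker, hLP] with q hq hl z hz
    rw [hq.momentumBalance_eq hTM hTMM hhbar i hz]
    have := momentum_balance_of_isLiePoisson hT hM hh hσ hA hU hq.smooth_density
      hq.smooth_momentum hl i hz
    exact_mod_cast this

end Proto

theorem mainTheorem2 {N : ℕ} (hbar m : ℝ) (hhbar : 0 < hbar) (hm : 0 < m)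
    -- the coordinate patch `M`, the reference set `R`, the constant metric `g^{ij}`
    (M R : Set (Coord N)) (hMo : IsOpen M) (hMc : IsConnected M) (hRM : R ⊆ M)
    (hR : volume R ≠ 0)
    (g : Matrix (Fin N) (Fin N) ℝ) (hg : g.IsSymm) (hgdet : IsUnit g.det)
    -- the labelling time `τ` and the time interval `τ < t < b`
    (τ b : ℝ) (hτ : τ < b)
    -- the potentials
    (A : ℝ → Coord N → Coord N) (U : ℝ → Coord N → ℝ)
    (hA : ContDiffOn ℝ ∞ (fun z : ℝ × Coord N => A z.1 z.2) (Ioo τ b ×ˢ M))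
    (hU : ContDiffOn ℝ ∞ (fun z : ℝ × Coord N => U z.1 z.2) (Ioo τ b ×ˢ M))
    -- the measure on the background, the phases `ζ_t^τ[k]` and the matrices `ρ̃_t^τ(ξ)(n, n')`
    [MeasurableSpace (Proto.Background hbar M R)]
    (𝒩 : Measure (Proto.Background hbar M R)) [SFinite 𝒩]
    (ζ₀ : Coord N → ℝ) (hζ₀ : ContDiffOn ℝ ∞ ζ₀ M)
    (ζ : ℝ → Proto.Background hbar M R → Coord N → Coord N → ℝ)
    (hζ : ∀ᵐ q ∂(𝒩.prod (volume : Measure (Coord N))),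
      ContDiffOn ℝ ∞ (fun z : ℝ × Coord N => ζ z.1 q.1 q.2 z.2) (Ioo τ b ×ˢ M) ∧
      ∀ x ∈ M, Tendsto (fun t => ζ t q.1 q.2 x) (𝓝[>] τ) (𝓝 (ζ₀ x)))
    (w : ℝ → Proto.Background hbar M R → Coord N → Coord N → ℂ)
    (hw : ∀ t ∈ Ioo τ b, ∀ ξ n n', (starRingEnd ℂ) (w t ξ n n') = w t ξ n' n)
    (hwint : ∀ᵐ q ∂(𝒩.prod (volume : Measure (Coord N))), ∀ t ∈ Ioo τ b, ∀ x ∈ M, ∀ y ∈ M,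
      Integrable (Proto.labelledIntegrand (Proto.volDensity fun _ => g) ζ₀ (w t q.1) q.1 q.2 x y))
    (hreg : Proto.SmoothUnderIntegral (𝒩.prod (volume : Measure (Coord N)))
      (Ioo τ b ×ˢ M ×ˢ M)
      (fun q (z : ℝ × Coord N × Coord N) =>
        Proto.evolvedKernel (Proto.volDensity fun _ => g) ζ₀ (ζ z.1 q.1 q.2) (w z.1 q.1)
          q.1 q.2 z.2.1 z.2.2))
    -- the Lie-Poisson equation for the canonical Hamiltonian
    (hLP : ∀ᵐ q ∂(𝒩.prod (volume : Measure (Coord N))),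
      Proto.IsLiePoisson M (Proto.volDensity fun _ => g) (Ioo τ b)
        (fun t => Proto.emergenceMomentum
          (Proto.emergenceDensity (Proto.volDensity fun _ => g) ζ₀ (w t q.1) q.1 q.2)
          (Proto.momentum hbar (Proto.sectionOf q.1 q.2 (ζ t q.1 q.2))))
        (fun t => Proto.hamOperator (Proto.canonicalHam (m⁻¹ • g) (A t) (U t))
          (Proto.momentum hbar (Proto.sectionOf q.1 q.2 (ζ t q.1 q.2)))))
    -- the density matrix is the pure state `|ψ_t⟩⟨ψ_t|`
    (ψ : ℝ → Coord N → ℂ)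
    (hψ : ContDiffOn ℝ ∞ (fun z : ℝ × Coord N => ψ z.1 z.2) (Ioo τ b ×ˢ M))
    (hpure : ∀ t ∈ Ioo τ b, ∀ x ∈ M, ∀ y ∈ M,
      Proto.densityMatrix 𝒩 (Proto.volDensity fun _ => g) ζ₀ (ζ t) (w t) x y =
        ψ t x * (starRingEnd ℂ) (ψ t y)) :
    -- where `ψ ≠ 0`: the Schrödinger equation locally, up to a phase depending only on time
    (∀ t₀ ∈ Ioo τ b, ∀ x₀ ∈ M, ψ t₀ x₀ ≠ 0 →
      ∃ θ : ℝ → ℝ, ContDiffAt ℝ ∞ θ t₀ ∧ ∀ᶠ z in 𝓝 (t₀, x₀),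
        Proto.SchrodingerAt hbar
          (fun t => Proto.schrodingerOp hbar m (fun _ => g) (A t) (U t))
          (Proto.rephase θ ψ) z.1 z.2) ∧
    -- globally, unless some `ψ_t` vanishes to infinite order at a point
    ((∀ t ∈ Ioo τ b, ∀ x ∈ M, ∃ n : ℕ, iteratedFDeriv ℝ n (ψ t) x ≠ 0) →
      ∃ θ : ℝ → ℝ, ContDiffOn ℝ ∞ θ (Ioo τ b) ∧ ∀ t ∈ Ioo τ b, ∀ x ∈ M,
        Proto.SchrodingerAt hbar
          (fun t => Proto.schrodingerOp hbar m (fun _ => g) (A t) (U t))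
          (Proto.rephase θ ψ) t x) := by
  have hA' : ∀ k, ContDiffOn ℝ ∞ (fun z : ℝ × Coord N => A z.1 z.2 k) (Ioo τ b ×ˢ M) :=
    contDiffOn_pi.1 hA
  have hTM : IsOpen (Ioo τ b ×ˢ M) := isOpen_Ioo.prod hMo
  set Ψ : ℝ × Coord N → ℂ := fun z => ψ z.1 z.2 with hΨdef
  set G := Proto.schrodingerDefect hbar (m⁻¹ • g) (fun k z => A z.1 z.2 k) (fun z => U z.1 z.2) Ψ
    with hGdef
  have hG : ContDiffOn ℝ ∞ G (Ioo τ b ×ˢ M) :=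
    Proto.contDiffOn_schrodingerDefect hTM hA' hU hψ
  have hquot := fun z hz hne => Proto.defect_div_of_pure (z := z) hhbar.ne' isOpen_Ioo hMo hg hgdet
    hA' hU (hζ.mono fun q hq => hq.1) hw hreg hLP hψ
    (fun z hz => hpure z.1 hz.1 z.2.1 hz.2.1 z.2.2 hz.2.2) hz hne
  have hloc := fun {t₀} (ht₀ : t₀ ∈ Ioo τ b) {x₀} (hx₀ : x₀ ∈ M) (hne : Ψ (t₀, x₀) ≠ 0) =>
    Proto.exists_defect_eq_mul hTM hG hψ hquot ht₀ hx₀ hne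
  -- a primitive of the ratio, divided by `ħ`, removes the defect
  have hfinal : ∀ {t : ℝ} {x : Coord N} {e : ℝ} {θ : ℝ → ℝ}, (t, x) ∈ Ioo τ b ×ˢ M →
      G (t, x) = e * Ψ (t, x) → HasDerivAt θ (e / hbar) t →
      Proto.SchrodingerAt hbar (fun t => Proto.schrodingerOp hbar m (fun _ => g) (A t) (U t))
        (Proto.rephase θ ψ) t x := fun {t x e θ} hz he hθ => by
    have hd : HasDerivAt (fun r => ψ r x) (Proto.dd Proto.dirT Ψ (t, x)) t := by
      have hl : HasDerivAt (fun r : ℝ => (r, x)) ((1 : ℝ), (0 : Coord N)) t :=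
        (hasDerivAt_id t).prodMk (hasDerivAt_const t x)
      exact (Proto.differentiableAt_of_contDiffOn hTM hψ hz).hasFDerivAt.comp_hasDerivAt t hl
    refine Proto.schrodingerAt_rephase hhbar.ne' hd ?_ hθ
    rw [← Proto.schrodingerDefect_eq isOpen_Ioo hMo hg hgdet hA' hψ hz.1 hz.2]
    exact he
  refine ⟨fun t₀ ht₀ x₀ hx₀ hne => ?_, fun hflat => ?_⟩
  · obtain ⟨ε, hε, e, he, hbox⟩ := hloc ht₀ hx₀ hne
    obtain ⟨θ, hθ, hθ'⟩ := Proto.exists_smooth_primitive (he.div_const hbar)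
    have ht₀' : t₀ ∈ Ioo (t₀ - ε) (t₀ + ε) := ⟨by linarith, by linarith⟩
    refine ⟨θ, hθ.contDiffAt (isOpen_Ioo.mem_nhds ht₀'), ?_⟩
    filter_upwards [prod_mem_nhds (isOpen_Ioo.mem_nhds ht₀') (Metric.ball_mem_nhds x₀ hε)]
      with z hz
    obtain ⟨h1, -, h3⟩ := hbox z.1 hz.1 z.2 hz.2
    exact hfinal h1 h3 (hθ' z.1 hz.1)
  · have hslice : ∀ {t}, t ∈ Ioo τ b → ∀ {f : ℝ × Coord N → ℂ},
        ContDiffOn ℝ ∞ f (Ioo τ b ×ˢ M) → ContDiffOn ℝ ∞ (fun y => f (t, y)) M :=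
      fun {t} ht {f} hf => hf.comp (contDiff_const.prodMk contDiff_id).contDiffOn
        fun y hy => ⟨ht, hy⟩
    have hc : ∀ t ∈ Ioo τ b, ∃ c : ℂ, ∀ x ∈ M, G (t, x) = c * ψ t x := fun t ht =>
      Proto.exists_eq_const_mul_of_no_flat_point hMo hMc.isPreconnected
        (hslice ht hψ) (hslice ht hG) (hflat t ht) fun x hx hne => by
          obtain ⟨ε, hε, e, -, hbox⟩ := hloc ht hx hne
          refine ⟨e t, ?_⟩
          filter_upwards [Metric.ball_mem_nhds x hε] with y hy
          exact (hbox t ⟨by linarith, by linarith⟩ y hy).2.2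
    choose! c hc using hc
    -- near `t₀` the constant is the ratio at a fixed point at which `ψ` does not vanish
    have hce : ∀ t₀ ∈ Ioo τ b, ∃ ε > 0, ∃ e : ℝ → ℝ,
        ContDiffOn ℝ ∞ e (Ioo (t₀ - ε) (t₀ + ε)) ∧
        ∀ t ∈ Ioo (t₀ - ε) (t₀ + ε), c t = e t := fun t₀ ht₀ => by
      obtain ⟨x, hx⟩ := hMc.nonempty
      obtain ⟨n, hn⟩ := hflat t₀ ht₀ x hx
      obtain ⟨x₀, hx₀, hne⟩ :=
        Proto.exists_ne_zero_of_iteratedFDeriv_ne_zero hn (hMo.mem_nhds hx)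
      obtain ⟨ε, hε, e, he, hbox⟩ := hloc ht₀ hx₀ hne
      refine ⟨ε, hε, e, he, fun t ht => ?_⟩
      obtain ⟨h1, h2, h3⟩ := hbox t ht x₀ (Metric.mem_ball_self hε)
      exact mul_right_cancel₀ h2 ((hc t h1.1 x₀ h1.2).symm.trans h3)
    have hcs : ContDiffOn ℝ ∞ (fun t => (c t).re) (Ioo τ b) := fun t₀ ht₀ => by
      obtain ⟨ε, hε, e, he, hce⟩ := hce t₀ ht₀
      have hI : Ioo (t₀ - ε) (t₀ + ε) ∈ 𝓝 t₀ := Ioo_mem_nhds (by linarith) (by linarith)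
      refine ((he.contDiffAt hI).congr_of_eventuallyEq ?_).contDiffWithinAt
      filter_upwards [hI] with t ht
      rw [hce t ht, Complex.ofReal_re]
    obtain ⟨θ, hθ, hθ'⟩ := Proto.exists_smooth_primitive (hcs.div_const hbar)
    refine ⟨θ, hθ, fun t ht x hx => hfinal ⟨ht, hx⟩ ?_ (hθ' t ht)⟩
    obtain ⟨ε, hε, e, -, hce⟩ := hce t ht
    rw [hc t ht x hx, hce t ⟨by linarith, by linarith⟩, Complex.ofReal_re]
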